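/- **Setting.** For a topological space $X$ with its Borel $\sigma$-algebra let $\mathscr M_{\le1}(X)$ and $\mathscr P(X)$ be the spaces of measures of total mass at most one and of probability measures, with the weak topology; write $\|\mu\|=\mu(X)$. Let $\mathbb M_0$ be a one-point space and $\mathbb M_{h+1}=\mathscr M_{\le1}(\mathbb M_h)$ for $h\in\mathbb N$. Let $p_{1,0}$ be the trivial map, let $p_{h+2,h+1}(\alpha)=(p_{h+1,h})_*\alpha$, and let $\mathbb M_\infty=\{(\alpha_h)_h\in\prod_{h}\mathbb M_h : p_{h+1,h}(\alpha_{h+1})=\alpha_h \text{ for all } h\}$ with the product topology. For a complete separable metric space $(S,d)$ and $\mu,\nu\in\mathscr M_{\le1}(S)$ the Prokhorov metric is $$\mathsf P(\mu,\nu)=\inf\{\varepsilon>0 : \mu(A)\le\nu(A^\varepsilon)+\varepsilon \text{ and } \nu(A)\le\mu(A^\varepsilon)+\varepsilon \text{ for all Borel } A\},\quad A^\varepsilon=\{y : d(x,y)<\varepsilon\text{ for some }x\in A\},$$ and, if $\|\mu\|\ge\|\nu\|$, the unbalanced Wasserstein metric is $$\mathsf W(\mu,\nu)=\mathsf W(\nu,\mu)=\|\mu\|-\|\nu\|+\inf_\gamma\int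 d\,d\gamma,$$ where $\gamma$ ranges over the measures of mass at most one on $S\times S$ with first marginal $\le\mu$ and second marginal $=\nu$. Let $d_{\mathsf P}^0=0$ on $\mathbb M_0$, let $d_{\mathsf P}^{h+1}$ be the Prokhorov metric on $\mathbb M_{h+1}=\mathscr M_{\le 1}(\mathbb M_h)$ over $(\mathbb M_h,d_{\mathsf P}^h)$, and let $d_{\mathsf P}^\infty(\alpha,\beta)=\sup_{h\ge1}\frac1h d_{\mathsf P}^h(\alpha_h,\beta_h)$ on $\mathbb M_\infty$. For $0\le h\le\infty$ let $\delta_{\mathsf P}^h$ be the Prokhorov metric on $\mathscr P(\mathbb M_h)$ over $(\mathbb M_h,d_{\mathsf P}^h)$. Define $d_{\mathsf W}^h$ and $\delta_{\mathsf W}^h$ in the same way with $\mathsf W$ in place of $\mathsf P$. A graphon is a symmetric measurable function $W:[0,1]^2\to[0,1]$. Put $i_{W,0}(x)$ equal to the point of $\mathbb M_0$ and $i_{W,h+1}(x)(A)=\int_{i_{W,h}^{-1}(A)}W(x,y)\,dy$ for Borel $A\subseteq \mathbb M_h$, and let $i_{W,\infty}(x)=(i_{W,h}(x))_h$. A finite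 nonempty simple graph $G$ with vertices $0,\dots,n-1$ gives the graphon $W_G(x,y)=1$ if $x\in I_u$, $y\in I_v$ for an edge $uv$, and $W_G(x,y)=0$ otherwise, where $I_v=[\frac vn,\frac{v+1}n)$ (the last interval being closed). For $0\le h\le\infty$ let $i_{G,h}(v)=i_{W_G,h}(x)$ for any $x\in I_v$, and let $\nu_{G,h}\in\mathscr P(\mathbb M_h)$ be the push-forward of Lebesgue measure under $i_{W_G,h}$. **Theorem.** 1. Let $0\le h\le\infty$. The distances $d_{\mathsf P}^h$ and $d_{\mathsf W}^h$ are well-defined metrics on $\mathbb M_h$ that metrize its topology, and $\delta_{\mathsf P}^h$ and $\delta_{\mathsf W}^h$ are well-defined metrics on $\mathscr P(\mathbb M_h)$ that metrize its topology. (Well-defined includes: $(\mathbb M_h,d^h)$ is complete and separable, its Borel $\sigma$-algebra is that of $\mathbb M_h$, the infima are over nonempty sets, with an admissible $\gamma$ of finite cost in the case of $\mathsf W$, and the suprema are finite.) 2. For finite graphs $G,H$ with $n,m\ge1$ vertices, vertices $u$ of $G$ and $v$ of $H$, and finite $h$, the numbers $d_{\mathsf P}^h(i_{G,h}(u),i_{H,h}(v))$,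 $\delta_{\mathsf P}^h(\nu_{G,h},\nu_{H,h})$, $d_{\mathsf W}^h(i_{G,h}(u),i_{H,h}(v))$ and $\delta_{\mathsf W}^h(\nu_{G,h},\nu_{H,h})$ are rational and can each be computed exactly from $(G,u,H,v,h)$, respectively $(G,H,h)$, in time polynomial in $n+m+h$. 3. The numbers $d_{\mathsf P}^\infty(i_{G,\infty}(u),i_{H,\infty}(v))$ and $\delta_{\mathsf P}^\infty(\nu_{G,\infty},\nu_{H,\infty})$ are rational and can each be computed exactly in time polynomial in $n+m$. 4. The numbers $d_{\mathsf W}^\infty(i_{G,\infty}(u),i_{H,\infty}(v))$ and $\delta_{\mathsf W}^\infty(\nu_{G,\infty},\nu_{H,\infty})$ can each be computed up to an additive error of $\varepsilon=2^{-k}$ from the graphs (with the vertices) and $k\in\mathbb N$ in time polynomial in $n+m+k$; in particular, for every fixed $\varepsilon>0$, up to an additive error of $\varepsilon$ in time polynomial in $n+m$. Here each computation is by one program, and time is bit complexity. -/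

import Mathlib

open MeasureTheory

noncomputable section

namespace IDMetric

/-! ### Prokhorov metric and unbalanced Wasserstein metric

Both are defined from a bare distance function `d` on a measurable space, so that the iteration
below does not presuppose that the distances obtained are metrics. -/

section MeasureDistances

variable {X : Type} [MeasurableSpace X]

/-- The open `ε`-neighbourhood `{y | d x y < ε for some x ∈ A}` of `A`. -/
def thicken (d : X → X → ℝ) (ε : ℝ) (A : Set X) : Set X := {y | ∃ x ∈ A, d x y < ε}

/-- The set whose infimum is the Prokhorov distance of `μ` and `ν`. -/
def prokhorovRadii (d : X → X → ℝ) (μ ν : Measure X) : Set ℝ :=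
  {ε | 0 < ε ∧ ∀ A : Set X, MeasurableSet A →
    μ A ≤ ν (thicken d ε A) + ENNReal.ofReal ε ∧ ν A ≤ μ (thicken d ε A) + ENNReal.ofReal ε}

/-- The Prokhorov distance. -/
def prokhorov (d : X → X → ℝ) (μ ν : Measure X) : ℝ := sInf (prokhorovRadii d μ ν)

/-- Measures on `X × X` of total mass at most one with first marginal at most `μ` and second
marginal equal to `ν`. -/
def plans (μ ν : Measure X) : Set (Measure (X × X)) :=
  {γ | γ Set.univ ≤ 1 ∧ γ.map Prod.fst ≤ μ ∧ γ.map Prod.snd = ν}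

/-- The transport cost `∫ d dγ`. -/
def cost (d : X → X → ℝ) (γ : Measure (X × X)) : ENNReal :=
  ∫⁻ z, ENNReal.ofReal (d z.1 z.2) ∂γ

open Classical in
/-- The unbalanced Wasserstein distance: the difference of the total masses plus the optimal cost
of transporting a part of the heavier measure onto the lighter one. -/
def wasserstein (d : X → X → ℝ) (μ ν : Measure X) : ℝ :=
  if ν Set.univ ≤ μ Set.univ then
    μ.real Set.univ - ν.real Set.univ + (⨅ γ ∈ plans μ ν, cost d γ).toReal
  else
    ν.real Set.univ - μ.real Set.univ + (⨅ γ ∈ plans ν μ, cost d γ).toReal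

end MeasureDistances

/-! ### The spaces of iterated degree measures -/

/-- The space of measures on `X` of total mass at most one. -/
def SubProb (X : Type) [MeasurableSpace X] : Type := {μ : FiniteMeasure X // μ.mass ≤ 1}

/-- The weak topology. -/
instance (X : Type) [MeasurableSpace X] [TopologicalSpace X] [OpensMeasurableSpace X] :
    TopologicalSpace (SubProb X) :=
  instTopologicalSpaceSubtype

/-- The underlying measure. -/
def SubProb.measure {X : Type} [MeasurableSpace X] (α : SubProb X) : Measure X :=
  (α.1 : Measure X)

/-- The push-forward. -/
def SubProb.push {X Y : Type} [MeasurableSpace X] [MeasurableSpace Y] (f : X → Y)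
    (α : SubProb X) : SubProb Y :=
  ⟨α.1.map f, (FiniteMeasure.mass_map_le f α.1).trans α.2⟩

/-- A topological space together with its Borel σ-algebra. -/
structure BorelSp where
  carrier : Type
  top : TopologicalSpace carrier
  meas : MeasurableSpace carrier
  isBorel : BorelSpace carrier

instance (S : BorelSp) : TopologicalSpace S.carrier := S.top
instance (S : BorelSp) : MeasurableSpace S.carrier := S.meas
instance (S : BorelSp) : BorelSpace S.carrier := S.isBorel

/-- A topological space with its Borel σ-algebra. -/
def BorelSp.of (X : Type) [t : TopologicalSpace X] : BorelSp :=
  ⟨X, t, borel X, @BorelSpace.mk X t (borel X) rfl⟩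

/-- `M₀` is the one-point space and `M_{h+1}` is the space of measures of total mass at most one
on `M_h`, with the weak topology. -/
def idmSpace : ℕ → BorelSp
  | 0 => BorelSp.of Unit
  | h + 1 => BorelSp.of (SubProb (idmSpace h).carrier)

/-- The space `M_h`, for finite `h`. -/
abbrev IDM (h : ℕ) : Type := (idmSpace h).carrier

/-- The projection `p_{h+1,h}`. -/
def proj : (h : ℕ) → IDM (h + 1) → IDM h
  | 0 => fun _ => ((() : Unit) : IDM 0)
  | h + 1 => fun α => SubProb.push (X := IDM (h + 1)) (Y := IDM h) (proj h) α

/-- The space `M = M_∞`: the inverse limit of the spaces `M_h`. -/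
def IDMInf : Type := {α : (h : ℕ) → IDM h // ∀ h, proj h (α (h + 1)) = α h}

instance : TopologicalSpace IDMInf := instTopologicalSpaceSubtype
instance : MeasurableSpace IDMInf := borel IDMInf
instance : BorelSpace IDMInf := ⟨rfl⟩

/-! ### The iterated metrics -/

/-- Iterating a distance between measures, starting with the trivial distance on `M₀`. -/
def iterDist (D : {X : Type} → [MeasurableSpace X] → (X → X → ℝ) → Measure X → Measure X → ℝ) :
    (h : ℕ) → IDM h → IDM h → ℝ
  | 0 => fun _ _ => 0
  | h + 1 => fun α β =>
      D (X := IDM h) (iterDist D h) (SubProb.measure (X := IDM h) α)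
        (SubProb.measure (X := IDM h) β)

/-- `d_P^h` for finite `h`. -/
def dP (h : ℕ) : IDM h → IDM h → ℝ := iterDist prokhorov h

/-- `d_W^h` for finite `h`. -/
def dW (h : ℕ) : IDM h → IDM h → ℝ := iterDist wasserstein h

/-- `d_P = d_P^∞`, the supremum over `h ≥ 1` of `d_P^h / h`. -/
def dPInf (α β : IDMInf) : ℝ := ⨆ h : ℕ, dP (h + 1) (α.1 (h + 1)) (β.1 (h + 1)) / ((h : ℝ) + 1)

/-- `d_W = d_W^∞`, the supremum over `h ≥ 1` of `d_W^h / h`. -/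
def dWInf (α β : IDMInf) : ℝ := ⨆ h : ℕ, dW (h + 1) (α.1 (h + 1)) (β.1 (h + 1)) / ((h : ℝ) + 1)

/-- `δ_P^h` for finite `h`. -/
def deltaP (h : ℕ) (μ ν : ProbabilityMeasure (IDM h)) : ℝ :=
  prokhorov (dP h) (μ : Measure (IDM h)) (ν : Measure (IDM h))

/-- `δ_W^h` for finite `h`. -/
def deltaW (h : ℕ) (μ ν : ProbabilityMeasure (IDM h)) : ℝ :=
  wasserstein (dW h) (μ : Measure (IDM h)) (ν : Measure (IDM h))

/-- `δ_P = δ_P^∞`. -/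
def deltaPInf (μ ν : ProbabilityMeasure IDMInf) : ℝ :=
  prokhorov dPInf (μ : Measure IDMInf) (ν : Measure IDMInf)

/-- `δ_W = δ_W^∞`. -/
def deltaWInf (μ ν : ProbabilityMeasure IDMInf) : ℝ :=
  wasserstein dWInf (μ : Measure IDMInf) (ν : Measure IDMInf)

/-! ### Being a metric, metrizing a topology, being well-defined -/

/-- `d` is a metric and induces the given topology. -/
def Metrizes {X : Type} [t : TopologicalSpace X] (d : X → X → ℝ) : Prop :=
  ∃ m : MetricSpace X, (∀ x y, m.dist x y = d x y) ∧
    m.toUniformSpace.toTopologicalSpace = t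

/-- `d` is a complete separable metric whose Borel σ-algebra is the given σ-algebra. -/
def CompleteSeparable {X : Type} [s : MeasurableSpace X] (d : X → X → ℝ) : Prop :=
  ∃ m : MetricSpace X, (∀ x y, m.dist x y = d x y) ∧
    @CompleteSpace X m.toUniformSpace ∧
    @TopologicalSpace.SeparableSpace X m.toUniformSpace.toTopologicalSpace ∧
    s = @borel X m.toUniformSpace.toTopologicalSpace

/-- The Prokhorov distance over `(X, d)` is well-defined on measures of mass at most one: the
ground space is as required, and the infimum is taken over a nonempty set. -/
def ProkhorovDefined {X : Type} [MeasurableSpace X] (d : X → X → ℝ) : Prop :=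
  CompleteSeparable d ∧
  ∀ μ ν : Measure X, μ Set.univ ≤ 1 → ν Set.univ ≤ 1 → (prokhorovRadii d μ ν).Nonempty

/-- The unbalanced Wasserstein distance over `(X, d)` is well-defined on measures of mass at most
one: the ground space is as required, and there is an admissible plan of finite cost. -/
def WassersteinDefined {X : Type} [MeasurableSpace X] (d : X → X → ℝ) : Prop :=
  CompleteSeparable d ∧
  ∀ μ ν : Measure X, μ Set.univ ≤ 1 → ν Set.univ ≤ μ Set.univ →
    ∃ γ ∈ plans μ ν, cost d γ < ⊤

/-! ### Graphons and their iterated degree measures -/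

/-- A graphon: a symmetric measurable function `[0,1]² → [0,1]`. -/
structure Graphon where
  toFun : unitInterval → unitInterval → ℝ
  measurable : Measurable fun z : unitInterval × unitInterval => toFun z.1 z.2
  symm : ∀ x y, toFun x y = toFun y x
  nonneg : ∀ x y, 0 ≤ toFun x y
  le_one : ∀ x y, toFun x y ≤ 1

/-- The measure with density `W(x, ·)` with respect to Lebesgue measure on `[0,1]`. -/
def Graphon.row (W : Graphon) (x : unitInterval) : Measure unitInterval :=
  (volume : Measure unitInterval).withDensity fun y => ENNReal.ofReal (W.toFun x y)

theorem Graphon.row_univ_le (W : Graphon) (x : unitInterval) : W.row x Set.univ ≤ 1 := by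
  rw [Graphon.row, withDensity_apply _ MeasurableSet.univ, Measure.restrict_univ]
  calc ∫⁻ y, ENNReal.ofReal (W.toFun x y) ≤ ∫⁻ _ : unitInterval, 1 :=
        lintegral_mono fun y => by
          simpa using ENNReal.ofReal_le_ofReal (W.le_one x y)
    _ = 1 := by simp

instance (W : Graphon) (x : unitInterval) : IsFiniteMeasure (W.row x) :=
  ⟨(W.row_univ_le x).trans_lt ENNReal.one_lt_top⟩

/-- The measure `W(x, y) dy` as an element of the space of measures of mass at most one. -/
def Graphon.rowSub (W : Graphon) (x : unitInterval) : SubProb unitInterval :=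
  ⟨⟨W.row x, inferInstance⟩, by
    have h := W.row_univ_le x
    have h2 := FiniteMeasure.ennreal_mass (μ := (⟨W.row x, inferInstance⟩ : FiniteMeasure _))
    exact ENNReal.coe_le_coe.1 (h2.trans_le h)⟩

/-- The map `i_{W,h} : [0,1] → M_h`; the measure `i_{W,h+1}(x)` assigns to `A` the integral of
`W(x, y)` over all `y` with `i_{W,h}(y) ∈ A`. -/
def Graphon.idm (W : Graphon) : (h : ℕ) → unitInterval → IDM h
  | 0 => fun _ => ((() : Unit) : IDM 0)
  | h + 1 => fun x => SubProb.push (Y := IDM h) (W.idm h) (W.rowSub x)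

/-! ### Graphs as graphons -/

/-- The index of the interval that contains `x` in the partition of `[0,1]` into the `n` intervals
`[0, 1/n), [1/n, 2/n), …, [(n-1)/n, 1]`. -/
def block (n : ℕ) [NeZero n] (x : unitInterval) : Fin n :=
  ⟨min ⌊(n : ℝ) * (x : ℝ)⌋₊ (n - 1),
    lt_of_le_of_lt (min_le_right _ _) (Nat.sub_lt (Nat.pos_of_ne_zero (NeZero.ne n)) one_pos)⟩

theorem measurable_block (n : ℕ) [NeZero n] : Measurable (block n) := by
  have h : Measurable fun x : unitInterval => min ⌊(n : ℝ) * (x : ℝ)⌋₊ (n - 1) := by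
    have h1 : Measurable fun x : unitInterval => ⌊(n : ℝ) * (x : ℝ)⌋₊ :=
      Nat.measurable_floor.comp (measurable_subtype_coe.const_mul _)
    exact h1.min measurable_const
  refine measurable_to_countable' fun i => ?_
  have : block n ⁻¹' {i} = (fun x : unitInterval => min ⌊(n : ℝ) * (x : ℝ)⌋₊ (n - 1)) ⁻¹' {i.1} := by
    ext x
    simp [block, Fin.ext_iff]
  rw [this]
  exact h (measurableSet_singleton _)

/-- A function that is constant on the blocks is measurable. -/
theorem measurable_of_block {Y : Type} [MeasurableSpace Y] (n : ℕ) [NeZero n]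
    (f : unitInterval → Y) (hf : ∀ x y, block n x = block n y → f x = f y) : Measurable f := by
  intro s _
  have : f ⁻¹' s = block n ⁻¹' (block n '' (f ⁻¹' s)) := by
    ext x
    constructor
    · intro hx
      exact ⟨x, hx, rfl⟩
    · rintro ⟨y, hy, hxy⟩
      simpa [Set.mem_preimage, ← hf y x hxy] using hy
  rw [this]
  exact measurable_block n (Set.toFinite _).measurableSet

open Classical in
/-- The graphon `W_G` of a graph `G`. -/
def graphon {n : ℕ} [NeZero n] (G : SimpleGraph (Fin n)) : Graphon where
  toFun x y := if G.Adj (block n x) (block n y) then 1 else 0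
  measurable := by
    have h : Measurable fun z : Fin n × Fin n => if G.Adj z.1 z.2 then (1 : ℝ) else 0 :=
      measurable_of_finite _
    exact h.comp (((measurable_block n).comp measurable_fst).prodMk
      ((measurable_block n).comp measurable_snd))
  symm x y := by simp [G.adj_comm]
  nonneg x y := by split_ifs <;> norm_num
  le_one x y := by split_ifs <;> norm_num

theorem idm_graphon_congr {n : ℕ} [NeZero n] (G : SimpleGraph (Fin n)) (h : ℕ)
    (x y : unitInterval) (hxy : block n x = block n y) :
    (graphon G).idm h x = (graphon G).idm h y := by
  cases h with
  | zero => rfl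
  | succ h =>
    have : (graphon G).rowSub x = (graphon G).rowSub y := by
      apply Subtype.ext
      apply Subtype.ext
      show (graphon G).row x = (graphon G).row y
      have h1 : (graphon G).toFun x = (graphon G).toFun y := by
        funext z
        simp only [graphon]
        rw [hxy]
      simp only [Graphon.row, h1]
    show SubProb.push (Y := IDM h) _ ((graphon G).rowSub x) = _
    rw [this]
    rfl

theorem measurable_idm_graphon {n : ℕ} [NeZero n] (G : SimpleGraph (Fin n)) (h : ℕ) :
    Measurable ((graphon G).idm h) :=
  measurable_of_block n _ (idm_graphon_congr G h)

theorem continuous_proj (h : ℕ) : Continuous (proj h) := by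
  induction h with
  | zero => exact continuous_const
  | succ h ih =>
    have h1 : Continuous fun α : SubProb (IDM (h + 1)) => α.1.map (proj h) :=
      (FiniteMeasure.continuous_map ih).comp continuous_subtype_val
    exact h1.subtype_mk _

theorem proj_idm_graphon {n : ℕ} [NeZero n] (G : SimpleGraph (Fin n)) (h : ℕ)
    (x : unitInterval) : proj h ((graphon G).idm (h + 1) x) = (graphon G).idm h x := by
  induction h generalizing x with
  | zero => rfl
  | succ h ih =>
    apply Subtype.ext
    apply Subtype.ext
    show Measure.map (proj h) (Measure.map ((graphon G).idm (h + 1)) ((graphon G).row x)) =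
      Measure.map ((graphon G).idm h) ((graphon G).row x)
    rw [Measure.map_map (continuous_proj h).measurable (measurable_idm_graphon G (h + 1))]
    congr 1
    funext y
    exact ih y

/-- `i_{W_G} : [0,1] → M`. -/
def idmInf {n : ℕ} [NeZero n] (G : SimpleGraph (Fin n)) (x : unitInterval) : IDMInf :=
  ⟨fun h => (graphon G).idm h x, fun h => proj_idm_graphon G h x⟩

theorem measurable_idmInf {n : ℕ} [NeZero n] (G : SimpleGraph (Fin n)) :
    Measurable (idmInf G) :=
  measurable_of_block n _ fun x y hxy =>
    Subtype.ext (funext fun h => idm_graphon_congr G h x y hxy)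

/-- `ν_{G,h}`: the distribution of the iterated degree measures of `W_G` after `h` rounds. -/
def didm {n : ℕ} [NeZero n] (G : SimpleGraph (Fin n)) (h : ℕ) : ProbabilityMeasure (IDM h) :=
  ⟨(volume : Measure unitInterval).map ((graphon G).idm h),
    Measure.isProbabilityMeasure_map (measurable_idm_graphon G h).aemeasurable⟩

/-- `ν_G = ν_{G,∞}`: the distribution of the iterated degree measures of `W_G`. -/
def didmInf {n : ℕ} [NeZero n] (G : SimpleGraph (Fin n)) : ProbabilityMeasure IDMInf :=
  ⟨(volume : Measure unitInterval).map (idmInf G),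
    Measure.isProbabilityMeasure_map (measurable_idmInf G).aemeasurable⟩

/-- The left end point `v/n` of the interval `I_v`, which represents the vertex `v`. -/
def point {n : ℕ} (v : Fin n) : unitInterval :=
  ⟨(v : ℝ) / n, by positivity,
    div_le_one_of_le₀ (by exact_mod_cast v.2.le) (Nat.cast_nonneg n)⟩

theorem block_point {n : ℕ} [NeZero n] (v : Fin n) : block n (point v) = v := by
  have hn : (n : ℝ) ≠ 0 := by exact_mod_cast NeZero.ne n
  have h : (n : ℝ) * ((point v : unitInterval) : ℝ) = (v.1 : ℝ) := by
    show (n : ℝ) * ((v.1 : ℝ) / n) = v.1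
    field_simp
  apply Fin.ext
  show min ⌊(n : ℝ) * ((point v : unitInterval) : ℝ)⌋₊ (n - 1) = v.1
  rw [h, Nat.floor_natCast]
  have := v.2
  omega

/-- All points of the interval `I_v` have the same iterated degree measures as the point that
represents `v`. -/
theorem idm_eq_point {n : ℕ} [NeZero n] (G : SimpleGraph (Fin n)) (h : ℕ) (x : unitInterval)
    (v : Fin n) (hx : block n x = v) : (graphon G).idm h x = (graphon G).idm h (point v) :=
  idm_graphon_congr G h x (point v) (by rw [hx, block_point])

/-! ### A machine model with bit cost

Programs of a first-order functional language act on binary trees with natural numbers at the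
leaves. Every operation is charged the number of bits of all data that it reads or writes (a
whole tree, if it is given a whole tree), so that running times agree with those of Turing machines
up to a polynomial. -/

/-- Binary trees with natural numbers at the leaves. -/
inductive Data
  | num (n : ℕ) : Data
  | pair (a b : Data) : Data

/-- The number of bits that it takes to write a datum down, up to a constant factor. -/
def Data.size : Data → ℕ
  | .num n => n.size + 1
  | .pair a b => a.size + b.size + 1

/-- Basic operations. -/
inductive Op
  | id | const (n : ℕ) | fst | snd | isPair | add | sub | mul | div

/-- The result of a basic operation; operations that do not apply to their argument return `0`.
Subtraction is truncated, division is rounded down. -/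
def Op.eval : Op → Data → Data
  | .id, x => x
  | .const n, _ => .num n
  | .fst, .pair a _ => a
  | .snd, .pair _ b => b
  | .isPair, .pair _ _ => .num 1
  | .add, .pair (.num a) (.num b) => .num (a + b)
  | .sub, .pair (.num a) (.num b) => .num (a - b)
  | .mul, .pair (.num a) (.num b) => .num (a * b)
  | .div, .pair (.num a) (.num b) => .num (a / b)
  | _, _ => .num 0

/-- Programs. -/
inductive Prog
  | op (o : Op) : Prog
  | comp (g f : Prog) : Prog
  | pair (f g : Prog) : Prog
  | ite (c f g : Prog) : Prog
  | while (c f : Prog) : Prog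

/-- `Runs f x y t`: on input `x` the program `f` halts with output `y` after time `t`. A condition
counts as true if its value is not `0`. -/
inductive Runs : Prog → Data → Data → ℕ → Prop
  | op (o : Op) (x : Data) : Runs (.op o) x (o.eval x) (x.size + (o.eval x).size)
  | comp {g f : Prog} {x y z : Data} {s t : ℕ} :
      Runs f x y s → Runs g y z t → Runs (.comp g f) x z (s + t)
  | pair {f g : Prog} {x y z : Data} {s t : ℕ} :
      Runs f x y s → Runs g x z t → Runs (.pair f g) x (.pair y z) (x.size + s + t)
  | iteTrue {c f g : Prog} {x b y : Data} {s t : ℕ} :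
      Runs c x b s → b ≠ .num 0 → Runs f x y t → Runs (.ite c f g) x y (x.size + s + t)
  | iteFalse {c f g : Prog} {x y : Data} {s t : ℕ} :
      Runs c x (.num 0) s → Runs g x y t → Runs (.ite c f g) x y (x.size + s + t)
  | whileTrue {c f : Prog} {x b y z : Data} {s t r : ℕ} :
      Runs c x b s → b ≠ .num 0 → Runs f x y t → Runs (.while c f) y z r →
      Runs (.while c f) x z (x.size + s + t + r)
  | whileFalse {c f : Prog} {x : Data} {s : ℕ} :
      Runs c x (.num 0) s → Runs (.while c f) x x (x.size + s)

/-- The real numbers `F i` are rational and are computed exactly, each as a numerator and a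
denominator, by one program whose time on instance `i` is polynomial in `size i`. -/
def PolyTime {ι : Type} (enc : ι → Data) (size : ι → ℕ) (F : ι → ℝ) : Prop :=
  ∃ (f : Prog) (p : Polynomial ℕ), ∀ i : ι, ∃ a b t : ℕ,
    Runs f (enc i) (.pair (.num a) (.num b)) t ∧ t ≤ p.eval (size i) ∧
    0 < b ∧ F i = (a : ℝ) / b

/-- There is one program that, given an instance `i` and a natural number `k`, computes a rational
number `a / b` with `|F i - a / b| ≤ 2⁻ᵏ`, in time polynomial in `size i` and `k`. -/
def PolyTimeApprox {ι : Type} (enc : ι → Data) (size : ι → ℕ) (F : ι → ℝ) : Prop :=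
  ∃ (f : Prog) (p : Polynomial ℕ), ∀ (i : ι) (k : ℕ), ∃ a b t : ℕ,
    Runs f (.pair (enc i) (.num k)) (.pair (.num a) (.num b)) t ∧ t ≤ p.eval (size i + k) ∧
    0 < b ∧ |F i - (a : ℝ) / b| ≤ (1 / 2 : ℝ) ^ k

/-! ### Graphs as input -/

/-- Lists as trees. -/
def encList : List Data → Data
  | [] => .num 0
  | a :: l => .pair a (encList l)

open Classical in
/-- A graph is given by its number of vertices and its adjacency matrix. -/
def encGraph {n : ℕ} (G : SimpleGraph (Fin n)) : Data :=
  .pair (.num n) (encList (List.ofFn fun i : Fin n =>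
    encList (List.ofFn fun j : Fin n => .num (if G.Adj i j then 1 else 0))))

/-- Two graphs. -/
structure GraphPair where
  n : ℕ
  m : ℕ
  hn : NeZero n
  hm : NeZero m
  G : SimpleGraph (Fin n)
  H : SimpleGraph (Fin m)

instance (I : GraphPair) : NeZero I.n := I.hn
instance (I : GraphPair) : NeZero I.m := I.hm

/-- Two graphs with a distinguished vertex in each. -/
structure VertexPair extends GraphPair where
  u : Fin n
  v : Fin m

/-- The numbers of vertices together. -/
def GraphPair.size (I : GraphPair) : ℕ := I.n + I.m

def GraphPair.enc (I : GraphPair) : Data := .pair (encGraph I.G) (encGraph I.H)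

def VertexPair.enc (I : VertexPair) : Data :=
  .pair I.toGraphPair.enc (.pair (.num I.u) (.num I.v))

/-- An instance together with a number of rounds `h`. -/
def withRounds {ι : Type} (enc : ι → Data) (i : ι × ℕ) : Data := .pair (enc i.1) (.num i.2)

end IDMetric

end

noncomputable section

namespace IDMetric

/-! ### Polynomially bounded functions and polynomial-time functions -/

/-! The metric statements rest on compactness. Over a compact metric space of diameter at most one,
the measures of mass at most one, and the probability measures, form compact spaces in the weak
topology. If a metric on such a space is continuous for the weak topology, the identity is a
continuous bijection from a compact to a Hausdorff space and hence a homeomorphism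
(`metrizes_of_compact`). So it suffices to check `WeakMetric` for both distances and to induct on
the depth; in the inverse limit, depths beyond `N` contribute at most about `1/N` to the supremum.

The unbalanced Wasserstein distance is handled in a symmetric form: the infimum, over plans whose
two marginals are only dominated by the given measures, of the cost plus the two untransported
masses. Diameter at most one makes this the same number, and plans of this kind can be glued
(`PartialPlan.glue`), which gives the triangle inequality. Weak continuity comes from partitions of
unity. A Wasserstein distance below `ε ^ 2` forces a Prokhorov distance of at most `ε`; this carries
continuity over to Prokhorov and separation of measures over to Wasserstein.

For graphs, all measures have finitely many atoms, of mass `1/n` or `1/m`. Each vertex is duplicated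
so that there are `n * m` points on either side, and non-neighbours serve as dummies, which cost 0
against dummies and 1 against neighbours. By Birkhoff's theorem the Wasserstein distance is then a
minimum over permutations (`OT`, `wasserstein_atoms`); by Hall's theorem with deficiency, a finite
form of Strassen's theorem, the Prokhorov distance is the threshold version `PV`
(`prokhorov_atoms`). The iterated distances thus obey the finite recursion `iterV`.

Each step of the recursion is a minimum-cost assignment problem, solved exactly by an auction with
cost scaling (`assign_spec`); for `PV` it is solved for each of `n * m + 1` thresholds. After `k`
rounds all values have the denominator `(n * m) ^ k`, so the numbers stay short.

For infinite depth, the Prokhorov iterates increase and are multiples of `1 / (n * m)`, so they are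
stationary after `(n * m) ^ 2` rounds (`iterV_PV_const`). The Wasserstein recursion contracts by the
factor `1 - 1 / n`, because no vertex is its own neighbour (`OT_costR_le`); `n * (k + 1)` rounds
leave an error of at most `2⁻ᵏ`. -/

theorem polyEval_mono (p : Polynomial ℕ) {a b : ℕ} (h : a ≤ b) : p.eval a ≤ p.eval b := by
  rw [Polynomial.eval_eq_sum, Polynomial.eval_eq_sum]
  exact Finset.sum_le_sum fun i _ => Nat.mul_le_mul_left _ (Nat.pow_le_pow_left h i)

/-- `g` is bounded by a polynomial in `s`. -/
def PolyBdd {α : Type} (s g : α → ℕ) : Prop := ∃ p : Polynomial ℕ, ∀ x, g x ≤ p.eval (s x)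

namespace PolyBdd
variable {α β : Type} {s g g' : α → ℕ}

theorem mono (h : PolyBdd s g') (hg : ∀ x, g x ≤ g' x) : PolyBdd s g :=
  h.imp fun _ hp x => (hg x).trans (hp x)

theorem self : PolyBdd s s := ⟨Polynomial.X, fun x => by simp⟩

theorem const (c : ℕ) : PolyBdd s fun _ => c := ⟨Polynomial.C c, fun _ => by simp⟩

theorem add (h : PolyBdd s g) (h' : PolyBdd s g') : PolyBdd s fun x => g x + g' x := by
  obtain ⟨p, hp⟩ := h
  obtain ⟨q, hq⟩ := h'
  exact ⟨p + q, fun x => by simpa using add_le_add (hp x) (hq x)⟩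

theorem mul (h : PolyBdd s g) (h' : PolyBdd s g') : PolyBdd s fun x => g x * g' x := by
  obtain ⟨p, hp⟩ := h
  obtain ⟨q, hq⟩ := h'
  exact ⟨p * q, fun x => by simpa using Nat.mul_le_mul (hp x) (hq x)⟩

theorem eval (h : PolyBdd s g) (p : Polynomial ℕ) : PolyBdd s fun x => p.eval (g x) := by
  obtain ⟨q, hq⟩ := h
  exact ⟨p.comp q, fun x => by simpa using polyEval_mono p (hq x)⟩

theorem trans (h : PolyBdd s g) (h' : PolyBdd g g') : PolyBdd s g' := by
  obtain ⟨q, hq⟩ := h'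
  exact (h.eval q).mono hq

theorem comp (h : PolyBdd s g) (f : β → α) : PolyBdd (fun x => s (f x)) (fun x => g (f x)) :=
  h.imp fun _ hp _ => hp _

end PolyBdd

/-- Types whose elements are written as data. -/
class Enc (α : Type) where
  enc : α → Data

open Enc

/-- The size of the encoding. -/
def sz {α : Type} [Enc α] (x : α) : ℕ := (enc x).size

instance : Enc ℕ := ⟨.num⟩
instance {α β : Type} [Enc α] [Enc β] : Enc (α × β) := ⟨fun x => .pair (enc x.1) (enc x.2)⟩
instance {α : Type} [Enc α] : Enc (List α) := ⟨fun l => encList (l.map enc)⟩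

theorem enc_nat (n : ℕ) : enc n = .num n := rfl
theorem enc_nil {α : Type} [Enc α] : enc ([] : List α) = .num 0 := rfl
theorem enc_prod {α β : Type} [Enc α] [Enc β] (x : α × β) :
    enc x = .pair (enc x.1) (enc x.2) := rfl

theorem one_le_size (d : Data) : 1 ≤ d.size := by cases d <;> simp [Data.size]

theorem sz_nat (n : ℕ) : sz n = n.size + 1 := rfl
theorem sz_prod {α β : Type} [Enc α] [Enc β] (x : α × β) : sz x = sz x.1 + sz x.2 + 1 := rfl
theorem sz_nil {α : Type} [Enc α] : sz ([] : List α) = 1 := rfl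
theorem sz_cons {α : Type} [Enc α] (a : α) (l : List α) : sz (a :: l) = sz a + sz l + 1 := rfl
theorem one_le_sz {α : Type} [Enc α] (x : α) : 1 ≤ sz x := one_le_size _

theorem sz_nat_le (n : ℕ) : sz n ≤ n + 1 := by
  rw [sz_nat, add_le_add_iff_right, Nat.size_le]
  exact Nat.lt_two_pow_self

theorem length_le_sz {α : Type} [Enc α] (l : List α) : l.length ≤ sz l := by
  induction l with
  | nil => simp
  | cons a l ih => rw [sz_cons, List.length_cons]; omega

theorem sz_le_of_forall {α : Type} [Enc α] (l : List α) (b : ℕ) (h : ∀ a ∈ l, sz a ≤ b) :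
    sz l ≤ l.length * (b + 1) + 1 := by
  induction l with
  | nil => simp [sz_nil]
  | cons a l ih =>
    have h1 := h a (by simp)
    have h2 := ih fun c hc => h c (by simp [hc])
    rw [sz_cons, List.length_cons, add_mul]
    omega

theorem sz_le_of_mem {α : Type} [Enc α] {l : List α} {a : α} (h : a ∈ l) : sz a ≤ sz l := by
  induction l with
  | nil => simp at h
  | cons b l ih =>
    rw [sz_cons]
    rcases List.mem_cons.1 h with rfl | h
    · omega
    · have := ih h
      omega

theorem sz_append_le {α : Type} [Enc α] (l l' : List α) : sz l ≤ sz (l ++ l') := by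
  induction l with
  | nil => exact one_le_sz _
  | cons a l ih => rw [List.cons_append, sz_cons, sz_cons]; omega

/-- `f` is computed by a program in time polynomial in the size of the argument. -/
@[fun_prop]
def PT {α β : Type} [Enc α] [Enc β] (f : α → β) : Prop :=
  ∃ (P : Prog) (p : Polynomial ℕ), ∀ x, ∃ t, Runs P (enc x) (enc (f x)) t ∧ t ≤ p.eval (sz x)

/-- `f` is computed by a program in time polynomial in `s`. -/
def PTOn {α β : Type} [Enc α] [Enc β] (s : α → ℕ) (f : α → β) : Prop :=
  ∃ (P : Prog) (p : Polynomial ℕ), ∀ x, ∃ t, Runs P (enc x) (enc (f x)) t ∧ t ≤ p.eval (s x)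

/-- `g` is bounded by a polynomial in the size of the argument. -/
abbrev SB {α : Type} [Enc α] (g : α → ℕ) : Prop := PolyBdd sz g

/-- Every operation is charged for what it writes, so a result exceeds its argument by less than the
running time. Intermediate values therefore have polynomial size, which is what makes compositions
polynomial. -/
theorem Runs.size_lt {f : Prog} {x y : Data} {t : ℕ} (h : Runs f x y t) : y.size < x.size + t := by
  induction h with
  | op o x =>
    have := one_le_size x
    omega
  | comp _ _ h1 h2 => omega
  | pair _ _ h1 h2 => simp only [Data.size] at *; omega
  | iteTrue _ _ _ _ h2 => omega
  | iteFalse _ _ _ h2 => omega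
  | whileTrue _ _ _ _ _ h2 h3 => omega
  | @whileFalse _ _ x _ _ _ =>
    have := one_le_size x
    omega

/-- A loop whose states and whose costs per step are bounded. -/
theorem Runs.while_seq {c f : Prog} (s : ℕ → Data) (k B : ℕ)
    (hs : ∀ i ≤ k, (s i).size ≤ B)
    (hc : ∀ i < k, ∃ b t, Runs c (s i) b t ∧ b ≠ .num 0 ∧ t ≤ B)
    (hf : ∀ i < k, ∃ t, Runs f (s i) (s (i + 1)) t ∧ t ≤ B)
    (hk : ∃ t, Runs c (s k) (.num 0) t ∧ t ≤ B) :
    ∃ t, Runs (.while c f) (s 0) (s k) t ∧ t ≤ (k + 1) * (3 * B) := by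
  induction k generalizing s with
  | zero =>
    obtain ⟨t, ht, htB⟩ := hk
    have := hs 0 le_rfl
    exact ⟨_, .whileFalse ht, by omega⟩
  | succ k ih =>
    obtain ⟨t, ht, htB⟩ := ih (fun i => s (i + 1)) (fun i hi => hs _ (by omega))
      (fun i hi => hc _ (by omega)) (fun i hi => hf _ (by omega)) hk
    obtain ⟨b, t1, h1, hb, h1B⟩ := hc 0 (by omega)
    obtain ⟨t2, h2, h2B⟩ := hf 0 (by omega)
    have := hs 0 (by omega)
    -- The state, the test and the body cost at most `B` each, whence the factor 3.
    exact ⟨_, .whileTrue h1 hb h2 ht, by linarith⟩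

/-! ### Closure properties of polynomial-time functions. -/

namespace PT
variable {α β γ δ σ : Type} [Enc α] [Enc β] [Enc γ] [Enc δ] [Enc σ]

theorem congr {f g : α → β} (hf : PT f) (h : ∀ x, g x = f x) : PT g := by
  rwa [show g = f from funext h]

theorem sb {f : α → β} (hf : PT f) : SB fun x => sz (f x) := by
  obtain ⟨P, p, h⟩ := hf
  refine ⟨Polynomial.X + p, fun x => ?_⟩
  obtain ⟨t, ht, htp⟩ := h x
  have := ht.size_lt
  simp only [Polynomial.eval_add, Polynomial.eval_X]
  change (enc (f x)).size ≤ (enc x).size + _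
  omega

/-- An operation costs the sizes of its argument and its value, so only the size of the value needs
a bound. -/
theorem ofOp (o : Op) {f : α → β} (h : ∀ x, enc (f x) = o.eval (enc x))
    (hb : SB fun x => sz (f x)) : PT f := by
  obtain ⟨p, hp⟩ := PolyBdd.self.add hb
  refine ⟨.op o, p, fun x => ⟨_, ?_, hp x⟩⟩
  have := Runs.op o (enc x)
  rw [← h x] at this
  exact this

/-- Functions that do not change the encoding. -/
theorem ofEnc {f : α → β} (h : ∀ x, enc (f x) = enc x) : PT f :=
  ofOp .id (fun x => (h x).trans (by cases enc x <;> rfl))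
    (PolyBdd.self.mono fun x => by simp [sz, h])

@[fun_prop]
theorem id : PT fun x : α => x := ofEnc fun _ => rfl

@[fun_prop]
theorem comp {g : β → γ} {f : α → β} (hg : PT g) (hf : PT f) : PT fun x => g (f x) := by
  obtain ⟨q, hq⟩ := hf.sb
  obtain ⟨P, p, h⟩ := hf
  obtain ⟨P', p', h'⟩ := hg
  refine ⟨.comp P' P, p + p'.comp q, fun x => ?_⟩
  obtain ⟨s, hs, hsp⟩ := h x
  obtain ⟨t, ht, htp⟩ := h' (f x)
  refine ⟨_, .comp hs ht, ?_⟩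
  have : p'.eval (sz (f x)) ≤ _ := polyEval_mono p' (hq x)
  simp only [Polynomial.eval_add, Polynomial.eval_comp]
  omega

@[fun_prop]
theorem prodMk {f : α → β} {g : α → γ} (hf : PT f) (hg : PT g) : PT fun x => (f x, g x) := by
  obtain ⟨P, p, h⟩ := hf
  obtain ⟨P', p', h'⟩ := hg
  refine ⟨.pair P P', Polynomial.X + p + p', fun x => ?_⟩
  obtain ⟨s, hs, hsp⟩ := h x
  obtain ⟨t, ht, htp⟩ := h' x
  refine ⟨_, .pair hs ht, ?_⟩
  simp only [Polynomial.eval_add, Polynomial.eval_X]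
  change (enc x).size + _ + _ ≤ (enc x).size + _ + _
  omega

/-- The basic constants are numbers only; other trees are assembled by pairing, with linear cost in
the ignored argument. -/
theorem exists_const (d : Data) : ∃ P : Prog, ∃ C : ℕ, ∀ x : Data, ∃ t, Runs P x d t ∧
    t ≤ C * (x.size + 1) := by
  induction d with
  | num n =>
    refine ⟨.op (.const n), (Data.num n).size + 1, fun x => ⟨_, .op _ _, ?_⟩⟩
    have : (Op.const n).eval x = .num n := by cases x <;> rfl
    rw [this]
    nlinarith
  | pair a b iha ihb =>
    obtain ⟨P, C, h⟩ := iha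
    obtain ⟨Q, D, h'⟩ := ihb
    refine ⟨.pair P Q, C + D + 1, fun x => ?_⟩
    obtain ⟨s, hs, hsp⟩ := h x
    obtain ⟨t, ht, htp⟩ := h' x
    exact ⟨_, .pair hs ht, by nlinarith⟩

@[fun_prop]
theorem const (c : β) : PT fun _ : α => c := by
  obtain ⟨P, C, h⟩ := exists_const (enc c)
  refine ⟨P, Polynomial.C C * (Polynomial.X + 1), fun x => ?_⟩
  obtain ⟨t, ht, htp⟩ := h (enc x)
  exact ⟨t, ht, by simpa [sz] using htp⟩

@[fun_prop]
theorem fst {f : α → β × γ} (hf : PT f) : PT fun x => (f x).1 :=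
  comp (ofOp (f := fun x : β × γ => x.1) .fst (fun _ => rfl)
    (PolyBdd.self.mono fun x => by rw [sz_prod]; omega)) hf

@[fun_prop]
theorem snd {f : α → β × γ} (hf : PT f) : PT fun x => (f x).2 :=
  comp (ofOp (f := fun x : β × γ => x.2) .snd (fun _ => rfl)
    (PolyBdd.self.mono fun x => by rw [sz_prod]; omega)) hf

theorem size_add_le (a b : ℕ) : (a + b).size ≤ a.size + b.size + 1 := by
  rw [Nat.size_le]
  have h1 := Nat.lt_size_self a
  have h2 := Nat.lt_size_self b
  have h3 : 2 ^ a.size ≤ 2 ^ (a.size + b.size) := Nat.pow_le_pow_right (by simp) (by omega)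
  have h4 : 2 ^ b.size ≤ 2 ^ (a.size + b.size) := Nat.pow_le_pow_right (by simp) (by omega)
  rw [pow_succ]
  omega

theorem size_mul_le (a b : ℕ) : (a * b).size ≤ a.size + b.size := by
  rw [Nat.size_le, pow_add]
  exact Nat.mul_lt_mul'' (Nat.lt_size_self a) (Nat.lt_size_self b)

@[fun_prop]
theorem add {f g : α → ℕ} (hf : PT f) (hg : PT g) : PT fun x => f x + g x :=
  comp (ofOp (f := fun x : ℕ × ℕ => x.1 + x.2) .add (fun _ => rfl)
    (PolyBdd.self.mono fun x => by
      have := size_add_le x.1 x.2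
      simp only [sz_prod, sz_nat]
      omega)) (prodMk hf hg)

@[fun_prop]
theorem mul {f g : α → ℕ} (hf : PT f) (hg : PT g) : PT fun x => f x * g x :=
  comp (ofOp (f := fun x : ℕ × ℕ => x.1 * x.2) .mul (fun _ => rfl)
    (PolyBdd.self.mono fun x => by
      have := size_mul_le x.1 x.2
      simp only [sz_prod, sz_nat]
      omega)) (prodMk hf hg)

@[fun_prop]
theorem sub {f g : α → ℕ} (hf : PT f) (hg : PT g) : PT fun x => f x - g x :=
  comp (ofOp (f := fun x : ℕ × ℕ => x.1 - x.2) .sub (fun _ => rfl)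
    (PolyBdd.self.mono fun x => by
      have := Nat.size_le_size (Nat.sub_le x.1 x.2)
      simp only [sz_prod, sz_nat]
      omega)) (prodMk hf hg)

@[fun_prop]
theorem div {f g : α → ℕ} (hf : PT f) (hg : PT g) : PT fun x => f x / g x :=
  comp (ofOp (f := fun x : ℕ × ℕ => x.1 / x.2) .div (fun _ => rfl)
    (PolyBdd.self.mono fun x => by
      have := Nat.size_le_size (Nat.div_le_self x.1 x.2)
      simp only [sz_prod, sz_nat]
      omega)) (prodMk hf hg)

@[fun_prop]
theorem mod {f g : α → ℕ} (hf : PT f) (hg : PT g) : PT fun x => f x % g x :=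
  congr (f := fun x => f x - f x / g x * g x) (by fun_prop) fun x => by
    have := Nat.div_add_mod (f x) (g x)
    rw [mul_comm] at this
    omega

theorem ite_zero {c : α → ℕ} {f g : α → β} (hc : PT c) (hf : PT f) (hg : PT g) :
    PT fun x => if c x = 0 then g x else f x := by
  obtain ⟨P, p, h⟩ := hc
  obtain ⟨P', p', h'⟩ := hf
  obtain ⟨P'', p'', h''⟩ := hg
  refine ⟨.ite P P' P'', Polynomial.X + p + p' + p'', fun x => ?_⟩
  obtain ⟨s, hs, hsp⟩ := h x
  simp only [Polynomial.eval_add, Polynomial.eval_X]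
  by_cases hx : c x = 0
  · obtain ⟨t, ht, htp⟩ := h'' x
    rw [if_pos hx]
    rw [hx] at hs
    refine ⟨_, .iteFalse hs ht, ?_⟩
    change (enc x).size + _ + _ ≤ (enc x).size + _ + _ + _
    omega
  · obtain ⟨t, ht, htp⟩ := h' x
    rw [if_neg hx]
    refine ⟨_, .iteTrue hs (by simpa [enc_nat] using hx) ht, ?_⟩
    change (enc x).size + _ + _ ≤ (enc x).size + _ + _ + _
    omega

@[fun_prop]
theorem ite_eq {a b : α → ℕ} {f g : α → β} (ha : PT a) (hb : PT b) (hf : PT f) (hg : PT g) :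
    PT fun x => if a x = b x then f x else g x :=
  -- Subtraction is truncated, so both differences vanish exactly when the numbers are equal.
  congr (ite_zero (c := fun x => (a x - b x) + (b x - a x)) (by fun_prop) hg hf) fun x =>
    if_congr (by omega) rfl rfl

@[fun_prop]
theorem ite_le {a b : α → ℕ} {f g : α → β} (ha : PT a) (hb : PT b) (hf : PT f) (hg : PT g) :
    PT fun x => if a x ≤ b x then f x else g x :=
  congr (ite_zero (c := fun x => a x - b x) (by fun_prop) hg hf) fun x =>
    if_congr (by omega) rfl rfl

@[fun_prop]
theorem ite_lt {a b : α → ℕ} {f g : α → β} (ha : PT a) (hb : PT b) (hf : PT f) (hg : PT g) :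
    PT fun x => if a x < b x then f x else g x :=
  congr (ite_le hb ha hg hf) fun x => by
    by_cases h : a x < b x
    · rw [if_pos h, if_neg (by omega)]
    · rw [if_neg h, if_pos (by omega)]

@[fun_prop]
theorem min {f g : α → ℕ} (hf : PT f) (hg : PT g) : PT fun x => min (f x) (g x) :=
  congr (ite_le hf hg hf hg) fun x => by rw [min_def]

@[fun_prop]
theorem max {f g : α → ℕ} (hf : PT f) (hg : PT g) : PT fun x => max (f x) (g x) :=
  congr (ite_le hf hg hg hf) fun x => by rw [max_def]

@[fun_prop]
theorem cons {f : α → β} {g : α → List β} (hf : PT f) (hg : PT g) : PT fun x => f x :: g x :=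
  comp (ofEnc (f := fun x : β × List β => x.1 :: x.2) fun _ => rfl) (prodMk hf hg)

@[fun_prop]
theorem tail {f : α → List β} (hf : PT f) : PT fun x => (f x).tail := by
  refine comp (ofOp (f := fun x : List β => x.tail) .snd ?_ (PolyBdd.self.mono ?_)) hf
  · rintro (_ | ⟨a, l⟩) <;> rfl
  · rintro (_ | ⟨a, l⟩)
    · rfl
    · simp only [List.tail_cons, sz_cons]
      omega

/-- The first element of a nonempty list; the value at the empty list is written as `0`. -/
theorem headD {d : β} (hd : enc d = .num 0) {f : α → List β} (hf : PT f) :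
    PT fun x => (f x).headD d := by
  refine comp (ofOp (f := fun x : List β => x.headD d) .fst ?_ (PolyBdd.self.mono ?_)) hf
  · rintro (_ | ⟨a, l⟩)
    · exact hd
    · rfl
  · rintro (_ | ⟨a, l⟩)
    · simp [sz, hd, enc_nil]
    · simp only [List.headD_cons, sz_cons]
      omega

/-- Nonempty lists are written as pairs and the empty list as a number; this serves as a loop test.
-/
theorem isNil {f : α → List β} (hf : PT f) : PT fun x => if (f x).isEmpty then 0 else 1 := by
  refine comp (ofOp (f := fun x : List β => if x.isEmpty then 0 else 1) .isPair ?_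
    ((PolyBdd.const 2).mono ?_)) hf
  · rintro (_ | ⟨a, l⟩) <;> rfl
  · rintro (_ | ⟨a, l⟩) <;> simp [sz_nat]

/-- A loop of polynomially many steps through states of polynomial size. -/
theorem whileLoopOn {s : α → ℕ} {c : σ → ℕ} {f : σ → σ} {g : α → σ} {k b : α → ℕ} (hc : PT c)
    (hf : PT f) (hg : PTOn s g) (hk : PolyBdd s k) (hb : PolyBdd s b) (hs : ∀ x, ∀ i ≤ k x, sz (f^[i] (g x)) ≤ b x)
    (h1 : ∀ x, ∀ i < k x, c (f^[i] (g x)) ≠ 0) (h0 : ∀ x, c (f^[k x] (g x)) = 0) :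
    PTOn s fun x => f^[k x] (g x) := by
  obtain ⟨Pc, pc, Hc⟩ := hc
  obtain ⟨Pf, pf, Hf⟩ := hf
  obtain ⟨Pg, pg, Hg⟩ := hg
  obtain ⟨q, hq⟩ : PolyBdd s fun x => pg.eval (s x) +
      (k x + 1) * (3 * (b x + (pc.eval (b x) + pf.eval (b x)))) :=
    (PolyBdd.self.eval pg).add ((hk.add (.const 1)).mul
      ((PolyBdd.const 3).mul (hb.add ((hb.eval pc).add (hb.eval pf)))))
  refine ⟨.comp (.while Pc Pf) Pg, q, fun x => ?_⟩
  obtain ⟨t0, ht0, ht0p⟩ := Hg x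
  obtain ⟨t, ht, htB⟩ := Runs.while_seq (c := Pc) (f := Pf) (fun i => enc (f^[i] (g x))) (k x)
    (b x + (pc.eval (b x) + pf.eval (b x))) (fun i hi => (hs x i hi).trans (by omega))
    (fun i hi => by
      obtain ⟨t, ht, htp⟩ := Hc (f^[i] (g x))
      refine ⟨_, t, ht, by simpa [enc_nat] using h1 x i hi, ?_⟩
      have := polyEval_mono pc (hs x i hi.le)
      omega)
    (fun i hi => by
      obtain ⟨t, ht, htp⟩ := Hf (f^[i] (g x))
      refine ⟨t, ?_, ?_⟩
      · rw [Function.iterate_succ_apply']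
        exact ht
      · have := polyEval_mono pf (hs x i hi.le)
        omega)
    (by
      obtain ⟨t, ht, htp⟩ := Hc (f^[k x] (g x))
      rw [h0 x] at ht
      refine ⟨t, ht, ?_⟩
      have := polyEval_mono pc (hs x _ le_rfl)
      omega)
  exact ⟨_, .comp ht0 ht, (add_le_add ht0p htB).trans (hq x)⟩

theorem whileLoop {c : σ → ℕ} {f : σ → σ} {g : α → σ} {k b : α → ℕ} (hc : PT c) (hf : PT f)
    (hg : PT g) (hk : SB k) (hb : SB b) (hs : ∀ x, ∀ i ≤ k x, sz (f^[i] (g x)) ≤ b x)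
    (h1 : ∀ x, ∀ i < k x, c (f^[i] (g x)) ≠ 0) (h0 : ∀ x, c (f^[k x] (g x)) = 0) :
    PT fun x => f^[k x] (g x) := whileLoopOn hc hf hg hk hb hs h1 h0

/-- The size of `f x` is at most that of `x` plus the running time of `f`. This is why `s` has to
dominate the input size. -/
theorem compOn {s : α → ℕ} {g : β → γ} {f : α → β} (hg : PT g) (hf : PTOn s f)
    (hs : PolyBdd s sz) : PTOn s fun x => g (f x) := by
  obtain ⟨P, p, h⟩ := hf
  obtain ⟨P', p', h'⟩ := hg
  obtain ⟨q, hq⟩ : PolyBdd s fun x => p.eval (s x) + p'.eval (sz x + p.eval (s x)) :=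
    (PolyBdd.self.eval p).add ((hs.add (PolyBdd.self.eval p)).eval p')
  refine ⟨.comp P' P, q, fun x => ?_⟩
  obtain ⟨t, ht, htp⟩ := h x
  obtain ⟨t', ht', htp'⟩ := h' (f x)
  refine ⟨_, .comp ht ht', le_trans ?_ (hq x)⟩
  have h1 := ht.size_lt
  have h2 : p'.eval (sz (f x)) ≤ p'.eval (sz x + p.eval (s x)) := polyEval_mono p' (by
    change (enc (f x)).size ≤ (enc x).size + _
    omega)
  dsimp only
  omega

theorem on {s : α → ℕ} {f : α → β} (hf : PT f) (hs : PolyBdd s sz) : PTOn s f := by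
  obtain ⟨P, p, h⟩ := hf
  obtain ⟨q, hq⟩ := hs.eval p
  exact ⟨P, q, fun x => (h x).imp fun t ht => ⟨ht.1, ht.2.trans (hq x)⟩⟩

/-- Writing a number in unary. -/
theorem unary {s : α × ℕ → ℕ} (hs : PolyBdd s fun x => sz x.1) (hn : PolyBdd s fun x => x.2) :
    PTOn s fun x : α × ℕ => (x.1, List.replicate x.2 0) := by
  -- The counter runs down while zeros are prepended. The time is polynomial in the value of the
  -- number and not in its length, so the measure `s` has to bound the value.
  let F : α × ℕ × List ℕ → α × ℕ × List ℕ := fun z => (z.1, z.2.1 - 1, 0 :: z.2.2)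
  have hF : ∀ (x : α × ℕ) i, F^[i] (x.1, x.2, []) = (x.1, x.2 - i, List.replicate i 0) := by
    intro x i
    induction i with
    | zero => simp
    | succ i ih =>
      rw [Function.iterate_succ_apply', ih]
      simp [F, Nat.sub_sub, List.replicate_succ]
  have hsz : PolyBdd s sz := (hs.add (hn.add (.const 2))).mono fun x => by
    have := sz_nat_le x.2
    rw [sz_prod]
    omega
  refine (compOn (g := fun z : α × ℕ × List ℕ => (z.1, z.2.2)) (by fun_prop)
    (whileLoopOn (s := s) (c := fun z : α × ℕ × List ℕ => z.2.1) (f := F)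
    (g := fun x => (x.1, x.2, [])) (k := fun x => x.2)
    (b := fun x => sz x.1 + ((x.2 + 1) + (x.2 * 2 + 1) + 1) + 1) (by fun_prop) (by fun_prop)
    (on (by fun_prop) hsz) hn ((hs.add (((hn.add (.const 1)).add
      ((hn.mul (.const 2)).add (.const 1))).add (.const 1))).add (.const 1)) ?_ ?_ ?_)
    hsz).imp fun P => Exists.imp fun p h x => ?_
  · intro x i hi
    rw [hF]
    simp only [sz_prod]
    have h1 := sz_nat_le (x.2 - i)
    have h2 : ∀ i, sz (List.replicate i 0) = i * 2 + 1 := by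
      intro i
      induction i with
      | zero => rfl
      | succ i ih =>
        rw [List.replicate_succ, sz_cons, ih]
        simp [sz_nat]
        omega
    rw [h2]
    omega
  · intro x i hi
    rw [hF]
    simp only
    omega
  · intro x
    rw [hF]
    simp
  · have := h x
    simp only [hF] at this
    exact this

/-- Recursion along a natural number of polynomial value. -/
theorem natRec {f : α → ℕ → σ → σ} {g : α → σ} {k b : α → ℕ}
    (hf : PT fun z : α × ℕ × σ => f z.1 z.2.1 z.2.2) (hg : PT g) (hk : PT k) (hkb : SB k)
    (hb : SB b) (hs : ∀ x, ∀ i ≤ k x, sz (Nat.rec (g x) (f x) i : σ) ≤ b x) :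
    PT fun x => (Nat.rec (g x) (f x) (k x) : σ) := by
  -- The state consists of the argument, the number of steps left (the loop test), the index, and
  -- the current value.
  let F : α × ℕ × ℕ × σ → α × ℕ × ℕ × σ := fun z =>
    (z.1, z.2.1 - 1, z.2.2.1 + 1, f z.1 z.2.2.1 z.2.2.2)
  have hF : ∀ x i, F^[i] (x, k x, 0, g x) = (x, k x - i, i, Nat.rec (g x) (f x) i) := by
    intro x i
    induction i with
    | zero => simp
    | succ i ih =>
      rw [Function.iterate_succ_apply', ih]
      simp [F, Nat.sub_sub]
  have hf' : PT fun z : α × ℕ × ℕ × σ => f z.1 z.2.2.1 z.2.2.2 :=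
    comp hf (f := fun z : α × ℕ × ℕ × σ => (z.1, z.2.2.1, z.2.2.2)) (by fun_prop)
  have := whileLoop (c := fun z : α × ℕ × ℕ × σ => z.2.1) (f := F)
    (g := fun x => (x, k x, 0, g x)) (k := k)
    (b := fun x => sz x + ((k x + 1) + ((k x + 1) + b x + 1) + 1) + 1) (by fun_prop)
    (by fun_prop) (by fun_prop) hkb
    (((PolyBdd.self.add (((hkb.add (.const 1)).add ((((hkb.add (.const 1)).add hb)).add
      (.const 1))).add (.const 1))).add (.const 1)))
    (fun x i hi => by
      rw [hF]
      simp only [sz_prod]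
      have h1 := hs x i hi
      have h2 := sz_nat_le (k x - i)
      have h3 := sz_nat_le i
      omega)
    (fun x i hi => by
      rw [hF]
      simp only
      omega)
    (fun x => by
      rw [hF]
      simp)
  refine congr (f := fun x => (F^[k x] (x, k x, 0, g x)).2.2.2) (by fun_prop) fun x => ?_
  rw [hF]

/-- Recursion along a list. -/
theorem foldl {f : α → σ → β → σ} {g : α → σ} {l : α → List β} {b : α → ℕ} {d : β}
    (hd : enc d = .num 0)
    (hf : PT fun z : α × σ × β => f z.1 z.2.1 z.2.2) (hg : PT g) (hl : PT l)
    (hb : SB b) (hs : ∀ x, ∀ i, sz (((l x).take i).foldl (f x) (g x)) ≤ b x) :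
    PT fun x => (l x).foldl (f x) (g x) := by
  -- The list is consumed from the front. On the empty list the first projection yields the number
  -- 0, so `headD` is a single operation as long as `d` is written as 0.
  let F : α × List β × σ → α × List β × σ := fun z =>
    (z.1, z.2.1.tail, f z.1 z.2.2 (z.2.1.headD d))
  have hF : ∀ x, ∀ i ≤ (l x).length, F^[i] (x, l x, g x) =
      (x, (l x).drop i, ((l x).take i).foldl (f x) (g x)) := by
    intro x i
    induction i with
    | zero => simp
    | succ i ih =>
      intro hi
      rw [Function.iterate_succ_apply', ih (by omega)]
      have : (l x).take (i + 1) = (l x).take i ++ [(l x)[i]] := by simp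
      rw [this]
      have h2 : (l x).drop i = (l x)[i] :: (l x).drop (i + 1) := List.drop_eq_getElem_cons hi
      simp only [F]
      rw [List.tail_drop, List.foldl_append]
      congr
      rw [h2]
      rfl
  have hf' : PT fun z : α × List β × σ => f z.1 z.2.2 (z.2.1.headD d) :=
    comp hf (f := fun z : α × List β × σ => (z.1, z.2.2, z.2.1.headD d))
      (prodMk (by fun_prop) (prodMk (by fun_prop) (headD hd (by fun_prop))))
  have := whileLoop (c := fun z : α × List β × σ => if z.2.1.isEmpty then 0 else 1) (f := F)
    (g := fun x => (x, l x, g x)) (k := fun x => (l x).length)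
    (b := fun x => sz x + (sz (l x) + b x + 1) + 1) (isNil (by fun_prop))
    (prodMk (by fun_prop) (prodMk (by fun_prop) hf')) (by fun_prop) (hl.sb.mono fun x => length_le_sz _)
    ((PolyBdd.self.add ((hl.sb.add hb).add (.const 1))).add (.const 1))
    (fun x i hi => by
      rw [hF x i hi]
      simp only [sz_prod]
      have h1 := hs x i
      have h2 : sz ((l x).drop i) ≤ sz (l x) := by
        clear h1 hi hf' hF hs
        induction i with
        | zero => simp
        | succ i ih =>
          refine le_trans ?_ ih
          rw [← List.tail_drop]
          cases (l x).drop i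
          · rfl
          · simp only [List.tail_cons, sz_cons]
            omega
      omega)
    (fun x i hi => by
      rw [hF x i hi.le]
      simpa using hi)
    (fun x => by
      rw [hF x _ le_rfl]
      simp)
  refine congr (f := fun x => (F^[(l x).length] (x, l x, g x)).2.2) (snd (snd this)) fun x => ?_
  rw [hF x _ le_rfl]
  simp

end PT

/-! ### Combinators for polynomial-time functions -/

/-- The list of the values at `0, …, k - 1`. -/
def tab {β : Type} (k : ℕ) (f : ℕ → β) : List β := (List.range k).map f

@[simp] theorem length_tab {β : Type} (k : ℕ) (f : ℕ → β) : (tab k f).length = k := by simp [tab]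

theorem getD_tab {β : Type} (k : ℕ) (f : ℕ → β) (d : β) {j : ℕ} (hj : j < k) :
    (tab k f).getD j d = f j := by
  simp [tab, List.getD_eq_getElem?_getD, hj]

theorem getD_tab_of_le {β : Type} (k : ℕ) (f : ℕ → β) (d : β) {j : ℕ} (hj : k ≤ j) :
    (tab k f).getD j d = d := by
  simp [tab, List.getD_eq_getElem?_getD, hj]

/-- The position of the minimum of `f` on `{0, …, k - 1}`. -/
def argminTo (k : ℕ) (f : ℕ → ℕ) : ℕ := Nat.rec 0 (fun i a => if f i < f a then i else a) k

theorem argminTo_succ (k : ℕ) (f : ℕ → ℕ) :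
    argminTo (k + 1) f = if f k < f (argminTo k f) then k else argminTo k f := rfl

theorem argminTo_lt {k : ℕ} (hk : 0 < k) (f : ℕ → ℕ) : argminTo k f < k := by
  induction k with
  | zero => omega
  | succ k ih =>
    rw [argminTo_succ]
    split_ifs
    · omega
    · rcases Nat.eq_zero_or_pos k with rfl | h
      · simp [argminTo]
      · have := ih h
        omega

theorem argminTo_le_self (k : ℕ) (f : ℕ → ℕ) : argminTo k f ≤ k := by
  rcases Nat.eq_zero_or_pos k with rfl | h
  · rfl
  · exact (argminTo_lt h f).le

theorem argminTo_le {k j : ℕ} (hj : j < k) (f : ℕ → ℕ) : f (argminTo k f) ≤ f j := by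
  induction k with
  | zero => omega
  | succ k ih =>
    rw [argminTo_succ]
    rcases Nat.lt_succ_iff_lt_or_eq.1 hj with h | rfl
    · have := ih h
      split_ifs <;> omega
    · split_ifs <;> omega

namespace PT
variable {α β γ δ σ : Type} [Enc α] [Enc β] [Enc γ] [Enc δ] [Enc σ]

/-- A bound for the values of a polynomial-time function with an index of polynomial value. -/
theorem bound_index {f : α → ℕ → β} (hf : PT fun z : α × ℕ => f z.1 z.2) {k : α → ℕ}
    (hk : SB k) : ∃ b : α → ℕ, SB b ∧ ∀ x, ∀ j ≤ k x, sz (f x j) ≤ b x := by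
  obtain ⟨q, hq⟩ := hf.sb
  refine ⟨fun x => q.eval (sz x + (k x + 1) + 1),
    ((PolyBdd.self.add (hk.add (.const 1))).add (.const 1)).eval q, fun x j hj => ?_⟩
  refine (hq (x, j)).trans (polyEval_mono q ?_)
  have := sz_nat_le j
  rw [sz_prod]
  dsimp only
  omega

theorem length {d : β} (hd : enc d = .num 0) {l : α → List β} (hl : PT l) :
    PT fun x => (l x).length := by
  have key : ∀ (l : List β) (n : ℕ), l.foldl (fun n _ => n + 1) n = n + l.length := by
    intro l
    induction l with
    | nil => simp
    | cons a l ih =>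
      intro n
      rw [List.foldl_cons, ih, List.length_cons]
      omega
  refine congr (foldl (f := fun (_ : α) (n : ℕ) (_ : β) => n + 1) (g := fun _ => 0)
    (b := fun x => sz (l x) + 1) hd (by fun_prop) (by fun_prop) hl (hl.sb.add (.const 1)) ?_) ?_
  · intro x i
    rw [key]
    refine (sz_nat_le _).trans ?_
    have := length_le_sz (l x)
    have := (l x).length_take_le' i
    omega
  · intro x
    rw [key, zero_add]

theorem getD {d : β} (hd : enc d = .num 0) {l : α → List β} {i : α → ℕ} (hl : PT l) (hi : PT i) :
    PT fun x => (l x).getD (i x) d := by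
  -- Started at `i + 1`, the counter equals 1 exactly at position `i`, where the element is stored;
  -- afterwards truncation keeps it at 0.
  let F : ℕ × β → β → ℕ × β := fun s a => (s.1 - 1, if s.1 = 1 then a else s.2)
  have h0 : ∀ (l : List β) (r : β), (l.foldl F (0, r)) = (0, r) := by
    intro l
    induction l with
    | nil => simp
    | cons a l ih => intro r; rw [List.foldl_cons]; exact ih r
  have h1 : ∀ (l : List β) (i : ℕ), (l.foldl F (i + 1, d)).2 = l.getD i d := by
    intro l
    induction l with
    | nil => simp
    | cons a l ih =>
      intro i
      rw [List.foldl_cons]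
      cases i with
      | zero => simp [F, h0]
      | succ i =>
        have : F (i + 1 + 1, d) a = (i + 1, d) := by simp [F]
        rw [this, ih]
        simp
  have h2 : ∀ (l : List β) (s : ℕ × β), (l.foldl F s).1 ≤ s.1 ∧
      ((l.foldl F s).2 = s.2 ∨ (l.foldl F s).2 ∈ l) := by
    intro l
    induction l with
    | nil => simp
    | cons a l ih =>
      intro s
      rw [List.foldl_cons]
      obtain ⟨h3, h4⟩ := ih (F s a)
      have h5 : (F s a).1 = s.1 - 1 := rfl
      have h6 : (F s a).2 = a ∨ (F s a).2 = s.2 := by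
        by_cases h : s.1 = 1 <;> simp [F, h]
      refine ⟨by omega, ?_⟩
      rcases h4 with h4 | h4
      · rcases h6 with h6 | h6
        · right; rw [h4, h6]; simp
        · left; rw [h4, h6]
      · right; simp [h4]
  have hF : PT fun z : α × (ℕ × β) × β => F z.2.1 z.2.2 := by fun_prop
  refine congr (snd (foldl (f := fun (_ : α) => F) (g := fun x => (i x + 1, d))
    (b := fun x => (sz (i x) + 1) + (sz (l x) + 2) + 1) hd hF (by fun_prop) hl
    (((hi.sb.add (.const 1)).add (hl.sb.add (.const 2))).add (.const 1)) ?_)) ?_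
  · intro x j
    obtain ⟨h3, h4⟩ := h2 ((l x).take j) (i x + 1, d)
    have h5 : sz ((l x).take j) ≤ sz (l x) := by
      conv_rhs => rw [← List.take_append_drop j (l x)]
      exact sz_append_le _ _
    have h6 : sz ((((l x).take j).foldl F (i x + 1, d)).2) ≤ sz (l x) + 1 := by
      rcases h4 with h4 | h4
      · rw [h4]
        simp [sz, hd, Data.size]
      · have := sz_le_of_mem h4
        omega
    have h7 : sz ((((l x).take j).foldl F (i x + 1, d)).1) ≤ sz (i x) + 1 := by
      have h8 := Nat.size_le_size h3
      have h9 := size_add_le (i x) 1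
      have h10 : Nat.size 1 = 1 := by simp
      have h11 : Nat.size (i x + 1) ≤ Nat.size (i x) + 1 := by
        rw [Nat.size_le, pow_succ]
        have := Nat.lt_size_self (i x)
        omega
      simp only [sz_nat]
      dsimp only at h8
      omega
    rw [sz_prod]
    omega
  · intro x
    rw [← h1]

@[fun_prop]
theorem getNat {l : α → List ℕ} {i : α → ℕ} (hl : PT l) (hi : PT i) :
    PT fun x => (l x).getD (i x) 0 := getD rfl hl hi

@[fun_prop]
theorem getList {l : α → List (List β)} {i : α → ℕ} (hl : PT l) (hi : PT i) :
    PT fun x => (l x).getD (i x) [] := getD rfl hl hi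

@[fun_prop]
theorem lengthNat {l : α → List ℕ} (hl : PT l) : PT fun x => (l x).length :=
  length (d := 0) rfl hl

@[fun_prop]
theorem lengthList {l : α → List (List β)} (hl : PT l) : PT fun x => (l x).length :=
  length (d := []) rfl hl

theorem tab {f : α → ℕ → β} {k : α → ℕ} (hf : PT fun z : α × ℕ => f z.1 z.2) (hk : PT k)
    (hkb : SB k) : PT fun x => tab (k x) (f x) := by
  obtain ⟨b, hb, hfb⟩ := bound_index hf hkb
  -- The list is built from its last entry backwards, since elements can only be prepended.
  let A : α → ℕ → List β := fun x i => Nat.rec [] (fun i a => f x (k x - 1 - i) :: a) i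
  have hA : ∀ x, ∀ i ≤ k x, A x i = (List.range' (k x - i) i).map (f x) := by
    intro x i
    induction i with
    | zero => simp [A]
    | succ i ih =>
      intro hi
      have : A x (i + 1) = f x (k x - 1 - i) :: A x i := rfl
      rw [this, ih (by omega), List.range'_succ]
      simp only [List.map_cons]
      rw [show k x - (i + 1) = k x - 1 - i by omega, show k x - 1 - i + 1 = k x - i by omega]
  have hf' : PT fun z : α × ℕ × List β => f z.1 (k z.1 - 1 - z.2.1) :: z.2.2 :=
    cons (comp hf (f := fun z : α × ℕ × List β => (z.1, k z.1 - 1 - z.2.1)) (by fun_prop))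
      (by fun_prop)
  refine congr (natRec (f := fun x i a => f x (k x - 1 - i) :: a) (g := fun _ => []) (k := k)
    (b := fun x => k x * (b x + 1) + 1) hf' (by fun_prop) hk hkb
    ((hkb.mul (hb.add (.const 1))).add (.const 1)) ?_) ?_
  · intro x i hi
    change sz (A x i) ≤ _
    refine (sz_le_of_forall _ (b x) ?_).trans ?_
    · intro a ha
      rw [hA x i hi] at ha
      simp only [List.mem_map, List.mem_range'_1] at ha
      obtain ⟨j, hj, rfl⟩ := ha
      exact hfb x j (by omega)
    · rw [hA x i hi]
      simp only [List.length_map, List.length_range']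
      gcongr
  · intro x
    change _ = A x (k x)
    rw [hA x _ le_rfl, IDMetric.tab, Nat.sub_self, List.range_eq_range']

theorem argmin {f : α → ℕ → ℕ} {k : α → ℕ} (hf : PT fun z : α × ℕ => f z.1 z.2) (hk : PT k)
    (hkb : SB k) : PT fun x => argminTo (k x) (f x) := by
  have hf1 : PT fun z : α × ℕ × ℕ => f z.1 z.2.1 :=
    comp hf (f := fun z : α × ℕ × ℕ => (z.1, z.2.1)) (by fun_prop)
  have hf2 : PT fun z : α × ℕ × ℕ => f z.1 z.2.2 :=
    comp hf (f := fun z : α × ℕ × ℕ => (z.1, z.2.2)) (by fun_prop)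
  refine natRec (f := fun x i a => if f x i < f x a then i else a) (g := fun _ => 0) (k := k)
    (b := fun x => k x + 1) (by fun_prop) (by fun_prop) hk hkb (hkb.add (.const 1)) ?_
  intro x i hi
  have h1 : argminTo i (f x) ≤ i := argminTo_le_self _ _
  refine (sz_nat_le (argminTo i (f x))).trans ?_
  omega

theorem sum {f : α → ℕ → ℕ} {k : α → ℕ} (hf : PT fun z : α × ℕ => f z.1 z.2) (hk : PT k)
    (hkb : SB k) : PT fun x => ∑ j ∈ Finset.range (k x), f x j := by
  obtain ⟨b, hb, hfb⟩ := bound_index hf hkb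
  have hf1 : PT fun z : α × ℕ × ℕ => f z.1 z.2.1 :=
    comp hf (f := fun z : α × ℕ × ℕ => (z.1, z.2.1)) (by fun_prop)
  have hrec : ∀ x i, (Nat.rec 0 (fun i a => a + f x i) i : ℕ) = ∑ j ∈ Finset.range i, f x j := by
    intro x i
    induction i with
    | zero => rfl
    | succ i ih => rw [Finset.sum_range_succ, ← ih]
  refine congr (natRec (f := fun x i a => a + f x i) (g := fun _ => 0) (k := k)
    (b := fun x => k x * (b x + 1) + 1) (by fun_prop) (by fun_prop) hk hkb
    ((hkb.mul (hb.add (.const 1))).add (.const 1)) ?_) fun x => (hrec x _).symm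
  intro x i hi
  suffices sz (Nat.rec 0 (fun i a => a + f x i) i : ℕ) ≤ i * (b x + 1) + 1 from
    this.trans (by gcongr)
  rw [hrec]
  induction i with
  | zero => simp [sz_nat]
  | succ i ih =>
    have h1 := ih (by omega)
    have h2 := hfb x i (by omega)
    have h3 := size_add_le (∑ j ∈ Finset.range i, f x j) (f x i)
    rw [Finset.sum_range_succ]
    simp only [sz_nat] at *
    linarith

theorem twoPow {k : α → ℕ} (hk : PT k) (hkb : SB k) : PT fun x => 2 ^ k x := by
  have hrec : ∀ i, (Nat.rec 1 (fun _ a => 2 * a) i : ℕ) = 2 ^ i := by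
    intro i
    induction i with
    | zero => rfl
    | succ i ih => rw [pow_succ', ← ih]
  refine congr (natRec (f := fun _ _ a => 2 * a) (g := fun _ => 1) (k := k)
    (b := fun x => k x + 2) (by fun_prop) (by fun_prop) hk hkb (hkb.add (.const 2)) ?_)
    fun x => (hrec _).symm
  intro x i hi
  rw [hrec, sz_nat, Nat.size_pow]
  omega

/-- The bit length is the number of halvings after which a number becomes 0. -/
theorem natSize {f : α → ℕ} (hf : PT f) : PT fun x => (f x).size := by
  have hrec : ∀ (n i : ℕ), (fun s : ℕ × ℕ => (s.1 / 2, s.2 + 1))^[i] (n, 0) = (n / 2 ^ i, i) := by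
    intro n i
    induction i with
    | zero => simp
    | succ i ih => rw [Function.iterate_succ_apply', ih, pow_succ, Nat.div_div_eq_div_mul]
  refine comp (g := fun n : ℕ => n.size) ?_ hf
  refine congr (snd (whileLoop (c := fun s : ℕ × ℕ => s.1)
    (f := fun s : ℕ × ℕ => (s.1 / 2, s.2 + 1)) (g := fun n : ℕ => (n, 0)) (k := fun n => n.size)
    (b := fun n => sz n + (sz n + 1) + 1) (by fun_prop) (by fun_prop) (by fun_prop)
    (PolyBdd.self.mono fun x => by simp [sz_nat])
    ((PolyBdd.self.add (PolyBdd.self.add (.const 1))).add (.const 1)) ?_ ?_ ?_)) ?_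
  · intro n i hi
    have h1 := Nat.size_le_size (Nat.div_le_self n (2 ^ i))
    have h2 := sz_nat_le i
    rw [hrec, sz_prod]
    simp only [sz_nat] at *
    omega
  · intro n i hi
    rw [hrec]
    have := Nat.lt_size.1 hi
    exact (Nat.div_pos this (by positivity)).ne'
  · intro n
    rw [hrec]
    exact Nat.div_eq_of_lt (Nat.lt_size_self n)
  · intro n
    rw [hrec]

end PT

/-! ### The assignment problem: algorithm -/

/-- An entry of a matrix. -/
def entry (c : List (List ℕ)) (i j : ℕ) : ℕ := (c.getD i []).getD j 0

/-- A row that holds no column, if there is one, where `s` lists for each row the number `j + 1`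
if it holds column `j`, and `0` if it holds no column. -/
def freeRow (n : ℕ) (s : List ℕ) : ℕ := argminTo n fun i => s.getD i 0

/-- The cheapest column for row `i` at prices `p`. -/
def bestCol (r : List (List ℕ)) (p : List ℕ) (i : ℕ) : ℕ :=
  argminTo r.length fun j => entry r i j + p.getD j 0

/-- The prices after the price of column `j₀` is raised by one. -/
def raise (n : ℕ) (p : List ℕ) (j₀ : ℕ) : List ℕ :=
  tab n fun j => if j = j₀ then p.getD j 0 + 1 else p.getD j 0

/-- The columns held after row `i₀` takes column `j₀`. -/
def take (n : ℕ) (s : List ℕ) (i₀ j₀ : ℕ) : List ℕ :=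
  tab n fun i => if i = i₀ then j₀ + 1 else if s.getD i 0 = j₀ + 1 then 0 else s.getD i 0

/-- One bid of the auction algorithm: a row that holds no column takes the cheapest column, the
price of which is raised by one. -/
def bid (r : List (List ℕ)) (st : List ℕ × List ℕ) : List ℕ × List ℕ :=
  if st.2.getD (freeRow r.length st.2) 0 = 0 then
    (raise r.length st.1 (bestCol r st.1 (freeRow r.length st.2)),
      take r.length st.2 (freeRow r.length st.2) (bestCol r st.1 (freeRow r.length st.2)))
  else st

/-- The auction algorithm. -/
def auction (r : List (List ℕ)) : List ℕ × List ℕ :=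
  (bid r)^[r.length * (4 * r.length + 3) + 1] (tab r.length fun _ => 0, tab r.length fun _ => 0)

/-- The costs `c / q`, reduced by the doubled prices `p` and truncated. -/
def reduced (c : List (List ℕ)) (q : ℕ) (p : List ℕ) : List (List ℕ) :=
  tab c.length fun i => tab c.length fun j =>
    min (entry c i j / q + 2 * p.getD j 0 -
      (entry c i (argminTo c.length fun j => entry c i j / q + 2 * p.getD j 0) / q +
        2 * p.getD (argminTo c.length fun j => entry c i j / q + 2 * p.getD j 0) 0))
      (4 * c.length + 1)

/-- One phase of cost scaling. -/
def phase (c : List (List ℕ)) (q : ℕ) (p : List ℕ) : List ℕ × List ℕ :=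
  (tab c.length fun j => 2 * p.getD j 0 + (auction (reduced c q p)).1.getD j 0,
    (auction (reduced c q p)).2)

/-- The states after each phase of cost scaling, where the costs are less than `2 ^ B`. -/
def scaling (c : List (List ℕ)) (B : ℕ) (k : ℕ) : List ℕ × List ℕ :=
  Nat.rec (tab c.length fun _ => 0, tab c.length fun _ => 0)
    (fun t st => phase c (2 ^ (B - t)) st.1) k

/-- The costs multiplied by their number of rows plus one. -/
def enlarge (c : List (List ℕ)) : List (List ℕ) :=
  tab c.length fun i => tab c.length fun j => (c.length + 1) * entry c i j

/-- The sum of all entries. -/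
def total (c : List (List ℕ)) : ℕ :=
  ∑ i ∈ Finset.range c.length, ∑ j ∈ Finset.range c.length, entry c i j

/-- The minimal cost of an assignment of the rows of a square matrix to the columns. -/
def assign (c : List (List ℕ)) : ℕ :=
  ∑ i ∈ Finset.range c.length, entry c i
    ((scaling (enlarge c) (total (enlarge c)).size ((total (enlarge c)).size + 1)).2.getD i 0 - 1)

/-! ### Iteration, and a single bid, in polynomial time. -/

namespace PT
variable {α β γ δ σ : Type} [Enc α] [Enc β] [Enc γ] [Enc δ] [Enc σ]

@[fun_prop]
theorem entry {c : α → List (List ℕ)} {i j : α → ℕ} (hc : PT c) (hi : PT i) (hj : PT j) :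
    PT fun x => entry (c x) (i x) (j x) := by
  unfold IDMetric.entry
  fun_prop

theorem sb_lengthNat {l : α → List ℕ} (hl : PT l) : SB fun x => (l x).length :=
  hl.sb.mono fun _ => length_le_sz _

theorem sb_lengthList {l : α → List (List β)} (hl : PT l) : SB fun x => (l x).length :=
  hl.sb.mono fun _ => length_le_sz _

theorem sb_natSize {f : α → ℕ} (hf : PT f) : SB fun x => (f x).size :=
  hf.sb.mono fun x => by rw [sz_nat]; omega

theorem iterate {f : α → σ → σ} {g : α → σ} {k b : α → ℕ} (hf : PT fun z : α × σ => f z.1 z.2)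
    (hg : PT g) (hk : PT k) (hkb : SB k) (hb : SB b)
    (hs : ∀ x, ∀ i ≤ k x, sz ((f x)^[i] (g x)) ≤ b x) :
    PT fun x => (f x)^[k x] (g x) := by
  have hrec : ∀ x i, (Nat.rec (g x) (fun _ a => f x a) i : σ) = (f x)^[i] (g x) := by
    intro x i
    induction i with
    | zero => rfl
    | succ i ih => rw [Function.iterate_succ_apply', ← ih]
  have hf1 : PT fun z : α × ℕ × σ => f z.1 z.2.2 :=
    comp hf (f := fun z : α × ℕ × σ => (z.1, z.2.2)) (by fun_prop)
  refine congr (natRec (f := fun x _ a => f x a) hf1 hg hk hkb hb ?_) fun x => (hrec _ _).symm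
  intro x i hi
  rw [hrec]
  exact hs x i hi

theorem bid : PT fun x : List (List ℕ) × List ℕ × List ℕ => bid x.1 x.2 := by
  have h1 : PT fun x : List (List ℕ) × List ℕ × List ℕ => freeRow x.1.length x.2.2 :=
    argmin (f := fun (x : List (List ℕ) × List ℕ × List ℕ) i => x.2.2.getD i 0) (by fun_prop)
      (by fun_prop) (sb_lengthList (by fun_prop))
  have h2 : PT fun x : List (List ℕ) × List ℕ × ℕ => bestCol x.1 x.2.1 x.2.2 :=
    argmin (f := fun (x : List (List ℕ) × List ℕ × ℕ) j =>
      IDMetric.entry x.1 x.2.2 j + x.2.1.getD j 0) (by fun_prop)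
      (by fun_prop) (sb_lengthList (by fun_prop))
  have h3 : PT fun x : List (List ℕ) × List ℕ × ℕ => raise x.1.length x.2.1 x.2.2 :=
    tab (f := fun (x : List (List ℕ) × List ℕ × ℕ) j =>
      if j = x.2.2 then x.2.1.getD j 0 + 1 else x.2.1.getD j 0) (by fun_prop) (by fun_prop)
      (sb_lengthList (by fun_prop))
  have h4 : PT fun x : List (List ℕ) × List ℕ × ℕ × ℕ => take x.1.length x.2.1 x.2.2.1 x.2.2.2 :=
    tab (f := fun (x : List (List ℕ) × List ℕ × ℕ × ℕ) i => if i = x.2.2.1 then x.2.2.2 + 1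
      else if x.2.1.getD i 0 = x.2.2.2 + 1 then 0 else x.2.1.getD i 0) (by fun_prop)
      (by fun_prop) (sb_lengthList (by fun_prop))
  have h5 : PT fun x : List (List ℕ) × List ℕ × List ℕ =>
      bestCol x.1 x.2.1 (freeRow x.1.length x.2.2) :=
    comp h2 (f := fun x : List (List ℕ) × List ℕ × List ℕ =>
      (x.1, x.2.1, freeRow x.1.length x.2.2)) (by fun_prop)
  exact ite_eq (getNat (by fun_prop) h1) (by fun_prop) (prodMk
    (comp h3 (f := fun x : List (List ℕ) × List ℕ × List ℕ =>
      (x.1, x.2.1, bestCol x.1 x.2.1 (freeRow x.1.length x.2.2))) (by fun_prop))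
    (comp h4 (f := fun x : List (List ℕ) × List ℕ × List ℕ =>
      (x.1, x.2.2, freeRow x.1.length x.2.2, bestCol x.1 x.2.1 (freeRow x.1.length x.2.2)))
      (by fun_prop))) (by fun_prop)

end PT

/-- The entries of a list of length `n` are at most `b`. -/
def ListLe (n b : ℕ) (l : List ℕ) : Prop := l.length = n ∧ ∀ j, l.getD j 0 ≤ b

theorem ListLe.tab {n b : ℕ} {f : ℕ → ℕ} (h : ∀ j < n, f j ≤ b) : ListLe n b (tab n f) := by
  refine ⟨length_tab _ _, fun j => ?_⟩
  by_cases hj : j < n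
  · rw [getD_tab _ _ _ hj]
    exact h j hj
  · rw [getD_tab_of_le _ _ _ (by omega)]
    exact Nat.zero_le _

theorem ListLe.mono {n b b' : ℕ} {l : List ℕ} (h : ListLe n b l) (hb : b ≤ b') : ListLe n b' l :=
  ⟨h.1, fun j => (h.2 j).trans hb⟩

theorem ListLe.sz_le {n b B : ℕ} {l : List ℕ} (h : ListLe n b l) (hb : b < 2 ^ B) :
    sz l ≤ n * (B + 2) + 1 := by
  rw [← h.1]
  refine sz_le_of_forall l (B + 1) fun a ha => ?_
  obtain ⟨i, hi, rfl⟩ := List.mem_iff_getElem.1 ha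
  have := h.2 i
  rw [List.getD_eq_getElem _ _ hi] at this
  rw [sz_nat, add_le_add_iff_right, Nat.size_le]
  omega

/-- Running times must be bounded for all inputs, also for meaningless matrices, so these bounds do
not use the auction invariant. Bounding `bestCol` by the number of columns without strictness avoids
a case distinction for the empty matrix. -/
theorem bid_bounds (r : List (List ℕ)) (st : List ℕ × List ℕ) (t : ℕ)
    (h1 : ListLe r.length t st.1) (h2 : ListLe r.length (r.length + 1) st.2) :
    ListLe r.length (t + 1) (bid r st).1 ∧ ListLe r.length (r.length + 1) (bid r st).2 := by
  unfold bid
  split_ifs with h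
  · refine ⟨ListLe.tab fun j hj => ?_, ListLe.tab fun i hi => ?_⟩
    · have := h1.2 j
      split_ifs <;> omega
    · have := h2.2 i
      have : bestCol r st.1 (freeRow r.length st.2) ≤ r.length := argminTo_le_self _ _
      split_ifs <;> omega
  · exact ⟨h1.mono (by omega), h2⟩

theorem bid_iterate_bounds (r : List (List ℕ)) (t : ℕ) :
    ListLe r.length t ((bid r)^[t] (tab r.length fun _ => 0, tab r.length fun _ => 0)).1 ∧
    ListLe r.length (r.length + 1)
      ((bid r)^[t] (tab r.length fun _ => 0, tab r.length fun _ => 0)).2 := by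
  induction t with
  | zero => exact ⟨ListLe.tab fun _ _ => le_rfl, ListLe.tab fun _ _ => Nat.zero_le _⟩
  | succ t ih =>
    rw [Function.iterate_succ_apply']
    exact bid_bounds _ _ _ ih.1 ih.2

theorem reduced_length (c : List (List ℕ)) (q : ℕ) (p : List ℕ) :
    (reduced c q p).length = c.length := by simp [reduced]

/-- Each phase doubles the prices and adds at most the number of bids, so after `k` phases the
prices still have polynomially many bits. -/
theorem scaling_bounds (c : List (List ℕ)) (B k : ℕ) :
    ListLe c.length ((2 ^ k - 1) * (c.length * (4 * c.length + 3) + 1)) (scaling c B k).1 ∧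
    ListLe c.length (c.length + 1) (scaling c B k).2 := by
  induction k with
  | zero => exact ⟨ListLe.tab fun _ _ => Nat.zero_le _, ListLe.tab fun _ _ => Nat.zero_le _⟩
  | succ k ih =>
    have h := bid_iterate_bounds (reduced c (2 ^ (B - k)) (scaling c B k).1)
      (c.length * (4 * c.length + 3) + 1)
    rw [reduced_length] at h
    have hs : scaling c B (k + 1) = phase c (2 ^ (B - k)) (scaling c B k).1 := rfl
    rw [hs]
    unfold phase auction
    rw [reduced_length]
    refine ⟨ListLe.tab fun j hj => ?_, h.2⟩
    have h1 := ih.1.2 j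
    have h2 := h.1.2 j
    have h3 := Nat.one_le_two_pow (n := k)
    obtain ⟨a, ha⟩ : ∃ a, 2 ^ k = a + 1 := ⟨2 ^ k - 1, by omega⟩
    have h4 : 2 ^ (k + 1) - 1 = 2 * a + 1 := by rw [pow_succ]; omega
    rw [h4]
    rw [ha, Nat.add_sub_cancel] at h1
    nlinarith

/-! ### Polynomial running time of the assignment solver. -/

namespace PT
variable {α β γ δ σ : Type} [Enc α] [Enc β] [Enc γ] [Enc δ] [Enc σ]

theorem auction : PT IDMetric.auction := by
  have hN : SB fun r : List (List ℕ) => r.length := sb_lengthList (by fun_prop)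
  have hT : SB fun r : List (List ℕ) => r.length * (4 * r.length + 3) + 1 :=
    (hN.mul (((PolyBdd.const 4).mul hN).add (.const 3))).add (.const 1)
  have h0 : PT fun r : List (List ℕ) => IDMetric.tab r.length fun _ => 0 :=
    tab (f := fun _ _ => 0) (by fun_prop) (by fun_prop) hN
  refine iterate (f := IDMetric.bid) bid (prodMk h0 h0) (by fun_prop) hT
    (b := fun r => (r.length * (r.length * (4 * r.length + 3) + 1 + 2) + 1) +
      (r.length * (r.length + 1 + 2) + 1) + 1)
    ((((hN.mul (hT.add (.const 2))).add (.const 1)).add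
      ((hN.mul ((hN.add (.const 1)).add (.const 2))).add (.const 1))).add (.const 1)) ?_
  intro r i hi
  obtain ⟨h1, h2⟩ := bid_iterate_bounds r i
  have h3 := (h1.mono hi).sz_le Nat.lt_two_pow_self
  have h4 := h2.sz_le Nat.lt_two_pow_self
  rw [sz_prod]
  omega

theorem reduced : PT fun x : List (List ℕ) × ℕ × List ℕ => reduced x.1 x.2.1 x.2.2 := by
  have h1 : PT fun z : (List (List ℕ) × ℕ × List ℕ) × ℕ => argminTo z.1.1.length
      fun j => IDMetric.entry z.1.1 z.2 j / z.1.2.1 + 2 * z.1.2.2.getD j 0 :=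
    argmin (f := fun (z : (List (List ℕ) × ℕ × List ℕ) × ℕ) j =>
      IDMetric.entry z.1.1 z.2 j / z.1.2.1 + 2 * z.1.2.2.getD j 0) (by fun_prop) (by fun_prop)
      (sb_lengthList (by fun_prop))
  have h2 : PT fun z : ((List (List ℕ) × ℕ × List ℕ) × ℕ) × ℕ => argminTo z.1.1.1.length
      fun j => IDMetric.entry z.1.1.1 z.1.2 j / z.1.1.2.1 + 2 * z.1.1.2.2.getD j 0 :=
    comp h1 (by fun_prop)
  unfold IDMetric.reduced
  refine tab (f := fun (x : List (List ℕ) × ℕ × List ℕ) i => IDMetric.tab x.1.length fun j =>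
    Min.min (IDMetric.entry x.1 i j / x.2.1 + 2 * x.2.2.getD j 0 -
      (IDMetric.entry x.1 i (argminTo x.1.length fun j =>
          IDMetric.entry x.1 i j / x.2.1 + 2 * x.2.2.getD j 0) / x.2.1 +
        2 * x.2.2.getD (argminTo x.1.length fun j =>
          IDMetric.entry x.1 i j / x.2.1 + 2 * x.2.2.getD j 0) 0))
      (4 * x.1.length + 1)) ?_ (by fun_prop) (sb_lengthList (by fun_prop))
  refine tab (f := fun (z : (List (List ℕ) × ℕ × List ℕ) × ℕ) j =>
    Min.min (IDMetric.entry z.1.1 z.2 j / z.1.2.1 + 2 * z.1.2.2.getD j 0 -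
      (IDMetric.entry z.1.1 z.2 (argminTo z.1.1.length fun j =>
          IDMetric.entry z.1.1 z.2 j / z.1.2.1 + 2 * z.1.2.2.getD j 0) / z.1.2.1 +
        2 * z.1.2.2.getD (argminTo z.1.1.length fun j =>
          IDMetric.entry z.1.1 z.2 j / z.1.2.1 + 2 * z.1.2.2.getD j 0) 0))
      (4 * z.1.1.length + 1)) ?_ (by fun_prop) (sb_lengthList (by fun_prop))
  exact min (sub (by fun_prop) (add (div (entry (by fun_prop) (by fun_prop) h2) (by fun_prop))
    (mul (by fun_prop) (getNat (by fun_prop) h2)))) (by fun_prop)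

theorem phase : PT fun x : List (List ℕ) × ℕ × List ℕ => phase x.1 x.2.1 x.2.2 := by
  have h : PT fun x : List (List ℕ) × ℕ × List ℕ =>
      IDMetric.auction (IDMetric.reduced x.1 x.2.1 x.2.2) := comp auction reduced
  refine prodMk (tab (f := fun (x : List (List ℕ) × ℕ × List ℕ) j => 2 * x.2.2.getD j 0 +
    (IDMetric.auction (IDMetric.reduced x.1 x.2.1 x.2.2)).1.getD j 0) ?_ (by fun_prop)
    (sb_lengthList (by fun_prop))) (snd h)
  exact add (by fun_prop) (getNat (fst (comp h (f := Prod.fst) (by fun_prop))) (by fun_prop))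

theorem scaling {c : α → List (List ℕ)} {B k : α → ℕ} (hc : PT c) (hB : PT B) (hBb : SB B)
    (hk : PT k) (hkb : SB k) : PT fun x => scaling (c x) (B x) (k x) := by
  have hN : SB fun x => (c x).length := sb_lengthList hc
  have hT : SB fun x => (c x).length * (4 * (c x).length + 3) + 1 :=
    (hN.mul (((PolyBdd.const 4).mul hN).add (.const 3))).add (.const 1)
  have h0 : PT fun x => IDMetric.tab (c x).length fun _ => 0 :=
    tab (f := fun _ _ => 0) (by fun_prop) (by fun_prop) hN
  have hq : PT fun z : α × ℕ × List ℕ × List ℕ => 2 ^ (B z.1 - z.2.1) :=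
    twoPow (by fun_prop) ((PolyBdd.trans (s := sz) (g := fun z : α × ℕ × List ℕ × List ℕ => sz z.1)
      (PolyBdd.self.mono fun z => by rw [sz_prod]; omega) (hBb.comp Prod.fst)).mono
        fun z => Nat.sub_le _ _)
  refine natRec (f := fun x t (st : List ℕ × List ℕ) =>
    IDMetric.phase (c x) (2 ^ (B x - t)) st.1)
    (g := fun x => (IDMetric.tab (c x).length fun _ => 0, IDMetric.tab (c x).length fun _ => 0))
    (k := k)
    (b := fun x => ((c x).length * ((k x + ((c x).length * (4 * (c x).length + 3) + 1)) + 2) + 1) +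
      ((c x).length * ((c x).length + 1 + 2) + 1) + 1)
    (comp phase (f := fun z : α × ℕ × List ℕ × List ℕ =>
      (c z.1, 2 ^ (B z.1 - z.2.1), z.2.2.1)) (by fun_prop)) (prodMk h0 h0) hk hkb
    ((((hN.mul ((hkb.add hT).add (.const 2))).add (.const 1)).add
      ((hN.mul ((hN.add (.const 1)).add (.const 2))).add (.const 1))).add (.const 1)) ?_
  intro x i hi
  obtain ⟨h1, h2⟩ := scaling_bounds (c x) (B x) i
  -- The price bound is a product of a factor below `2 ^ k` and the number of bids, which is below 2
  -- to the power of itself; the exponents add up.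
  have h3 := h1.sz_le (B := k x + ((c x).length * (4 * (c x).length + 3) + 1)) (by
    rw [pow_add]
    have h5 : 2 ^ i ≤ 2 ^ k x := Nat.pow_le_pow_right (by simp) hi
    have h6 := Nat.one_le_two_pow (n := i)
    exact Nat.mul_lt_mul_of_lt_of_le (by omega) Nat.lt_two_pow_self.le (by positivity))
  have h4 := h2.sz_le Nat.lt_two_pow_self
  change sz (IDMetric.scaling (c x) (B x) i) ≤ _
  rw [sz_prod]
  omega

theorem enlarge : PT enlarge := by
  refine tab (f := fun (c : List (List ℕ)) i => IDMetric.tab c.length fun j =>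
    (c.length + 1) * IDMetric.entry c i j) ?_ (by fun_prop) (sb_lengthList (by fun_prop))
  exact tab (f := fun (z : List (List ℕ) × ℕ) j =>
    (z.1.length + 1) * IDMetric.entry z.1 z.2 j) (by fun_prop) (by fun_prop)
    (sb_lengthList (by fun_prop))

theorem total : PT total := by
  refine sum (f := fun (c : List (List ℕ)) i => ∑ j ∈ Finset.range c.length, IDMetric.entry c i j)
    ?_ (by fun_prop) (sb_lengthList (by fun_prop))
  exact sum (f := fun (z : List (List ℕ) × ℕ) j => IDMetric.entry z.1 z.2 j) (by fun_prop)
    (by fun_prop) (sb_lengthList (by fun_prop))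

theorem assign : PT assign := by
  have ht : PT fun c => IDMetric.total (IDMetric.enlarge c) := comp total enlarge
  have hB := natSize ht
  have hs := scaling enlarge hB (sb_natSize ht) (add hB (const 1)) ((sb_natSize ht).add (.const 1))
  refine sum (f := fun c i => IDMetric.entry c i ((IDMetric.scaling (IDMetric.enlarge c)
    (IDMetric.total (IDMetric.enlarge c)).size
    ((IDMetric.total (IDMetric.enlarge c)).size + 1)).2.getD i 0 - 1)) ?_ (by fun_prop)
    (sb_lengthList (by fun_prop))
  exact entry (by fun_prop) (by fun_prop)
    (sub (getNat (snd (comp hs (f := Prod.fst) (by fun_prop))) (by fun_prop)) (by fun_prop))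

end PT

/-! ### The assignment problem: correctness -/

/-- The invariant of the auction algorithm after `t` bids, for costs at most `C`. -/
structure AuctionInv (r : List (List ℕ)) (C t : ℕ) (st : List ℕ × List ℕ) : Prop where
  le : ∀ i < r.length, st.2.getD i 0 ≤ r.length
  inj : ∀ i < r.length, ∀ i' < r.length, st.2.getD i 0 = st.2.getD i' 0 → st.2.getD i 0 ≠ 0 →
    i = i'
  slack : ∀ i < r.length, ∀ j, st.2.getD i 0 = j + 1 → ∀ j' < r.length,
    entry r i j + st.1.getD j 0 ≤ entry r i j' + st.1.getD j' 0 + 1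
  free : ∀ j < r.length, (∀ i < r.length, st.2.getD i 0 ≠ j + 1) → st.1.getD j 0 = 0
  price : ∀ j < r.length, st.1.getD j 0 ≤ C + 1
  count : (∀ i < r.length, st.2.getD i 0 ≠ 0) ∨ ∑ j ∈ Finset.range r.length, st.1.getD j 0 = t

/-- Pigeonhole: if all columns were held, sending columns to their holders would be injective and
would miss row `i`. -/
theorem exists_free_col {n i : ℕ} {s : List ℕ} (hi : i < n) (h0 : s.getD i 0 = 0) :
    ∃ j < n, ∀ i' < n, s.getD i' 0 ≠ j + 1 := by
  by_contra! hcon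
  choose! g hg hgs using hcon
  have hinj : Set.InjOn g (Finset.range n) := by
    intro a ha b hb hab
    simp only [Finset.coe_range, Set.mem_Iio] at ha hb
    have h1 := hgs a ha
    have h2 := hgs b hb
    rw [hab] at h1
    omega
  have hmaps : Set.MapsTo g (Finset.range n) ((Finset.range n).erase i) := by
    intro a ha
    simp only [Finset.coe_range, Set.mem_Iio] at ha
    simp only [Finset.coe_erase, Finset.coe_range, Set.mem_sdiff, Set.mem_Iio,
      Set.mem_singleton_iff]
    refine ⟨hg a ha, fun hga => ?_⟩
    have := hgs a ha
    rw [hga, h0] at this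
    omega
  have := Finset.card_le_card_of_injOn g hmaps hinj
  rw [Finset.card_erase_of_mem (by simpa using hi), Finset.card_range] at this
  omega

/-- The core is complementary slackness up to 1. A column that was ever held remains held, so an
unheld column still has price 0; this is what bounds all prices. -/
theorem AuctionInv.bid {r : List (List ℕ)} {C t : ℕ} {st : List ℕ × List ℕ}
    (hC : ∀ i < r.length, ∀ j < r.length, entry r i j ≤ C)
    (h : AuctionInv r C t st) : AuctionInv r C (t + 1) (bid r st) := by
  unfold IDMetric.bid
  by_cases h0 : st.2.getD (freeRow r.length st.2) 0 = 0
  swap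
  · rw [if_neg h0]
    refine ⟨h.le, h.inj, h.slack, h.free, h.price, Or.inl fun i hi => ?_⟩
    have := argminTo_le hi fun i => st.2.getD i 0
    change st.2.getD (freeRow r.length st.2) 0 ≤ _ at this
    omega
  rw [if_pos h0]
  by_cases hN : r.length = 0
  · refine ⟨?_, ?_, ?_, ?_, ?_, ?_⟩ <;> simp [hN]
  have hi₀ : freeRow r.length st.2 < r.length := argminTo_lt (by omega) _
  set i₀ := freeRow r.length st.2 with hi₀_def
  have hj₀ : bestCol r st.1 i₀ < r.length := argminTo_lt (by omega) _
  have hbest : ∀ j < r.length, entry r i₀ (bestCol r st.1 i₀) +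
      st.1.getD (bestCol r st.1 i₀) 0 ≤ entry r i₀ j + st.1.getD j 0 :=
    fun j hj => argminTo_le hj fun j => entry r i₀ j + st.1.getD j 0
  set j₀ := bestCol r st.1 i₀ with hj₀_def
  have hp : ∀ j < r.length, (raise r.length st.1 j₀).getD j 0 =
      if j = j₀ then st.1.getD j 0 + 1 else st.1.getD j 0 := fun j hj => getD_tab _ _ _ hj
  have hs : ∀ i < r.length, (take r.length st.2 i₀ j₀).getD i 0 =
      if i = i₀ then j₀ + 1 else if st.2.getD i 0 = j₀ + 1 then 0 else st.2.getD i 0 :=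
    fun i hi => getD_tab _ _ _ hi
  -- The free row leaves some column unheld, with price 0. The chosen column is no more expensive
  -- for this row, so its price before the bid is at most `C`.
  have hp0 : st.1.getD j₀ 0 ≤ C := by
    obtain ⟨j, hj, hfree⟩ := exists_free_col hi₀ h0
    have h1 := hbest j hj
    rw [h.free j hj hfree] at h1
    have := hC i₀ hi₀ j hj
    omega
  refine ⟨?_, ?_, ?_, ?_, ?_, ?_⟩ <;> dsimp only
  · intro i hi
    have := h.le i hi
    rw [hs i hi]
    split_ifs <;> omega
  · intro i hi i' hi'
    have := h.inj i hi i' hi'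
    rw [hs i hi, hs i' hi']
    grind
  -- The new holder chose the cheapest column just before its price rose by 1. For the other rows
  -- the price of the held column is unchanged, and no price falls.
  · intro i hi j hij j' hj'
    have hslack := h.slack i hi j
    have hle := h.le i hi
    have hb := hbest j' hj'
    rw [hs i hi] at hij
    split_ifs at hij with h1 h2
    · have hjj : j = j₀ := by omega
      subst h1
      rw [hjj, hp _ hj₀, hp _ hj']
      split_ifs <;> omega
    · have hj : j < r.length := by omega
      have h3 := hslack hij j' hj'
      have hne : j ≠ j₀ := by omega
      rw [hp _ hj, hp _ hj', if_neg hne]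
      split_ifs <;> omega
  · intro j hj hfree
    have hne : j ≠ j₀ := by
      rintro rfl
      have := hfree i₀ hi₀
      rw [hs i₀ hi₀, if_pos rfl] at this
      omega
    rw [hp _ hj, if_neg hne]
    refine h.free j hj fun i hi hij => ?_
    have := hfree i hi
    rw [hs i hi] at this
    split_ifs at this with h1 h2
    · subst h1
      rw [h0] at hij
      omega
    · omega
    · exact this hij
  · intro j hj
    have := h.price j hj
    rw [hp _ hj]
    split_ifs with h1
    · subst h1
      omega
    · omega
  -- A bid raises the sum of all prices by exactly 1.
  · right
    have hcount := h.count.resolve_left fun hall => hall i₀ hi₀ h0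
    rw [Finset.sum_congr rfl fun j hj => hp j (Finset.mem_range.1 hj)]
    have : ∀ j, (if j = j₀ then st.1.getD j 0 + 1 else st.1.getD j 0) =
        st.1.getD j 0 + if j = j₀ then 1 else 0 := by
      intro j
      split_ifs <;> rfl
    simp only [this, Finset.sum_add_distrib, hcount]
    simp [hj₀]

/-- The auction algorithm ends with an assignment that is nearly optimal for each row. -/
theorem auction_spec (r : List (List ℕ))
    (hr : ∀ i < r.length, ∀ j < r.length, entry r i j ≤ 4 * r.length + 1) :
    ∃ σ : Equiv.Perm (Fin r.length),
      (∀ i : Fin r.length, (auction r).2.getD i 0 = σ i + 1) ∧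
      ∀ i j : Fin r.length, entry r i (σ i) + (auction r).1.getD (σ i) 0 ≤
        entry r i j + (auction r).1.getD j 0 + 1 := by
  have hinv : ∀ t, AuctionInv r (4 * r.length + 1) t
      ((bid r)^[t] (tab r.length fun _ => 0, tab r.length fun _ => 0)) := by
    intro t
    induction t with
    | zero =>
      refine ⟨?_, ?_, ?_, ?_, ?_, ?_⟩ <;> dsimp only [Function.iterate_zero, _root_.id]
      · intro i hi
        rw [getD_tab _ _ _ hi]
        omega
      · intro i hi i' hi' _ h
        rw [getD_tab _ _ _ hi] at h
        omega
      · intro i hi j h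
        rw [getD_tab _ _ _ hi] at h
        omega
      · intro j hj _
        exact getD_tab _ _ _ hj
      · intro j hj
        rw [getD_tab _ _ _ hj]
        omega
      · right
        exact Finset.sum_eq_zero fun j hj => getD_tab _ _ _ (Finset.mem_range.1 hj)
    | succ t ih =>
      rw [Function.iterate_succ_apply']
      exact ih.bid hr
  have h : AuctionInv r (4 * r.length + 1) (r.length * (4 * r.length + 3) + 1) (auction r) :=
    hinv _
  -- Otherwise the sum of the prices would equal the number of bids, `N * (4 * N + 3) + 1`, which
  -- `N` prices of at most `4 * N + 2` cannot reach.
  have hall : ∀ i < r.length, (auction r).2.getD i 0 ≠ 0 := by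
    refine h.count.resolve_right fun hsum => ?_
    have := Finset.sum_le_card_nsmul (Finset.range r.length) (fun j => (auction r).1.getD j 0)
      (4 * r.length + 1 + 1) fun j hj => h.price j (Finset.mem_range.1 hj)
    rw [hsum, Finset.card_range, smul_eq_mul] at this
    nlinarith
  let f : Fin r.length → Fin r.length := fun i => ⟨(auction r).2.getD i 0 - 1, by
    have h1 := hall i i.2
    have h2 := h.le i i.2
    omega⟩
  have hf : ∀ i : Fin r.length, (auction r).2.getD i 0 = f i + 1 := fun i => by
    have h1 := hall i i.2
    simp only [f]
    omega
  have hinj : Function.Injective f := by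
    intro a b hab
    refine Fin.ext (h.inj a a.2 b b.2 ?_ (hall a a.2))
    rw [hf, hf, hab]
  refine ⟨Equiv.ofBijective f hinj.bijective_of_finite, fun i => ?_, fun i j => ?_⟩
  · rw [Equiv.ofBijective_apply, hf]
  · rw [Equiv.ofBijective_apply]
    exact h.slack i i.2 (f i) (hf i) j j.2

theorem entry_tab {n : ℕ} (f : ℕ → ℕ → ℕ) {i j : ℕ} (hi : i < n) (hj : j < n) :
    entry (tab n fun i => tab n (f i)) i j = f i j := by
  rw [entry, getD_tab _ _ _ hi, getD_tab _ _ _ hj]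

/-- A nearly optimal assignment for halved costs leads to one for the costs. -/
theorem phase_spec (c : List (List ℕ)) (q : ℕ) (p : List ℕ)
    (hp : ∃ σ : Equiv.Perm (Fin c.length), ∀ i j : Fin c.length,
      entry c i (σ i) / q + 2 * p.getD (σ i) 0 ≤ entry c i j / q + 2 * p.getD j 0 + 3) :
    ∃ σ : Equiv.Perm (Fin c.length),
      (∀ i : Fin c.length, (phase c q p).2.getD i 0 = σ i + 1) ∧
      ∀ i j : Fin c.length, entry c i (σ i) / q + (phase c q p).1.getD (σ i) 0 ≤
        entry c i j / q + (phase c q p).1.getD j 0 + 1 := by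
  obtain ⟨τ, hτ⟩ := hp
  let w : ℕ → ℕ → ℕ := fun i j => entry c i j / q + 2 * p.getD j 0
  let m : ℕ → ℕ := fun i => w i (argminTo c.length (w i))
  have hm : ∀ i, ∀ j < c.length, m i ≤ w i j := fun i j hj => argminTo_le hj (w i)
  have hlen := reduced_length c q p
  have hr : ∀ i < c.length, ∀ j < c.length,
      entry (reduced c q p) i j = min (w i j - m i) (4 * c.length + 1) :=
    fun i hi j hj => entry_tab _ hi hj
  obtain ⟨σ, hσ1, hσ2⟩ := auction_spec (reduced c q p) (by
    rw [hlen]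
    intro i hi j hj
    rw [hr i hi j hj]
    exact min_le_right _ _)
  revert σ
  rw [hlen]
  intro σ hσ1 hσ2
  set P := (auction (reduced c q p)).1 with hP
  -- The given assignment `τ` has reduced cost at most 3 per row. Slack 1 per row loses at most `N`
  -- against it, as prices cancel when summed over permutations; in total this is `3 * N + N`.
  have hsum : ∑ i : Fin c.length, entry (reduced c q p) i (σ i) ≤ 4 * c.length := by
    have h1 : ∑ i : Fin c.length, (entry (reduced c q p) i (σ i) + P.getD (σ i) 0) ≤
        ∑ i : Fin c.length, (entry (reduced c q p) i (τ i) + P.getD (τ i) 0 + 1) :=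
      Finset.sum_le_sum fun i _ => hσ2 i (τ i)
    simp only [Finset.sum_add_distrib] at h1
    rw [Equiv.sum_comp σ (fun j : Fin c.length => P.getD j 0),
      Equiv.sum_comp τ (fun j : Fin c.length => P.getD j 0)] at h1
    have h2 : ∑ i : Fin c.length, entry (reduced c q p) i (τ i) ≤ ∑ _i : Fin c.length, 3 := by
      refine Finset.sum_le_sum fun i _ => ?_
      rw [hr i i.2 _ (τ i).2]
      refine (min_le_left _ _).trans ?_
      have h3 : w i (τ i) ≤ m i + 3 := by
        have h4 : argminTo c.length (w i) < c.length :=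
          argminTo_lt (lt_of_le_of_lt (Nat.zero_le _) i.2) _
        exact hτ i ⟨_, h4⟩
      omega
    simp only [Finset.sum_const, Finset.card_univ, Fintype.card_fin, smul_eq_mul, mul_one] at h1 h2
    omega
  have hpp : ∀ j : Fin c.length, (phase c q p).1.getD j 0 = 2 * p.getD j 0 + P.getD j 0 :=
    fun j => getD_tab _ _ _ j.2
  refine ⟨σ, hσ1, fun i j => ?_⟩
  have h1 := hσ2 i j
  have h2 : entry (reduced c q p) i (σ i) ≤ 4 * c.length :=
    (Finset.single_le_sum (f := fun i : Fin c.length => entry (reduced c q p) i (σ i))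
      (fun _ _ => Nat.zero_le _) (Finset.mem_univ i)).trans hsum
  rw [hr i i.2 _ (σ i).2] at h1 h2
  rw [hr i i.2 _ j.2] at h1
  have h3 := hm i (σ i) (σ i).2
  have h4 := hm i j j.2
  have h5 := min_le_left (w i j - m i) (4 * c.length + 1)
  -- The entries in use lie below the truncation level `4 * N + 1` and are exact. Truncation can
  -- only have lowered the right-hand side, so the inequality holds for the true costs as well.
  have h6 : min (w i (σ i) - m i) (4 * c.length + 1) = w i (σ i) - m i :=
    min_eq_left (by omega)
  rw [hpp, hpp]
  have h7 : entry c i (σ i) / q + 2 * p.getD (σ i) 0 = w i (σ i) := rfl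
  have h8 : entry c i j / q + 2 * p.getD j 0 = w i j := rfl
  omega

/-- Reading one more bit of the costs and doubling the prices turns slack 1 into slack at most 3:
two from doubling and one from the new bit. `phase_spec` restores slack 1. -/
theorem scaling_spec (c : List (List ℕ)) (B : ℕ)
    (hB : ∀ i < c.length, ∀ j < c.length, entry c i j < 2 ^ B) (k : ℕ) (hk : k ≤ B) :
    ∃ σ : Equiv.Perm (Fin c.length),
      (∀ i : Fin c.length, (scaling c B (k + 1)).2.getD i 0 = σ i + 1) ∧
      ∀ i j : Fin c.length,
        entry c i (σ i) / 2 ^ (B - k) + (scaling c B (k + 1)).1.getD (σ i) 0 ≤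
        entry c i j / 2 ^ (B - k) + (scaling c B (k + 1)).1.getD j 0 + 1 := by
  induction k with
  | zero =>
    -- At the coarsest scale all costs round to 0 and all prices are 0, so any permutation will do.
    refine phase_spec c _ _ ⟨1, fun i j => ?_⟩
    rw [Equiv.Perm.one_apply, Nat.sub_zero, Nat.div_eq_of_lt (hB i i.2 i i.2)]
    have h1 := Nat.zero_le (entry c i j / 2 ^ B)
    have : (scaling c B 0).1.getD i 0 = 0 := getD_tab _ _ _ i.2
    change 0 + 2 * (scaling c B 0).1.getD i 0 ≤ _ / _ + 2 * (scaling c B 0).1.getD j 0 + 3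
    omega
  | succ k ih =>
    obtain ⟨σ, -, hσ⟩ := ih (by omega)
    refine phase_spec c _ _ ⟨σ, fun i j => ?_⟩
    have h := hσ i j
    have h1 : 2 ^ (B - k) = 2 ^ (B - (k + 1)) * 2 := by
      rw [← pow_succ]
      congr 1
      omega
    rw [h1, ← Nat.div_div_eq_div_mul, ← Nat.div_div_eq_div_mul] at h
    change _ / _ + 2 * (scaling c B (k + 1)).1.getD _ 0 ≤
      _ + 2 * (scaling c B (k + 1)).1.getD _ 0 + 3
    omega

/-- Slack 1 per row makes a total error of at most the number `N` of rows. After multiplication of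
the costs by `N + 1`, different totals differ by at least `N + 1`, so the assignment found is
optimal. -/
theorem assign_spec (c : List (List ℕ)) :
    (∃ σ : Equiv.Perm (Fin c.length), assign c = ∑ i : Fin c.length, entry c i (σ i)) ∧
    ∀ τ : Equiv.Perm (Fin c.length), assign c ≤ ∑ i : Fin c.length, entry c i (τ i) := by
  have hlen : (enlarge c).length = c.length := by simp [enlarge]
  have he : ∀ i < c.length, ∀ j < c.length,
      entry (enlarge c) i j = (c.length + 1) * entry c i j := fun i hi j hj => entry_tab _ hi hj
  obtain ⟨σ, hσ1, hσ2⟩ := scaling_spec (enlarge c) (total (enlarge c)).size (by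
    intro i hi j hj
    refine lt_of_le_of_lt ?_ (Nat.lt_size_self (total (enlarge c)))
    exact (Finset.single_le_sum (f := fun j => entry (enlarge c) i j)
      (fun _ _ => Nat.zero_le _) (Finset.mem_range.2 hj)).trans
      (Finset.single_le_sum (f := fun i => ∑ j ∈ Finset.range (enlarge c).length,
        entry (enlarge c) i j) (fun _ _ => Nat.zero_le _) (Finset.mem_range.2 hi))) _ le_rfl
  revert σ
  rw [hlen, Nat.sub_self, pow_zero]
  simp only [Nat.div_one]
  intro σ hσ1 hσ2
  have hval : assign c = ∑ i : Fin c.length, entry c i (σ i) := by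
    rw [assign, Finset.sum_range]
    refine Finset.sum_congr rfl fun i _ => ?_
    rw [hσ1, Nat.add_sub_cancel]
  refine ⟨⟨σ, hval⟩, fun τ => ?_⟩
  rw [hval]
  set P := (scaling (enlarge c) (total (enlarge c)).size ((total (enlarge c)).size + 1)).1
  have h1 : ∑ i : Fin c.length, (entry (enlarge c) i (σ i) + P.getD (σ i) 0) ≤
      ∑ i : Fin c.length, (entry (enlarge c) i (τ i) + P.getD (τ i) 0 + 1) :=
    Finset.sum_le_sum fun i _ => hσ2 i (τ i)
  simp only [Finset.sum_add_distrib] at h1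
  rw [Equiv.sum_comp σ (fun j : Fin c.length => P.getD j 0),
    Equiv.sum_comp τ (fun j : Fin c.length => P.getD j 0)] at h1
  have h2 : ∀ ρ : Equiv.Perm (Fin c.length), ∑ i : Fin c.length, entry (enlarge c) i (ρ i) =
      (c.length + 1) * ∑ i : Fin c.length, entry c i (ρ i) := by
    intro ρ
    rw [Finset.mul_sum]
    exact Finset.sum_congr rfl fun i _ => he i i.2 _ (ρ i).2
  rw [h2, h2] at h1
  simp only [Finset.sum_const, Finset.card_univ, Fintype.card_fin, smul_eq_mul, mul_one] at h1
  by_contra! hlt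
  have h3 : (c.length + 1) * (∑ i : Fin c.length, entry c i (τ i) + 1) ≤
      (c.length + 1) * ∑ i : Fin c.length, entry c i (σ i) := Nat.mul_le_mul_left _ hlt
  rw [mul_add] at h3
  omega

/-! ### Optimal transport between finite uniform distributions -/

section Transport

variable {n m : ℕ}

/-- The minimal cost of transporting the uniform distribution on `Fin n` to that on `Fin m`, where
rows and columns are duplicated so that there are `n * m` of each. -/
def OT (c : Fin n → Fin m → ℝ) : ℝ :=
  (⨅ π : Equiv.Perm (Fin n × Fin m), ∑ x, c x.1 (π x).2) / (n * m)

theorem OT_le_perm (c : Fin n → Fin m → ℝ) (π : Equiv.Perm (Fin n × Fin m)) :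
    OT c ≤ (∑ x, c x.1 (π x).2) / (n * m) := by
  unfold OT
  gcongr
  exact ciInf_le (Set.finite_range _).bddBelow π

theorem exists_OT_eq (c : Fin n → Fin m → ℝ) :
    ∃ π : Equiv.Perm (Fin n × Fin m), OT c = (∑ x, c x.1 (π x).2) / (n * m) := by
  obtain ⟨π, hπ⟩ := exists_eq_ciInf_of_finite
    (f := fun π : Equiv.Perm (Fin n × Fin m) => ∑ x, c x.1 (π x).2)
  exact ⟨π, by rw [OT, ← hπ]⟩

theorem OT_mono {c c' : Fin n → Fin m → ℝ} (h : ∀ u v, c u v ≤ c' u v) : OT c ≤ OT c' := by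
  obtain ⟨π, hπ⟩ := exists_OT_eq c'
  rw [hπ]
  refine (OT_le_perm c π).trans ?_
  gcongr
  exact h _ _

theorem OT_nonneg {c : Fin n → Fin m → ℝ} (h : ∀ u v, 0 ≤ c u v) : 0 ≤ OT c := by
  obtain ⟨π, hπ⟩ := exists_OT_eq c
  rw [hπ]
  exact div_nonneg (Finset.sum_nonneg fun _ _ => h _ _) (by positivity)

theorem OT_le_one {c : Fin n → Fin m → ℝ} (h : ∀ u v, c u v ≤ 1) : OT c ≤ 1 := by
  refine (OT_le_perm c 1).trans (div_le_one_of_le₀ ?_ (by positivity))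
  refine (Finset.sum_le_sum fun x _ => h _ _).trans ?_
  simp

theorem OT_div (c : Fin n → Fin m → ℝ) {K : ℝ} (hK : 0 < K) :
    OT (fun u v => c u v / K) = OT c / K := by
  refine le_antisymm ?_ ?_
  · obtain ⟨π, hπ⟩ := exists_OT_eq c
    rw [hπ]
    refine (OT_le_perm _ π).trans_eq ?_
    rw [← Finset.sum_div, div_right_comm]
  · obtain ⟨π, hπ⟩ := exists_OT_eq fun u v => c u v / K
    rw [hπ, ← Finset.sum_div, div_right_comm]
    gcongr
    exact OT_le_perm c π

/-- Birkhoff's theorem: spread over the copies, `Γ` is doubly stochastic and so a convex combination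
of permutation matrices, whose average cost is at least the minimum. -/
theorem OT_le_coupling [NeZero n] [NeZero m] (c : Fin n → Fin m → ℝ) (Γ : Fin n → Fin m → ℝ)
    (h0 : ∀ u v, 0 ≤ Γ u v) (h1 : ∀ u, ∑ v, Γ u v = 1 / n) (h2 : ∀ v, ∑ u, Γ u v = 1 / m) :
    OT c ≤ ∑ u, ∑ v, Γ u v * c u v := by
  have hn : (n : ℝ) ≠ 0 := by exact_mod_cast NeZero.ne n
  have hm : (m : ℝ) ≠ 0 := by exact_mod_cast NeZero.ne m
  -- No normalization is needed: a row of `M` contains each entry of a row of `Γ` exactly `n` times,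
  -- and that row has sum `1 / n`.
  let M : Matrix (Fin n × Fin m) (Fin n × Fin m) ℝ := fun x y => Γ x.1 y.2
  have hM : M ∈ doublyStochastic ℝ (Fin n × Fin m) := by
    rw [mem_doublyStochastic_iff_sum]
    refine ⟨fun _ _ => h0 _ _, fun x => ?_, fun y => ?_⟩
    · simp only [M, Fintype.sum_prod_type, h1, Finset.sum_const, Finset.card_univ,
        Fintype.card_fin, nsmul_eq_mul]
      field_simp
    · simp only [M, Fintype.sum_prod_type, Finset.sum_const, Finset.card_univ,
        Fintype.card_fin, nsmul_eq_mul, ← Finset.mul_sum, h2]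
      field_simp
  obtain ⟨w, hw0, hw1, hw⟩ := exists_eq_sum_perm_of_mem_doublyStochastic hM
  have hsum : ∑ x, ∑ y, M x y * c x.1 y.2 = (n * m) * ∑ u, ∑ v, Γ u v * c u v := by
    simp only [M, Fintype.sum_prod_type, Finset.sum_const, Finset.card_univ,
      Fintype.card_fin, nsmul_eq_mul, Finset.mul_sum]
    refine Finset.sum_congr rfl fun u _ => Finset.sum_congr rfl fun v _ => by ring
  have hperm : ∀ π : Equiv.Perm (Fin n × Fin m),
      ∑ x, ∑ y, (π.permMatrix ℝ) x y * c x.1 y.2 = ∑ x, c x.1 (π x).2 := by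
    intro π
    refine Finset.sum_congr rfl fun x _ => ?_
    simp [Equiv.Perm.permMatrix, PEquiv.toMatrix_apply, Equiv.toPEquiv_apply]
  have hsum2 : ∑ x, ∑ y, M x y * c x.1 y.2 = ∑ π, w π * ∑ x, c x.1 (π x).2 := by
    rw [← hw]
    simp only [Matrix.sum_apply, Matrix.smul_apply, smul_eq_mul, Finset.sum_mul]
    simp_rw [← hperm, Finset.mul_sum]
    rw [Finset.sum_comm]
    conv_rhs => rw [Finset.sum_comm]
    rw [Finset.sum_comm]
    refine Finset.sum_congr rfl fun x _ => ?_
    rw [Finset.sum_comm]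
    exact Finset.sum_congr rfl fun π _ => Finset.sum_congr rfl fun y _ => by ring
  have hle : (n * m) * OT c ≤ ∑ π, w π * ∑ x, c x.1 (π x).2 := by
    calc (n * m) * OT c = ∑ π, w π * ((n * m) * OT c) := by rw [← Finset.sum_mul, hw1, one_mul]
      _ ≤ _ := Finset.sum_le_sum fun π _ => mul_le_mul_of_nonneg_left ?_ (hw0 π)
    have := OT_le_perm c π
    rw [le_div_iff₀ (by positivity)] at this
    linarith
  rw [← hsum2, hsum] at hle
  exact le_of_mul_le_mul_left hle (by positivity)

/-- The optimal cost is attained by a coupling. -/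
theorem exists_coupling [NeZero n] [NeZero m] (c : Fin n → Fin m → ℝ) :
    ∃ Γ : Fin n → Fin m → ℝ, (∀ u v, 0 ≤ Γ u v) ∧ (∀ u, ∑ v, Γ u v = 1 / n) ∧
      (∀ v, ∑ u, Γ u v = 1 / m) ∧ ∑ u, ∑ v, Γ u v * c u v = OT c := by
  have hn : (n : ℝ) ≠ 0 := by exact_mod_cast NeZero.ne n
  have hm : (m : ℝ) ≠ 0 := by exact_mod_cast NeZero.ne m
  obtain ⟨π, hπ⟩ := exists_OT_eq c
  -- The share of all copies that `π` sends from a copy of `u` to a copy of `v`.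
  refine ⟨fun u v => (∑ x, if x.1 = u ∧ (π x).2 = v then 1 else 0) / (n * m),
    fun u v => by positivity, fun u => ?_, fun v => ?_, ?_⟩
  · rw [← Finset.sum_div, Finset.sum_comm]
    have : ∀ x : Fin n × Fin m, (∑ v, if x.1 = u ∧ (π x).2 = v then (1 : ℝ) else 0) =
        if x.1 = u then 1 else 0 := by
      intro x
      by_cases h : x.1 = u <;> simp [h]
    simp only [this, Fintype.sum_prod_type_right, Finset.sum_const, Finset.card_univ,
      Fintype.card_fin, nsmul_eq_mul, mul_one, Finset.sum_ite_eq', Finset.mem_univ, if_true]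
    field_simp
  · rw [← Finset.sum_div, Finset.sum_comm]
    have : ∀ x : Fin n × Fin m, (∑ u, if x.1 = u ∧ (π x).2 = v then (1 : ℝ) else 0) =
        if (π x).2 = v then 1 else 0 := by
      intro x
      by_cases h : (π x).2 = v <;> simp [h]
    simp only [this]
    rw [Equiv.sum_comp π (fun y : Fin n × Fin m => if y.2 = v then (1 : ℝ) else 0)]
    simp only [Fintype.sum_prod_type, Finset.sum_const, Finset.card_univ,
      Fintype.card_fin, nsmul_eq_mul, mul_one, Finset.sum_ite_eq',
      Finset.mem_univ, if_true]
    field_simp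
  · rw [hπ]
    simp only [div_mul_eq_mul_div, ← Finset.sum_div, Finset.sum_mul]
    congr 1
    have : ∀ u : Fin n, (∑ v, ∑ x : Fin n × Fin m,
        (if x.1 = u ∧ (π x).2 = v then (1 : ℝ) else 0) * c u v) =
        ∑ x : Fin n × Fin m, if x.1 = u then c u (π x).2 else 0 := by
      intro u
      rw [Finset.sum_comm]
      refine Finset.sum_congr rfl fun x _ => ?_
      by_cases h : x.1 = u <;> simp [h]
    simp only [this]
    rw [Finset.sum_comm]
    simp

/-- The smallest `ε` such that all but a part `ε` of the mass can be transported at costs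
below `ε`. -/
def PV (c : Fin n → Fin m → ℝ) : ℝ :=
  sInf {ε | 0 < ε ∧ OT (fun u v => if ε ≤ c u v then 1 else 0) ≤ ε}

theorem PV_set_bddBelow (c : Fin n → Fin m → ℝ) :
    BddBelow {ε | 0 < ε ∧ OT (fun u v => if ε ≤ c u v then 1 else 0) ≤ ε} :=
  ⟨0, fun _ h => h.1.le⟩

theorem one_mem_PV_set (c : Fin n → Fin m → ℝ) :
    (1 : ℝ) ∈ {ε | 0 < ε ∧ OT (fun u v => if ε ≤ c u v then 1 else 0) ≤ ε} :=
  ⟨one_pos, OT_le_one fun u v => by split_ifs <;> norm_num⟩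

theorem PV_nonneg (c : Fin n → Fin m → ℝ) : 0 ≤ PV c := Real.sInf_nonneg fun _ h => h.1.le

theorem PV_le_one (c : Fin n → Fin m → ℝ) : PV c ≤ 1 :=
  csInf_le (PV_set_bddBelow c) (one_mem_PV_set c)

theorem PV_mono {c c' : Fin n → Fin m → ℝ} (h : ∀ u v, c u v ≤ c' u v) : PV c ≤ PV c' := by
  refine csInf_le_csInf (PV_set_bddBelow c) ⟨1, one_mem_PV_set c'⟩ ?_
  rintro ε ⟨h0, h1⟩
  refine ⟨h0, (OT_mono fun u v => ?_).trans h1⟩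
  have := h u v
  split_ifs
  · rfl
  · linarith
  · norm_num
  · rfl

/-- The threshold in `PV` can be taken to be `0` or one of the costs. -/
theorem PV_eq (c : Fin n → Fin m → ℝ) (T : Set ℝ) (hT : T = insert 0 (Set.range fun x :
    Fin n × Fin m => c x.1 x.2)) (hc : ∀ u v, 0 ≤ c u v) (r t₀ : ℝ) (ht₀ : t₀ ∈ T)
    (hr : r = max t₀ (OT fun u v => if t₀ < c u v then 1 else 0))
    (hmin : ∀ t ∈ T, r ≤ max t (OT fun u v => if t < c u v then 1 else 0)) : PV c = r := by
  have hT0 : ∀ t ∈ T, 0 ≤ t := by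
    subst hT
    rintro t (rfl | ⟨x, rfl⟩)
    · rfl
    · exact hc _ _
  refine le_antisymm ?_ ?_
  -- The value `r` may be 0, which is not admitted in the infimum, but every `r + δ` is: costs of at
  -- least `r + δ` exceed `t₀`.
  · refine le_of_forall_pos_le_add fun δ hδ => csInf_le (PV_set_bddBelow c) ⟨?_, ?_⟩
    · have := hT0 _ ht₀
      have := le_max_left t₀ (OT fun u v => if t₀ < c u v then 1 else 0)
      linarith
    · refine (OT_mono (c' := fun u v => if t₀ < c u v then 1 else 0) fun u v => ?_).trans
        (((le_max_right t₀ _).trans_eq hr.symm).trans (by linarith))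
      have := le_max_left t₀ (OT fun u v => if t₀ < c u v then 1 else 0)
      split_ifs
      · rfl
      · linarith
      · norm_num
      · rfl
  · refine le_csInf ⟨1, one_mem_PV_set c⟩ ?_
    rintro ε ⟨h0, h1⟩
    have hfin : (T ∩ Set.Iio ε).Finite := by
      subst hT
      exact (((Set.finite_range _).insert 0)).inter_of_left _
    have hne : (T ∩ Set.Iio ε).Nonempty := ⟨0, by subst hT; exact Set.mem_insert _ _, h0⟩
    -- For the largest threshold `t` below `ε`, the costs above `t` are exactly those that are at
    -- least `ε`.
    obtain ⟨t, ⟨htT, htε⟩, ht⟩ := Set.exists_max_image _ (fun t => t) hfin hne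
    refine (hmin t htT).trans (max_le (le_of_lt htε) ?_)
    refine le_trans (le_of_eq ?_) h1
    congr 1
    funext u v
    refine if_congr ⟨fun h => ?_, fun h => lt_of_lt_of_le htε h⟩ rfl rfl
    by_contra! hlt
    have := ht (c u v) ⟨by subst hT; exact Set.mem_insert_of_mem _ ⟨(u, v), rfl⟩, hlt⟩
    linarith

end Transport

/-! ### Computing transport costs -/

/-- A matrix as a list of rows. -/
def mat (n m : ℕ) (c : ℕ → ℕ → ℕ) : List (List ℕ) := tab n fun i => tab m (c i)

/-- The number of columns. -/
def cols (c : List (List ℕ)) : ℕ := (c.getD 0 []).length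

theorem entry_mat {n m : ℕ} (c : ℕ → ℕ → ℕ) {i j : ℕ} (hi : i < n) (hj : j < m) :
    entry (mat n m c) i j = c i j := by
  rw [entry, mat, getD_tab _ _ _ hi, getD_tab _ _ _ hj]

theorem length_mat (n m : ℕ) (c : ℕ → ℕ → ℕ) : (mat n m c).length = n := length_tab _ _

theorem cols_mat (n m : ℕ) [NeZero n] (c : ℕ → ℕ → ℕ) : cols (mat n m c) = m := by
  rw [cols, mat, getD_tab _ _ _ (Nat.pos_of_ne_zero (NeZero.ne n)), length_tab]

/-- The cost matrix in which rows and columns are duplicated. -/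
def spread (c : List (List ℕ)) : List (List ℕ) :=
  mat (c.length * cols c) (c.length * cols c) fun a b => entry c (a / cols c) (b % cols c)

/-- The optimal transport cost, times the numbers of rows and columns and the scale. -/
def solveW (c : List (List ℕ)) (_K : ℕ) : ℕ := assign (spread c)

/-- The transport problem for a threshold. -/
def cut (c : List (List ℕ)) (t : ℕ) : List (List ℕ) :=
  mat c.length (cols c) fun i j => if t < entry c i j then 1 else 0

/-- The possible thresholds. -/
def threshold (c : List (List ℕ)) (a : ℕ) : ℕ :=
  if a < c.length * cols c then entry c (a / cols c) (a % cols c) else 0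

/-- The value for one threshold. -/
def cutValue (c : List (List ℕ)) (K t : ℕ) : ℕ :=
  max (t * (c.length * cols c)) (K * assign (spread (cut c t)))

/-- The value `PV`, times the numbers of rows and columns and the scale. -/
def solveP (c : List (List ℕ)) (K : ℕ) : ℕ :=
  cutValue c K (threshold c (argminTo (c.length * cols c + 1) fun a =>
    cutValue c K (threshold c a)))

/-- The pair `(u, v)` has the number `v + m * u`, so the quotient by `m` recovers the row of a
source copy and the remainder recovers the column of a target copy. -/
theorem assign_spread (n m : ℕ) [NeZero n] (c : ℕ → ℕ → ℕ) :
    (assign (spread (mat n m c)) : ℝ) = n * m * OT fun (u : Fin n) (v : Fin m) => (c u v : ℝ) := by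
  rcases Nat.eq_zero_or_pos m with rfl | hm
  · have : (spread (mat n 0 c)).length = 0 := by
      rw [spread, length_mat, cols_mat, mul_zero]
    simp [assign, this]
  have hn := Nat.pos_of_ne_zero (NeZero.ne n)
  have hlen : (spread (mat n m c)).length = n * m := by
    rw [spread, length_mat, length_mat, cols_mat]
  have he : ∀ a < n * m, ∀ b < n * m, entry (spread (mat n m c)) a b = c (a / m) (b % m) := by
    intro a ha b hb
    rw [spread, length_mat, cols_mat, entry_mat _ ha hb, entry_mat _
      (Nat.div_lt_of_lt_mul (by rwa [mul_comm])) (Nat.mod_lt _ hm)]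
  obtain ⟨h1, h2⟩ := assign_spec (spread (mat n m c))
  rw [hlen] at h1 h2
  have hsum : ∀ σ : Equiv.Perm (Fin n × Fin m),
      ((∑ i : Fin (n * m), entry (spread (mat n m c)) i
        (finProdFinEquiv.permCongr σ i) : ℕ) : ℝ) =
      ∑ x : Fin n × Fin m, (c x.1 (σ x).2 : ℝ) := by
    intro σ
    rw [← Equiv.sum_comp finProdFinEquiv]
    push_cast
    refine Finset.sum_congr rfl fun x _ => ?_
    rw [he _ (Fin.isLt _) _ (Fin.isLt _), Equiv.permCongr_apply, Equiv.symm_apply_apply]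
    have h3 : ∀ y : Fin n × Fin m, (finProdFinEquiv y : ℕ) = y.2 + m * y.1 := fun y => rfl
    rw [h3, h3, Nat.add_mul_div_left _ _ hm, Nat.div_eq_of_lt x.2.2, zero_add,
      Nat.add_mul_mod_self_left, Nat.mod_eq_of_lt (σ x).2.2]
  have hnm : (0 : ℝ) < n * m := by positivity
  refine le_antisymm ?_ ?_
  · obtain ⟨π, hπ⟩ := exists_OT_eq fun (u : Fin n) (v : Fin m) => (c u v : ℝ)
    rw [hπ, mul_div_cancel₀ _ hnm.ne', ← hsum]
    exact_mod_cast h2 _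
  · obtain ⟨σ, hσ⟩ := h1
    have h4 := hsum (finProdFinEquiv.permCongr.symm σ)
    rw [Equiv.apply_symm_apply, ← hσ] at h4
    rw [h4, mul_comm, ← le_div_iff₀ hnm]
    exact OT_le_perm _ _

/-- The solver `S` computes `V`, up to a factor. -/
def Solves (S : List (List ℕ) → ℕ → ℕ)
    (V : (n m : ℕ) → (Fin n → Fin m → ℝ) → ℝ) : Prop :=
  ∀ (n m : ℕ) [NeZero n] [NeZero m] (c : ℕ → ℕ → ℕ) (K : ℕ), 0 < K →
    (S (mat n m c) K : ℝ) = n * m * K * V n m fun (u : Fin n) (v : Fin m) => (c u v : ℝ) / K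

theorem solves_W : Solves solveW fun _ _ => OT := by
  intro n m _ _ c K hK
  change _ = n * m * K * OT fun (u : Fin n) (v : Fin m) => (c u v : ℝ) / K
  rw [solveW, assign_spread, OT_div _ (by exact_mod_cast hK)]
  have : (K : ℝ) ≠ 0 := by exact_mod_cast hK.ne'
  field_simp

/-- By `PV_eq` only 0 and the entries matter as thresholds, and the factor `n * m * K` makes the
value of each threshold an integer. -/
theorem solves_P : Solves solveP fun _ _ => PV := by
  intro n m _ _ c K hK
  have hK' : (0 : ℝ) < K := by exact_mod_cast hK
  have hn : (0 : ℝ) < n := by exact_mod_cast Nat.pos_of_ne_zero (NeZero.ne n)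
  have hm' := Nat.pos_of_ne_zero (NeZero.ne m)
  have hm : (0 : ℝ) < m := by exact_mod_cast hm'
  have hcut : ∀ t, cut (mat n m c) t = mat n m fun i j => if t < c i j then 1 else 0 := by
    intro t
    rw [cut, length_mat, cols_mat]
    refine List.map_congr_left fun i hi => List.map_congr_left fun j hj => ?_
    dsimp only
    rw [entry_mat _ (List.mem_range.1 hi) (List.mem_range.1 hj)]
  have hval : ∀ t : ℕ, (cutValue (mat n m c) K t : ℝ) = n * m * K * max ((t : ℝ) / K)
      (OT fun (u : Fin n) (v : Fin m) => if (t : ℝ) / K < (c u v : ℝ) / K then 1 else 0) := by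
    intro t
    rw [cutValue, length_mat, cols_mat, hcut, Nat.cast_max, Nat.cast_mul, Nat.cast_mul,
      Nat.cast_mul, assign_spread, mul_max_of_nonneg _ _ (by positivity)]
    congr 1
    · field_simp
    · have : ∀ u v : ℕ, ((t : ℝ) / K < (c u v : ℝ) / K) ↔ t < c u v := fun u v => by
        rw [div_lt_div_iff_of_pos_right hK', Nat.cast_lt]
      simp only [this]
      push_cast
      ring
  set T : Set ℝ := insert 0 (Set.range fun x : Fin n × Fin m => (c x.1 x.2 : ℝ) / K) with hT
  have hth : ∀ a, ((threshold (mat n m c) a : ℕ) : ℝ) / K ∈ T := by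
    intro a
    rw [threshold, length_mat, cols_mat]
    split_ifs with ha
    · have h1 : a / m < n := Nat.div_lt_of_lt_mul (by rwa [mul_comm])
      rw [entry_mat _ h1 (Nat.mod_lt _ hm')]
      exact Set.mem_insert_of_mem _ ⟨(⟨a / m, h1⟩, ⟨a % m, Nat.mod_lt _ hm'⟩), rfl⟩
    · simp [hT]
  have hth' : ∀ t ∈ T, ∃ a < n * m + 1, ((threshold (mat n m c) a : ℕ) : ℝ) / K = t := by
    rintro t (rfl | ⟨⟨u, v⟩, rfl⟩)
    -- The index `n * m` lies beyond the matrix and stands for the threshold 0.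
    · exact ⟨n * m, by omega, by rw [threshold, length_mat, cols_mat]; simp⟩
    · refine ⟨finProdFinEquiv (u, v), (Fin.isLt _).trans (by omega), ?_⟩
      have h3 : (finProdFinEquiv (u, v) : ℕ) = v + m * u := rfl
      rw [threshold, length_mat, cols_mat, if_pos (Fin.isLt _), h3,
        Nat.add_mul_div_left _ _ hm', Nat.div_eq_of_lt v.2, zero_add,
        Nat.add_mul_mod_self_left, Nat.mod_eq_of_lt v.2, entry_mat _ u.2 v.2]
  have hnmK : (0 : ℝ) < n * m * K := by positivity
  rw [solveP, hval]
  congr 1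
  refine (PV_eq _ T hT (fun u v => by positivity) _ _ (hth _) rfl fun t ht => ?_).symm
  obtain ⟨a, ha, rfl⟩ := hth' t ht
  refine le_of_mul_le_mul_left ?_ hnmK
  rw [← hval, ← hval]
  rw [length_mat, cols_mat]
  exact_mod_cast argminTo_le ha fun a => cutValue (mat n m c) K (threshold (mat n m c) a)

/-! ### Polynomial running time of the two transport solvers. -/

namespace PT
variable {α β γ δ σ : Type} [Enc α] [Enc β] [Enc γ] [Enc δ] [Enc σ]

@[fun_prop]
theorem cols {f : α → List (List ℕ)} (hf : PT f) : PT fun x => cols (f x) := by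
  unfold IDMetric.cols
  fun_prop

theorem sb_cols {f : α → List (List ℕ)} (hf : PT f) : SB fun x => IDMetric.cols (f x) :=
  sb_lengthNat (getList hf (const 0))

theorem mat {f : α → ℕ → ℕ → ℕ} {k l : α → ℕ}
    (hf : PT fun z : (α × ℕ) × ℕ => f z.1.1 z.1.2 z.2) (hk : PT k) (hkb : SB k) (hl : PT l)
    (hlb : SB l) : PT fun x => mat (k x) (l x) (f x) := by
  refine tab (f := fun x i => IDMetric.tab (l x) (f x i)) ?_ hk hkb
  exact tab (f := fun (z : α × ℕ) j => f z.1 z.2 j) hf (by fun_prop)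
    ((PolyBdd.trans (s := sz) (g := fun z : α × ℕ => sz z.1)
      (PolyBdd.self.mono fun z => by rw [sz_prod]; omega) (hlb.comp Prod.fst)))

theorem sb_nm {f : α → List (List ℕ)} (hf : PT f) :
    SB fun x => (f x).length * IDMetric.cols (f x) := (sb_lengthList hf).mul (sb_cols hf)

@[fun_prop]
theorem spread {f : α → List (List ℕ)} (hf : PT f) : PT fun x => spread (f x) := by
  refine mat (f := fun x a b => IDMetric.entry (f x) (a / IDMetric.cols (f x))
    (b % IDMetric.cols (f x))) ?_ ?_ (sb_nm hf) ?_ (sb_nm hf) <;> fun_prop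

theorem solveW : PT fun x : List (List ℕ) × ℕ => solveW x.1 x.2 :=
  comp assign (spread (by fun_prop))

theorem cutValue : PT fun x : List (List ℕ) × ℕ × ℕ => cutValue x.1 x.2.1 x.2.2 := by
  have h : PT fun x : List (List ℕ) × ℕ × ℕ => cut x.1 x.2.2 := by
    refine mat (f := fun (x : List (List ℕ) × ℕ × ℕ) i j =>
      if x.2.2 < IDMetric.entry x.1 i j then 1 else 0) (by fun_prop) (by fun_prop)
      (sb_lengthList (by fun_prop)) (by fun_prop) (sb_cols (by fun_prop))
  exact max (by fun_prop) (mul (by fun_prop) (comp assign (spread h)))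

theorem threshold : PT fun x : List (List ℕ) × ℕ => threshold x.1 x.2 := by
  unfold IDMetric.threshold
  fun_prop

theorem solveP : PT fun x : List (List ℕ) × ℕ => solveP x.1 x.2 := by
  have h : PT fun x : (List (List ℕ) × ℕ) × ℕ =>
      IDMetric.cutValue x.1.1 x.1.2 (IDMetric.threshold x.1.1 x.2) := by
    have := comp threshold (f := fun x : (List (List ℕ) × ℕ) × ℕ => (x.1.1, x.2)) (by fun_prop)
    exact comp cutValue (f := fun x : (List (List ℕ) × ℕ) × ℕ =>
      (x.1.1, x.1.2, IDMetric.threshold x.1.1 x.2)) (by fun_prop)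
  have h2 := argmin (f := fun (x : List (List ℕ) × ℕ) a =>
    IDMetric.cutValue x.1 x.2 (IDMetric.threshold x.1 a)) h
    (k := fun x => x.1.length * IDMetric.cols x.1 + 1) (by fun_prop)
    ((sb_nm (by fun_prop)).add (.const 1))
  exact comp h (prodMk id h2)

end PT

/-! ### Tables of iterated distances -/

/-- The transport problem for the vertices `u` and `v`: neighbours are transported at cost `d`, and
`K` is the cost of transporting a neighbour to a vertex that is not a neighbour. -/
def costMat (g h d : List (List ℕ)) (K u v : ℕ) : List (List ℕ) :=
  mat g.length h.length fun u' v' =>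
    if entry g u u' = 0 then (if entry h v v' = 0 then 0 else K)
    else if entry h v v' = 0 then K else entry d u' v'

/-- One round; a table is stored together with its scale. -/
def round (S : List (List ℕ) → ℕ → ℕ) (g h : List (List ℕ)) (x : List (List ℕ) × ℕ) :
    List (List ℕ) × ℕ :=
  (mat g.length h.length fun u v => S (costMat g h x.1 x.2 u v) x.2, g.length * h.length * x.2)

/-- The distances after `k` rounds. -/
def table (S : List (List ℕ) → ℕ → ℕ) (g h : List (List ℕ)) (k : ℕ) : List (List ℕ) × ℕ :=
  (round S g h)^[k] (mat g.length h.length fun _ _ => 0, 1)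

/-- The maxima over `1 ≤ i ≤ k` of the distances after `i` rounds divided by `i`, at `L` times the
scale of `table`. -/
def maxTable (S : List (List ℕ) → ℕ → ℕ) (g h : List (List ℕ)) (L : ℕ) (k : ℕ) :
    List (List ℕ) :=
  Nat.rec (mat g.length h.length fun _ _ => 0) (fun i e => mat g.length h.length fun u v =>
    max (entry e u v * (g.length * h.length)) (entry (table S g h (i + 1)).1 u v * (L / (i + 1)))) k

/-- Values of `V` on costs at most one are between zero and one. -/
def UnitBounded (V : (n m : ℕ) → (Fin n → Fin m → ℝ) → ℝ) : Prop :=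
  ∀ (n m : ℕ) [NeZero n] [NeZero m] (c : Fin n → Fin m → ℝ), (∀ u v, 0 ≤ c u v) →
    (∀ u v, c u v ≤ 1) → 0 ≤ V n m c ∧ V n m c ≤ 1

/-! ### Bounds for the entries of the tables. -/

section Bounds

variable {S : List (List ℕ) → ℕ → ℕ} {V : (n m : ℕ) → (Fin n → Fin m → ℝ) → ℝ}

theorem Solves.le (hS : Solves S V) (hV : UnitBounded V) {n m : ℕ} (hn : 0 < n) (hm : 0 < m)
    (c : ℕ → ℕ → ℕ) {K : ℕ} (hK : 0 < K) (hc : ∀ u < n, ∀ v < m, c u v ≤ K) :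
    S (mat n m c) K ≤ n * m * K := by
  have : NeZero n := ⟨hn.ne'⟩
  have : NeZero m := ⟨hm.ne'⟩
  have hK' : (0 : ℝ) < K := by exact_mod_cast hK
  have h := hS n m c K hK
  have h1 := (hV n m (fun (u : Fin n) (v : Fin m) => (c u v : ℝ) / K)
    (fun u v => by positivity) (fun u v => by
      rw [div_le_one hK']
      exact_mod_cast hc u u.2 v v.2)).2
  have h2 : (S (mat n m c) K : ℝ) ≤ n * m * K := by
    rw [h]
    exact mul_le_of_le_one_right (by positivity) h1
  exact_mod_cast h2

/-- A matrix with `n` rows and `m` columns and entries at most `b`. -/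
def MatLe (n m b : ℕ) (c : List (List ℕ)) : Prop :=
  ∃ f : ℕ → ℕ → ℕ, c = mat n m f ∧ ∀ u < n, ∀ v < m, f u v ≤ b

theorem MatLe.sz_le {n m b B : ℕ} {c : List (List ℕ)} (h : MatLe n m b c) (hb : b < 2 ^ B) :
    sz c ≤ n * (m * (B + 2) + 2) + 1 := by
  obtain ⟨f, rfl, hf⟩ := h
  have := sz_le_of_forall (mat n m f) (m * (B + 2) + 1) fun a ha => by
    obtain ⟨i, hi, rfl⟩ := List.mem_map.1 ha
    exact (ListLe.tab (hf i (List.mem_range.1 hi))).sz_le hb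
  rwa [length_mat] at this

theorem table_succ (S : List (List ℕ) → ℕ → ℕ) (g h : List (List ℕ)) (k : ℕ) :
    table S g h (k + 1) = round S g h (table S g h k) := Function.iterate_succ_apply' _ _ _

theorem table_scale (S : List (List ℕ) → ℕ → ℕ) (g h : List (List ℕ)) (k : ℕ) :
    (table S g h k).2 = (g.length * h.length) ^ k := by
  induction k with
  | zero => rfl
  | succ k ih =>
    rw [table_succ, pow_succ']
    change _ * (table S g h k).2 = _
    rw [ih]

/-- Since distances are at most 1, an entry never exceeds the scale, so the bit lengths grow only
linearly with the number of rounds. -/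
theorem table_le (hS : Solves S V) (hV : UnitBounded V) (g h : List (List ℕ)) (k : ℕ) :
    MatLe g.length h.length ((g.length * h.length) ^ k) (table S g h k).1 := by
  induction k with
  | zero => exact ⟨_, rfl, fun _ _ _ _ => Nat.zero_le _⟩
  | succ k ih =>
    obtain ⟨f, hf, hfb⟩ := ih
    rw [table_succ]
    refine ⟨_, rfl, fun u hu v hv => ?_⟩
    rw [table_scale, pow_succ']
    have hn : 0 < g.length := by omega
    have hm : 0 < h.length := by omega
    refine hS.le hV hn hm _ (by positivity) fun u' hu' v' hv' => ?_
    rw [hf, entry_mat _ hu' hv']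
    have := hfb u' hu' v' hv'
    split_ifs <;> omega

theorem maxTable_le (hS : Solves S V) (hV : UnitBounded V) (g h : List (List ℕ)) (L k : ℕ) :
    MatLe g.length h.length ((g.length * h.length) ^ k * L) (maxTable S g h L k) := by
  induction k with
  | zero => exact ⟨_, rfl, fun _ _ _ _ => Nat.zero_le _⟩
  | succ k ih =>
    obtain ⟨f, hf, hfb⟩ := ih
    obtain ⟨f', hf', hfb'⟩ := table_le hS hV g h (k + 1)
    refine ⟨_, rfl, fun u hu v hv => max_le ?_ ?_⟩
    · change entry (maxTable S g h L k) u v * _ ≤ _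
      rw [hf, entry_mat _ hu hv, pow_succ, mul_right_comm]
      exact Nat.mul_le_mul_right _ (hfb u hu v hv)
    · rw [hf', entry_mat _ hu hv]
      exact Nat.mul_le_mul (hfb' u hu v hv) (Nat.div_le_self _ _)

end Bounds

/-- A crude bound; it is enough that the exponent is polynomial in `n` and `k`. -/
theorem pow_lt_two_pow (n k : ℕ) : n ^ k < 2 ^ (k * n + 1) :=
  calc n ^ k ≤ (2 ^ n) ^ k := Nat.pow_le_pow_left Nat.lt_two_pow_self.le k
    _ = 2 ^ (k * n) := by rw [← pow_mul, mul_comm]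
    _ < 2 ^ (k * n + 1) := Nat.pow_lt_pow_right (by norm_num) (by omega)

theorem factorial_le_two_pow (k : ℕ) : k.factorial ≤ 2 ^ (k * k) := by
  calc k.factorial ≤ k ^ k := Nat.factorial_le_pow k
    _ ≤ (2 ^ k) ^ k := Nat.pow_le_pow_left Nat.lt_two_pow_self.le k
    _ = 2 ^ (k * k) := by rw [← pow_mul]

/-! ### Polynomial running time of the tables. -/

namespace PT
variable {α β γ δ σ : Type} [Enc α] [Enc β] [Enc γ] [Enc δ] [Enc σ]
variable {S : List (List ℕ) → ℕ → ℕ} {V : (n m : ℕ) → (Fin n → Fin m → ℝ) → ℝ}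

theorem costMat : PT fun x : (List (List ℕ) × List (List ℕ) × List (List ℕ)) × ℕ × ℕ × ℕ =>
    costMat x.1.1 x.1.2.1 x.1.2.2 x.2.1 x.2.2.1 x.2.2.2 := by
  refine mat (f := fun (x : (List (List ℕ) × List (List ℕ) × List (List ℕ)) × ℕ × ℕ × ℕ) u' v' =>
    if IDMetric.entry x.1.1 x.2.2.1 u' = 0
    then (if IDMetric.entry x.1.2.1 x.2.2.2 v' = 0 then 0 else x.2.1)
    else if IDMetric.entry x.1.2.1 x.2.2.2 v' = 0 then x.2.1 else IDMetric.entry x.1.2.2 u' v')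
    (by fun_prop) (by fun_prop) (sb_lengthList (by fun_prop)) (by fun_prop)
    (sb_lengthList (by fun_prop))

theorem round (hS : PT fun x : List (List ℕ) × ℕ => S x.1 x.2) :
    PT fun x : (List (List ℕ) × List (List ℕ)) × List (List ℕ) × ℕ =>
      round S x.1.1 x.1.2 x.2 := by
  refine prodMk (mat (f := fun (x : (List (List ℕ) × List (List ℕ)) × List (List ℕ) × ℕ) u v =>
    S (IDMetric.costMat x.1.1 x.1.2 x.2.1 x.2.2 u v) x.2.2) ?_ (by fun_prop)
    (sb_lengthList (by fun_prop)) (by fun_prop) (sb_lengthList (by fun_prop))) (by fun_prop)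
  exact comp hS (prodMk (comp costMat (f := fun z :
    (((List (List ℕ) × List (List ℕ)) × List (List ℕ) × ℕ) × ℕ) × ℕ =>
    ((z.1.1.1.1, z.1.1.1.2, z.1.1.2.1), z.1.1.2.2, z.1.2, z.2)) (by fun_prop)) (by fun_prop))

theorem table (hS : PT fun x : List (List ℕ) × ℕ => S x.1 x.2) (hSV : Solves S V)
    (hV : UnitBounded V) {g h : α → List (List ℕ)} {k : α → ℕ} (hg : PT g) (hh : PT h) (hk : PT k)
    (hkb : SB k) : PT fun x => table S (g x) (h x) (k x) := by
  have hn : SB fun x => (g x).length := sb_lengthList hg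
  have hm : SB fun x => (h x).length := sb_lengthList hh
  have hB : SB fun x => k x * ((g x).length * (h x).length) + 1 :=
    (hkb.mul (hn.mul hm)).add (.const 1)
  refine iterate (f := fun x => IDMetric.round S (g x) (h x))
    (g := fun x => (IDMetric.mat (g x).length (h x).length fun _ _ => 0, 1)) (k := k)
    (b := fun x => ((g x).length * ((h x).length *
      (k x * ((g x).length * (h x).length) + 1 + 2) + 2) + 1) +
      (k x * ((g x).length * (h x).length) + 1 + 1) + 1)
    (comp (round hS) (f := fun z : α × List (List ℕ) × ℕ => ((g z.1, h z.1), z.2))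
      (by fun_prop))
    (prodMk (mat (f := fun _ _ _ => 0) (by fun_prop) (by fun_prop) hn (by fun_prop) hm)
      (by fun_prop)) hk hkb
    ((((hn.mul ((hm.mul (hB.add (.const 2))).add (.const 2))).add (.const 1)).add
      (hB.add (.const 1))).add (.const 1)) ?_
  intro x i hi
  change sz (IDMetric.table S (g x) (h x) i) ≤ _
  have hlt : ((g x).length * (h x).length) ^ i <
      2 ^ (k x * ((g x).length * (h x).length) + 1) :=
    (pow_lt_two_pow _ _).trans_le (Nat.pow_le_pow_right (by norm_num)
      (by gcongr))
  have h1 := (table_le hSV hV (g x) (h x) i).sz_le hlt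
  have h2 : sz (IDMetric.table S (g x) (h x) i).2 ≤
      k x * ((g x).length * (h x).length) + 1 + 1 := by
    rw [table_scale, sz_nat, add_le_add_iff_right, Nat.size_le]
    exact hlt
  rw [sz_prod]
  omega

theorem factorial {k : α → ℕ} (hk : PT k) (hkb : SB k) : PT fun x => (k x).factorial := by
  have hrec : ∀ i, (Nat.rec 1 (fun i a => (i + 1) * a) i : ℕ) = i.factorial := by
    intro i
    induction i with
    | zero => rfl
    | succ i ih => rw [Nat.factorial_succ, ← ih]
  refine congr (natRec (f := fun _ i a => (i + 1) * a) (g := fun _ => 1) (k := k)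
    (b := fun x => k x * k x + 2) (by fun_prop) (by fun_prop) hk hkb
    ((hkb.mul hkb).add (.const 2)) ?_) fun x => (hrec _).symm
  intro x i hi
  rw [hrec, sz_nat]
  have h1 := Nat.size_le_size ((Nat.factorial_le hi).trans (factorial_le_two_pow _))
  rw [Nat.size_pow] at h1
  omega

theorem maxTable (hS : PT fun x : List (List ℕ) × ℕ => S x.1 x.2) (hSV : Solves S V)
    (hV : UnitBounded V) {g h : α → List (List ℕ)} {k : α → ℕ} (hg : PT g) (hh : PT h) (hk : PT k)
    (hkb : SB k) : PT fun x => maxTable S (g x) (h x) (k x).factorial (k x) := by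
  have hn : SB fun x => (g x).length := sb_lengthList hg
  have hm : SB fun x => (h x).length := sb_lengthList hh
  have hB : SB fun x => k x * ((g x).length * (h x).length) + 1 + k x * k x :=
    ((hkb.mul (hn.mul hm)).add (.const 1)).add (hkb.mul hkb)
  -- The body of the recursion must be polynomial for every index, also for one far beyond `k`.
  -- Capping the index ensures this and changes nothing at the indices that occur.
  have ht : PT fun z : α × ℕ => IDMetric.table S (g z.1) (h z.1)
      (Min.min (z.2 + 1) (k z.1 + 1)) := by
    refine table hS hSV hV (by fun_prop) (by fun_prop) (by fun_prop) ?_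
    have : SB fun z : α × ℕ => k z.1 := PolyBdd.trans (g := fun z : α × ℕ => sz z.1)
      (PolyBdd.self.mono fun z => by rw [sz_prod]; omega) (hkb.comp Prod.fst)
    exact (this.add (.const 1)).mono fun z => min_le_right _ _
  have ht' : PT fun z : (((α × ℕ × List (List ℕ)) × ℕ) × ℕ) =>
      (IDMetric.table S (g z.1.1.1) (h z.1.1.1) (Min.min (z.1.1.2.1 + 1) (k z.1.1.1 + 1))).1 :=
    fst (comp ht (f := fun z : (((α × ℕ × List (List ℕ)) × ℕ) × ℕ) => (z.1.1.1, z.1.1.2.1))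
      (by fun_prop))
  have hfac := factorial hk hkb
  have hfac' : PT fun z : (((α × ℕ × List (List ℕ)) × ℕ) × ℕ) => (k z.1.1.1).factorial :=
    comp hfac (f := fun z : (((α × ℕ × List (List ℕ)) × ℕ) × ℕ) => z.1.1.1) (by fun_prop)
  have hn' : SB fun z : α × ℕ × List (List ℕ) => (g z.1).length := sb_lengthList (by fun_prop)
  have hm' : SB fun z : α × ℕ × List (List ℕ) => (h z.1).length := sb_lengthList (by fun_prop)
  have hrec : ∀ x, ∀ i ≤ k x, (Nat.rec (IDMetric.mat (g x).length (h x).length fun _ _ => 0)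
      (fun i e => IDMetric.mat (g x).length (h x).length fun u v =>
        Max.max (IDMetric.entry e u v * ((g x).length * (h x).length))
          (IDMetric.entry (IDMetric.table S (g x) (h x) (Min.min (i + 1) (k x + 1))).1 u v *
            ((k x).factorial / (i + 1)))) i : List (List ℕ)) =
      IDMetric.maxTable S (g x) (h x) (k x).factorial i := by
    intro x i
    induction i with
    | zero => intro _; rfl
    | succ i ih =>
      intro hi
      dsimp only
      rw [ih (by omega), min_eq_left (by omega)]
      rfl
  refine congr (natRec (f := fun x i e => IDMetric.mat (g x).length (h x).length fun u v =>
      Max.max (IDMetric.entry e u v * ((g x).length * (h x).length))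
        (IDMetric.entry (IDMetric.table S (g x) (h x) (Min.min (i + 1) (k x + 1))).1 u v *
          ((k x).factorial / (i + 1))))
    (g := fun x => IDMetric.mat (g x).length (h x).length fun _ _ => 0) (k := k)
    (b := fun x => (g x).length * ((h x).length *
      (k x * ((g x).length * (h x).length) + 1 + k x * k x + 2) + 2) + 1)
    (mat (f := fun (z : α × ℕ × List (List ℕ)) u v =>
      Max.max (IDMetric.entry z.2.2 u v * ((g z.1).length * (h z.1).length))
        (IDMetric.entry (IDMetric.table S (g z.1) (h z.1) (Min.min (z.2.1 + 1) (k z.1 + 1))).1 u v *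
          ((k z.1).factorial / (z.2.1 + 1)))) ?_ (by fun_prop) hn' (by fun_prop) hm')
    (mat (f := fun _ _ _ => 0) (by fun_prop) (by fun_prop) hn (by fun_prop) hm) hk hkb
    ((hn.mul ((hm.mul (hB.add (.const 2))).add (.const 2))).add (.const 1)) ?_)
    fun x => (hrec x _ le_rfl).symm
  · refine max (by fun_prop) (mul (entry ht' (by fun_prop) (by fun_prop))
      (div hfac' (by fun_prop)))
  · intro x i hi
    rw [hrec x i hi]
    refine (maxTable_le hSV hV (g x) (h x) _ i).sz_le ?_
    rw [pow_add]
    refine Nat.mul_lt_mul_of_lt_of_le ((pow_lt_two_pow _ _).trans_le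
      (Nat.pow_le_pow_right (by norm_num) (by gcongr))) (factorial_le_two_pow _) (by positivity)

end PT

/-! ### Iterated distances of the vertices of two graphs -/

section Iter

open Classical in
/-- The transport problem for the vertices `u` and `v`. -/
def costR {n m : ℕ} (G : SimpleGraph (Fin n)) (H : SimpleGraph (Fin m)) (d : Fin n → Fin m → ℝ)
    (u : Fin n) (v : Fin m) : Fin n → Fin m → ℝ := fun u' v' =>
  if G.Adj u u' then (if H.Adj v v' then d u' v' else 1) else if H.Adj v v' then 1 else 0

/-- The iterated distances between the vertices of `G` and `H`. -/
def iterV (V : (n m : ℕ) → (Fin n → Fin m → ℝ) → ℝ) {n m : ℕ} (G : SimpleGraph (Fin n))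
    (H : SimpleGraph (Fin m)) : ℕ → Fin n → Fin m → ℝ
  | 0 => fun _ _ => 0
  | k + 1 => fun u v => V n m (costR G H (iterV V G H k) u v)

/-- The maxima of the iterated distances after `1 ≤ i ≤ k` rounds, divided by `i`. -/
def maxV (V : (n m : ℕ) → (Fin n → Fin m → ℝ) → ℝ) {n m : ℕ} (G : SimpleGraph (Fin n))
    (H : SimpleGraph (Fin m)) : ℕ → Fin n → Fin m → ℝ
  | 0 => fun _ _ => 0
  | k + 1 => fun u v => max (maxV V G H k u v) (iterV V G H (k + 1) u v / ((k : ℝ) + 1))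

/-- The suprema of the iterated distances, divided by the number of rounds. -/
def supV (V : (n m : ℕ) → (Fin n → Fin m → ℝ) → ℝ) {n m : ℕ} (G : SimpleGraph (Fin n))
    (H : SimpleGraph (Fin m)) (u : Fin n) (v : Fin m) : ℝ :=
  ⨆ k : ℕ, iterV V G H (k + 1) u v / ((k : ℝ) + 1)

variable {V : (n m : ℕ) → (Fin n → Fin m → ℝ) → ℝ} {n m : ℕ} [NeZero n] [NeZero m]
  (G : SimpleGraph (Fin n)) (H : SimpleGraph (Fin m))

theorem unitBounded_OT : UnitBounded fun _ _ => OT :=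
  fun _ _ _ _ _ h0 h1 => ⟨OT_nonneg h0, OT_le_one h1⟩

theorem unitBounded_PV : UnitBounded fun _ _ => PV :=
  fun _ _ _ _ c _ _ => ⟨PV_nonneg c, PV_le_one c⟩

/-- Larger costs have larger values of `V`. -/
def Increasing (V : (n m : ℕ) → (Fin n → Fin m → ℝ) → ℝ) : Prop :=
  ∀ (n m : ℕ) (c c' : Fin n → Fin m → ℝ), (∀ u v, c u v ≤ c' u v) → V n m c ≤ V n m c'

theorem increasing_PV : Increasing fun _ _ => PV := fun _ _ _ _ h => PV_mono h

theorem costR_mono {n m : ℕ} (G : SimpleGraph (Fin n)) (H : SimpleGraph (Fin m))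
    {d d' : Fin n → Fin m → ℝ} (h : ∀ u v, d u v ≤ d' u v) (u : Fin n) (v : Fin m)
    (u' : Fin n) (v' : Fin m) : costR G H d u v u' v' ≤ costR G H d' u v u' v' := by
  unfold costR
  split_ifs
  · exact h _ _
  all_goals rfl

theorem iterV_mem (hV : UnitBounded V) (k : ℕ) (u : Fin n) (v : Fin m) :
    0 ≤ iterV V G H k u v ∧ iterV V G H k u v ≤ 1 := by
  induction k generalizing u v with
  | zero => exact ⟨le_rfl, zero_le_one⟩
  | succ k ih =>
    refine hV n m _ (fun u' v' => ?_) (fun u' v' => ?_)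
    · unfold costR
      split_ifs
      · exact (ih _ _).1
      all_goals norm_num
    · unfold costR
      split_ifs
      · exact (ih _ _).2
      all_goals norm_num

/-- The iteration starts at 0, and the recursion preserves inequalities because `V` is increasing.
-/
theorem iterV_mono (hV : UnitBounded V) (hI : Increasing V) (k : ℕ) (u : Fin n) (v : Fin m) :
    iterV V G H k u v ≤ iterV V G H (k + 1) u v := by
  induction k generalizing u v with
  | zero => exact (iterV_mem G H hV 1 u v).1
  | succ k ih => exact hI n m _ _ (costR_mono G H ih u v)

theorem bddAbove_iterV (hV : UnitBounded V) (u : Fin n) (v : Fin m) :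
    BddAbove (Set.range fun k : ℕ => iterV V G H (k + 1) u v / ((k : ℝ) + 1)) := by
  refine ⟨1, ?_⟩
  rintro _ ⟨k, rfl⟩
  have := (iterV_mem G H hV (k + 1) u v).2
  exact div_le_one_of_le₀ (by linarith [Nat.cast_nonneg (α := ℝ) k]) (by positivity)

theorem supV_nonneg (hV : UnitBounded V) (u : Fin n) (v : Fin m) : 0 ≤ supV V G H u v :=
  Real.iSup_nonneg fun k => div_nonneg (iterV_mem G H hV (k + 1) u v).1 (by positivity)

theorem maxV_le_supV (hV : UnitBounded V) (k : ℕ) (u : Fin n) (v : Fin m) :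
    maxV V G H k u v ≤ supV V G H u v := by
  induction k with
  | zero => exact supV_nonneg G H hV u v
  | succ k ih => exact max_le ih (le_ciSup (bddAbove_iterV G H hV u v) k)

theorem le_maxV {n m : ℕ} (G : SimpleGraph (Fin n)) (H : SimpleGraph (Fin m)) {i k : ℕ} (h : i < k) (u : Fin n) (v : Fin m) :
    iterV V G H (i + 1) u v / ((i : ℝ) + 1) ≤ maxV V G H k u v := by
  induction k with
  | zero => omega
  | succ k ih =>
    rcases Nat.lt_succ_iff_lt_or_eq.1 h with h | rfl
    · exact (ih h).trans (le_max_left _ _)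
    · exact le_max_right _ _

/-- If later distances exceed the distance after `k` rounds by at most `e`, then the supremum
exceeds the maximum by at most `e`. -/
theorem supV_le_maxV_add {k : ℕ} {e : ℝ} (he : 0 ≤ e) (u : Fin n) (v : Fin m)
    (hV : UnitBounded V)
    (h : ∀ j, iterV V G H (k + 1 + j) u v ≤ iterV V G H (k + 1) u v + e) :
    supV V G H u v ≤ maxV V G H (k + 1) u v + e := by
  refine ciSup_le fun i => ?_
  rcases Nat.lt_or_ge i (k + 1) with hi | hi
  · exact (le_maxV G H hi u v).trans (by linarith)
  · obtain ⟨j, rfl⟩ := Nat.exists_eq_add_of_le hi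
    have h0 := (iterV_mem G H hV (k + 1) u v).1
    have h1 := h (j + 1)
    have h2 := le_maxV (V := V) G H (Nat.lt_succ_self k) u v
    refine le_trans ?_ (add_le_add_left h2 e)
    push_cast
    rw [show k + 1 + (j + 1) = k + 1 + j + 1 by ring] at h1
    calc _ ≤ (iterV V G H (k + 1) u v + e) / ((k : ℝ) + 1 + j + 1) := by gcongr
      _ ≤ (iterV V G H (k + 1) u v + e) / ((k : ℝ) + 1) := by
        gcongr
        linarith [Nat.cast_nonneg (α := ℝ) j]
      _ = iterV V G H (k + 1) u v / ((k : ℝ) + 1) + e / ((k : ℝ) + 1) := add_div _ _ _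
      _ ≤ _ := by
        gcongr
        exact div_le_self he (by linarith [Nat.cast_nonneg (α := ℝ) k])

/-! #### The Prokhorov distance: stabilization -/

/-- For costs 0 and 1 an optimal permutation merely counts points, among `n * m` of them. -/
theorem OT_indicator_eq {n m : ℕ} (p : Fin n → Fin m → Prop) [∀ u v, Decidable (p u v)] :
    ∃ a : ℕ, OT (fun u v => if p u v then 1 else 0) = (a : ℝ) / (n * m) := by
  obtain ⟨π, hπ⟩ := exists_OT_eq fun u v => if p u v then (1 : ℝ) else 0
  exact ⟨∑ x : Fin n × Fin m, if p x.1 (π x).2 then 1 else 0, by rw [hπ]; push_cast; rfl⟩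

/-- By `PV_eq` the value is a threshold or an optimum for 0-1 costs, and both have denominator `n *
m`. -/
theorem PV_eq_div {n m : ℕ} (c : Fin n → Fin m → ℝ) (hc : ∀ u v, ∃ a : ℕ, c u v = (a : ℝ) / (n * m)) :
    ∃ a : ℕ, PV c = (a : ℝ) / (n * m) := by
  set T : Set ℝ := insert 0 (Set.range fun x : Fin n × Fin m => c x.1 x.2) with hT
  have hfin : T.Finite := (Set.finite_range _).insert 0
  obtain ⟨t₀, ht₀, hmin⟩ := Set.exists_min_image T
    (fun t => max t (OT fun u v => if t < c u v then 1 else 0)) hfin ⟨0, Set.mem_insert _ _⟩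
  have hc0 : ∀ u v, 0 ≤ c u v := fun u v => by
    obtain ⟨a, ha⟩ := hc u v
    rw [ha]
    positivity
  rw [PV_eq c T hT hc0 _ t₀ ht₀ rfl hmin]
  have h1 : ∃ a : ℕ, t₀ = (a : ℝ) / (n * m) := by
    rcases ht₀ with rfl | ⟨x, rfl⟩
    · exact ⟨0, by simp⟩
    · exact hc _ _
  obtain ⟨b, hb⟩ := OT_indicator_eq fun u v => t₀ < c u v
  obtain ⟨a, ha⟩ := h1
  rcases max_choice t₀ (OT fun u v => if t₀ < c u v then 1 else 0) with h | h
  · exact ⟨a, h.trans ha⟩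
  · exact ⟨b, h.trans hb⟩

theorem iterV_PV_eq_div (k : ℕ) (u : Fin n) (v : Fin m) :
    ∃ a : ℕ, iterV (fun _ _ => PV) G H k u v = (a : ℝ) / (n * m) := by
  have hnm : (n : ℝ) * m ≠ 0 := by
    exact_mod_cast mul_ne_zero (NeZero.ne n) (NeZero.ne m)
  induction k generalizing u v with
  | zero => exact ⟨0, by simp [iterV]⟩
  | succ k ih =>
    refine PV_eq_div _ fun u' v' => ?_
    unfold costR
    split_ifs
    · exact ih _ _
    · exact ⟨n * m, by push_cast; rw [div_self hnm]⟩
    · exact ⟨n * m, by push_cast; rw [div_self hnm]⟩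
    · exact ⟨0, by simp⟩

/-- The numerators over `n * m` do not decrease, and their sum over all pairs of vertices is at most
`(n * m) ^ 2`. Hence an early step changes nothing, and from then on the recursion is stationary. -/
theorem iterV_PV_const {k : ℕ} (hk : (n * m) ^ 2 ≤ k) (j : ℕ) :
    iterV (fun _ _ => PV) G H (k + j) = iterV (fun _ _ => PV) G H k := by
  have hstable : ∀ i, iterV (fun _ _ => PV) G H (i + 1) = iterV (fun _ _ => PV) G H i →
      ∀ j, iterV (fun _ _ => PV) G H (i + j) = iterV (fun _ _ => PV) G H i := by
    intro i hi j
    induction j with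
    | zero => rfl
    | succ j ih =>
      rw [← hi, ← add_assoc]
      funext u v
      change PV (costR G H (iterV (fun _ _ => PV) G H (i + j)) u v) = _
      rw [ih]
      rfl
  have hnm : (0 : ℝ) < (n : ℝ) * m := by
    exact_mod_cast Nat.pos_of_ne_zero (mul_ne_zero (NeZero.ne n) (NeZero.ne m))
  choose a ha using iterV_PV_eq_div G H
  have hmono : ∀ i u v, a i u v ≤ a (i + 1) u v := by
    intro i u v
    have := iterV_mono G H unitBounded_PV increasing_PV i u v
    rw [ha, ha, div_le_div_iff_of_pos_right hnm] at this
    exact_mod_cast this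
  have hle : ∀ i u v, a i u v ≤ n * m := by
    intro i u v
    have := (iterV_mem G H unitBounded_PV i u v).2
    rw [ha, div_le_one hnm] at this
    exact_mod_cast this
  have hex : ∃ i ≤ (n * m) ^ 2, ∑ u, ∑ v, a (i + 1) u v = ∑ u, ∑ v, a i u v := by
    by_contra! hne
    have hlt : ∀ i ≤ (n * m) ^ 2 + 1, i ≤ ∑ u, ∑ v, a i u v := by
      intro i
      induction i with
      | zero => intro _; exact Nat.zero_le _
      | succ i ih =>
        intro hi
        have h1 := ih (by omega)
        have h2 : ∑ u, ∑ v, a i u v ≤ ∑ u, ∑ v, a (i + 1) u v :=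
          Finset.sum_le_sum fun u _ => Finset.sum_le_sum fun v _ => hmono i u v
        have h3 := hne i (by omega)
        omega
    have h4 := hlt _ le_rfl
    have h5 : ∑ u, ∑ v, a ((n * m) ^ 2 + 1) u v ≤ ∑ _u : Fin n, ∑ _v : Fin m, n * m :=
      Finset.sum_le_sum fun u _ => Finset.sum_le_sum fun v _ => hle _ u v
    simp only [Finset.sum_const, Finset.card_univ, Fintype.card_fin, smul_eq_mul] at h5
    have h6 : n * (m * (n * m)) = (n * m) ^ 2 := by ring
    omega
  obtain ⟨i, hi, hsum⟩ := hex
  -- Numbers that are ordered termwise and have equal sums agree termwise.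
  have heq : iterV (fun _ _ => PV) G H (i + 1) = iterV (fun _ _ => PV) G H i := by
    funext u v
    rw [ha, ha]
    have h1 := (Finset.sum_eq_sum_iff_of_le fun u _ =>
      Finset.sum_le_sum fun v (_ : v ∈ Finset.univ) => hmono i u v).1 hsum.symm u
      (Finset.mem_univ u)
    have h2 := (Finset.sum_eq_sum_iff_of_le fun v _ => hmono i u v).1 h1 v (Finset.mem_univ v)
    rw [h2]
  obtain ⟨l, rfl⟩ := Nat.exists_eq_add_of_le (hi.trans hk)
  rw [add_assoc, hstable i heq, hstable i heq]

theorem supV_PV_eq : supV (fun _ _ => PV) G H = maxV (fun _ _ => PV) G H ((n * m) ^ 2 + 1) := by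
  funext u v
  refine le_antisymm ?_ (maxV_le_supV G H unitBounded_PV _ u v)
  have := supV_le_maxV_add (V := fun _ _ => PV) G H (k := (n * m) ^ 2) le_rfl u v unitBounded_PV
    fun j => by rw [iterV_PV_const G H (by omega) j, add_zero]
  simpa using this

/-! #### The unbalanced Wasserstein distance: contraction -/

/-- As `u` is not adjacent to itself, the copies of `u`, a share `1 / n` of all points, have costs
that do not depend on the previous distances. Only the other copies feel the error `e`. -/
theorem OT_costR_le {d d' : Fin n → Fin m → ℝ} {e : ℝ} (he : 0 ≤ e)
    (h : ∀ u v, d u v ≤ d' u v + e) (u : Fin n) (v : Fin m) :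
    OT (costR G H d u v) ≤ OT (costR G H d' u v) + (1 - 1 / (n : ℝ)) * e := by
  have hn : (n : ℝ) ≠ 0 := by exact_mod_cast NeZero.ne n
  have hm : (m : ℝ) ≠ 0 := by exact_mod_cast NeZero.ne m
  obtain ⟨π, hπ⟩ := exists_OT_eq (costR G H d' u v)
  refine (OT_le_perm _ π).trans ?_
  have h1 : ∀ x : Fin n × Fin m, costR G H d u v x.1 (π x).2 ≤
      costR G H d' u v x.1 (π x).2 + (e - if x.1 = u then e else 0) := by
    intro x
    by_cases hx : x.1 = u
    · simp [costR, hx]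
    · rw [if_neg hx, sub_zero]
      unfold costR
      split_ifs
      · exact h _ _
      all_goals linarith
  have h2 := Finset.sum_le_sum fun x (_ : x ∈ Finset.univ) => h1 x
  rw [Finset.sum_add_distrib, Finset.sum_sub_distrib] at h2
  have h3 : ∑ x : Fin n × Fin m, (if x.1 = u then e else 0) = m * e := by
    simp [Fintype.sum_prod_type_right]
  rw [h3] at h2
  simp only [Finset.sum_const, Finset.card_univ, Fintype.card_prod, Fintype.card_fin,
    nsmul_eq_mul] at h2
  rw [hπ]
  calc _ ≤ (∑ x, costR G H d' u v x.1 (π x).2 + (((n * m : ℕ) : ℝ) * e - m * e)) / (n * m) := by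
        gcongr
    _ = _ := by
        push_cast
        field_simp

theorem OT_le_add {c c' : Fin n → Fin m → ℝ} {e : ℝ} (h : ∀ u v, c u v ≤ c' u v + e) :
    OT c ≤ OT c' + e := by
  have hn : (n : ℝ) ≠ 0 := by exact_mod_cast NeZero.ne n
  have hm : (m : ℝ) ≠ 0 := by exact_mod_cast NeZero.ne m
  obtain ⟨π, hπ⟩ := exists_OT_eq c'
  refine (OT_le_perm _ π).trans ?_
  have h2 := Finset.sum_le_sum fun (x : Fin n × Fin m) (_ : x ∈ Finset.univ) => h x.1 (π x).2
  rw [Finset.sum_add_distrib] at h2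
  simp only [Finset.sum_const, Finset.card_univ, Fintype.card_prod, Fintype.card_fin,
    nsmul_eq_mul] at h2
  rw [hπ]
  calc _ ≤ (∑ x, c' x.1 (π x).2 + ((n * m : ℕ) : ℝ) * e) / (n * m) := by gcongr
    _ = _ := by
        push_cast
        field_simp

theorem one_sub_inv_mem : 0 ≤ 1 - 1 / (n : ℝ) ∧ 1 - 1 / (n : ℝ) ≤ 1 := by
  have hn : (1 : ℝ) ≤ n := by exact_mod_cast Nat.pos_of_ne_zero (NeZero.ne n)
  have h1 : 1 / (n : ℝ) ≤ 1 := by rw [div_le_one (by linarith)]; exact hn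
  have h2 : 0 ≤ 1 / (n : ℝ) := by positivity
  constructor <;> linarith

/-- The same recursion is started from the distances at round `j` and from 0, which differ by at
most 1, and each of the `k` rounds shrinks the difference. -/
theorem iterV_OT_le (k j : ℕ) (u : Fin n) (v : Fin m) :
    iterV (fun _ _ => OT) G H (k + j) u v ≤
      iterV (fun _ _ => OT) G H k u v + (1 - 1 / (n : ℝ)) ^ k := by
  induction k generalizing u v with
  | zero =>
    have := (iterV_mem G H unitBounded_OT j u v).2
    simpa [iterV] using this
  | succ k ih =>
    rw [add_right_comm, pow_succ']
    exact OT_costR_le G H (pow_nonneg one_sub_inv_mem.1 k) ih u v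

/-- From `(1 - 1/n) ^ n ≤ 1/e ≤ 1/2`. -/
theorem one_sub_inv_pow_le (k : ℕ) : (1 - 1 / (n : ℝ)) ^ (n * (k + 1)) ≤ (1 / 2 : ℝ) ^ k := by
  have hn : (1 : ℝ) ≤ n := by exact_mod_cast Nat.pos_of_ne_zero (NeZero.ne n)
  have h1 : (1 - 1 / (n : ℝ)) ^ n ≤ 1 / 2 := by
    refine (Real.one_sub_div_pow_le_exp_neg hn).trans ?_
    rw [Real.exp_neg, one_div]
    have := Real.add_one_le_exp (1 : ℝ)
    exact inv_anti₀ (by norm_num) (by linarith)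
  rw [pow_mul]
  calc _ ≤ (1 / 2 : ℝ) ^ (k + 1) := by
        gcongr
        exact pow_nonneg one_sub_inv_mem.1 n
    _ ≤ (1 / 2 : ℝ) ^ k := pow_le_pow_of_le_one (by norm_num) (by norm_num) (by omega)

theorem supV_OT_le (k : ℕ) (u : Fin n) (v : Fin m) :
    supV (fun _ _ => OT) G H u v ≤
      maxV (fun _ _ => OT) G H (n * (k + 1)) u v + (1 / 2 : ℝ) ^ k := by
  obtain ⟨l, hl⟩ : ∃ l, n * (k + 1) = l + 1 :=
    Nat.exists_eq_succ_of_ne_zero (mul_ne_zero (NeZero.ne n) (by omega))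
  have h1 := one_sub_inv_pow_le (n := n) k
  have h2 := supV_le_maxV_add (V := fun _ _ => OT) G H (k := l)
    (pow_nonneg (one_sub_inv_mem (n := n)).1 (l + 1)) u v unitBounded_OT
    fun j => iterV_OT_le G H _ j u v
  rw [hl] at h1 ⊢
  linarith

end Iter

/-! ### The tables contain the iterated distances -/

section TableSpec

open Classical in
/-- The adjacency matrix as a list of rows. -/
def adjList {n : ℕ} (G : SimpleGraph (Fin n)) : List (List ℕ) :=
  List.ofFn fun i : Fin n => List.ofFn fun j : Fin n => if G.Adj i j then 1 else 0

theorem length_adjList {n : ℕ} (G : SimpleGraph (Fin n)) : (adjList G).length = n := by simp [adjList]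

open Classical in
theorem entry_adjList {n : ℕ} (G : SimpleGraph (Fin n)) (i j : Fin n) : entry (adjList G) i j = if G.Adj i j then 1 else 0 := by
  simp [entry, adjList, List.getD_eq_getElem?_getD]

variable {S : List (List ℕ) → ℕ → ℕ} {V : (n m : ℕ) → (Fin n → Fin m → ℝ) → ℝ}
  {n m : ℕ} [NeZero n] [NeZero m] (G : SimpleGraph (Fin n)) (H : SimpleGraph (Fin m))

theorem table_spec (hS : Solves S V) (k : ℕ) :
    ∃ f : ℕ → ℕ → ℕ, (table S (adjList G) (adjList H) k).1 = mat n m f ∧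
      ∀ (u : Fin n) (v : Fin m), (f u v : ℝ) / ((n * m) ^ k : ℕ) = iterV V G H k u v := by
  have hnm : 0 < n * m := Nat.pos_of_ne_zero (mul_ne_zero (NeZero.ne n) (NeZero.ne m))
  induction k with
  | zero =>
    refine ⟨fun _ _ => 0, ?_, fun u v => by simp [iterV]⟩
    change mat (adjList G).length (adjList H).length _ = _
    rw [length_adjList, length_adjList]
  | succ k ih =>
    obtain ⟨f, hf, hfV⟩ := ih
    have hK : 0 < (n * m) ^ k := by positivity
    have hK' : (((n * m) ^ k : ℕ) : ℝ) ≠ 0 := by exact_mod_cast hK.ne'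
    refine ⟨fun u v => S (costMat (adjList G) (adjList H) (mat n m f) ((n * m) ^ k) u v)
      ((n * m) ^ k), ?_, fun u v => ?_⟩
    · rw [table_succ]
      change mat _ _ _ = _
      rw [table_scale, hf, length_adjList, length_adjList]
    · have h1 := hS n m (fun u' v' => if entry (adjList G) u u' = 0 then
          (if entry (adjList H) v v' = 0 then 0 else (n * m) ^ k)
        else if entry (adjList H) v v' = 0 then (n * m) ^ k else entry (mat n m f) u' v') _ hK
      dsimp only
      rw [costMat, length_adjList, length_adjList, h1]
      have h2 : (fun (u' : Fin n) (v' : Fin m) =>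
          ((if entry (adjList G) u u' = 0 then
            (if entry (adjList H) v v' = 0 then 0 else (n * m) ^ k)
          else if entry (adjList H) v v' = 0 then (n * m) ^ k
          else entry (mat n m f) u' v' : ℕ) : ℝ) / ((n * m) ^ k : ℕ)) =
          costR G H (iterV V G H k) u v := by
        funext u' v'
        rw [entry_adjList, entry_adjList, entry_mat _ u'.2 v'.2, costR, ← hfV]
        by_cases hu : G.Adj u u' <;> by_cases hv : H.Adj v v' <;>
          simp only [hu, hv, if_true, if_false, one_ne_zero, Nat.cast_zero, zero_div,
            div_self hK']
      rw [h2]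
      have hnm' : (n : ℝ) * m ≠ 0 := by exact_mod_cast hnm.ne'
      change _ = V n m _
      push_cast [pow_succ] at hK' ⊢
      field_simp
      rw [mul_div_cancel_left₀ _ hnm']

/-- Divisibility makes the quotients `L / (i + 1)` exact, so different rounds can be compared as
integers on a common scale; a factorial serves as `L`. -/
theorem maxTable_spec (hS : Solves S V) (L : ℕ) (hL : 0 < L) (k : ℕ)
    (hd : ∀ i < k, (i + 1) ∣ L) :
    ∃ f : ℕ → ℕ → ℕ, maxTable S (adjList G) (adjList H) L k = mat n m f ∧
      ∀ (u : Fin n) (v : Fin m), (f u v : ℝ) / ((n * m) ^ k * L : ℕ) = maxV V G H k u v := by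
  have hnm : 0 < n * m := Nat.pos_of_ne_zero (mul_ne_zero (NeZero.ne n) (NeZero.ne m))
  induction k with
  | zero =>
    refine ⟨fun _ _ => 0, ?_, fun u v => by simp [maxV]⟩
    change mat (adjList G).length (adjList H).length _ = _
    rw [length_adjList, length_adjList]
  | succ k ih =>
    obtain ⟨f, hf, hfV⟩ := ih fun i hi => hd i (by omega)
    obtain ⟨f', hf', hfV'⟩ := table_spec G H hS (k + 1)
    refine ⟨fun u v => max (entry (mat n m f) u v * (n * m))
      (entry (mat n m f') u v * (L / (k + 1))), ?_, fun u v => ?_⟩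
    · change mat _ _ (fun u v => max (entry (maxTable S _ _ L k) u v * _) _) = _
      rw [hf, hf', length_adjList, length_adjList]
    · obtain ⟨q, hq⟩ := hd k (by omega)
      have hq0 : 0 < q := Nat.pos_of_ne_zero (by rintro rfl; omega)
      have hn : (n : ℝ) ≠ 0 := by exact_mod_cast NeZero.ne n
      have hm : (m : ℝ) ≠ 0 := by exact_mod_cast NeZero.ne m
      have hq' : (q : ℝ) ≠ 0 := by exact_mod_cast hq0.ne'
      have hk' : (k : ℝ) + 1 ≠ 0 := by positivity
      dsimp only
      rw [entry_mat _ u.2 v.2, entry_mat _ u.2 v.2, maxV]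
      dsimp only
      rw [← hfV, ← hfV', hq,
        Nat.mul_div_cancel_left _ (by omega)]
      push_cast
      rw [← max_div_div_right (by positivity)]
      congr 1
      · field_simp
        ring
      · field_simp

end TableSpec

/-! ### Computing the iterated distances from graphs -/

theorem polyTime_of_PTOn {ι : Type} [Enc ι] {size : ι → ℕ} {f : ι → ℕ × ℕ} (hf : PTOn size f)
    {F : ι → ℝ} (hF : ∀ i, 0 < (f i).2 ∧ F i = ((f i).1 : ℝ) / (f i).2) :
    PolyTime enc size F := by
  obtain ⟨P, p, h⟩ := hf
  refine ⟨P, p, fun i => ?_⟩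
  obtain ⟨t, ht, htp⟩ := h i
  exact ⟨_, _, t, ht, htp, hF i⟩

instance : Enc GraphPair := ⟨GraphPair.enc⟩
instance : Enc VertexPair := ⟨VertexPair.enc⟩

theorem enc_ofFn {α : Type} [Enc α] {n : ℕ} (f : Fin n → α) :
    enc (List.ofFn f) = encList (List.ofFn fun i => enc (f i)) := by
  change encList ((List.ofFn f).map enc) = _
  rw [List.map_ofFn]
  rfl

theorem encGraph_eq {n : ℕ} (G : SimpleGraph (Fin n)) : encGraph G = enc (n, adjList G) := by
  rw [enc_prod, adjList, enc_ofFn]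
  simp only [enc_ofFn]
  rfl

theorem sz_adjList {n : ℕ} (G : SimpleGraph (Fin n)) : sz (adjList G) ≤ n * (n * 3 + 2) + 1 := by
  have h := sz_le_of_forall (adjList G) (n * 3 + 1) fun a ha => by
    obtain ⟨i, rfl⟩ := (List.mem_ofFn' _ _).1 ha
    have h := sz_le_of_forall (List.ofFn fun j : Fin n => open Classical in
        if G.Adj i j then 1 else 0) 2 fun b hb => by
      obtain ⟨j, rfl⟩ := (List.mem_ofFn' _ _).1 hb
      dsimp only
      split_ifs <;> simp [sz_nat]
    rwa [List.length_ofFn] at h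
  rwa [length_adjList] at h

theorem polyBdd_graphPair : PolyBdd GraphPair.size sz := by
  have h : PolyBdd GraphPair.size fun I => I.n := PolyBdd.self.mono fun I => Nat.le_add_right _ _
  have h' : PolyBdd GraphPair.size fun I => I.m := PolyBdd.self.mono fun I => Nat.le_add_left _ _
  refine (((h.add (.const 1)).add ((h.mul ((h.mul (.const 3)).add (.const 2))).add
    (.const 2))).add (((h'.add (.const 1)).add ((h'.mul ((h'.mul (.const 3)).add (.const 2))).add
    (.const 2))).add (.const 1))).mono fun I => ?_
  change (Data.pair (encGraph I.G) (encGraph I.H)).size ≤ _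
  rw [encGraph_eq, encGraph_eq, Data.size]
  have h1 := sz_adjList I.G
  have h2 := sz_adjList I.H
  have h3 := sz_nat_le I.n
  have h4 := sz_nat_le I.m
  change sz (I.n, adjList I.G) + sz (I.m, adjList I.H) + 1 ≤ _
  rw [sz_prod, sz_prod]
  dsimp only
  omega

theorem polyBdd_vertexPair : PolyBdd (fun I : VertexPair => I.size) sz := by
  have h : PolyBdd (fun I : VertexPair => I.size) fun I => I.n :=
    PolyBdd.self.mono fun I => Nat.le_add_right _ _
  have h' : PolyBdd (fun I : VertexPair => I.size) fun I => I.m :=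
    PolyBdd.self.mono fun I => Nat.le_add_left _ _
  refine ((polyBdd_graphPair.comp VertexPair.toGraphPair).add
    ((h.add (.const 1)).add (h'.add (.const 3)))).mono fun I => ?_
  have h1 := sz_nat_le (I.u : ℕ)
  have h2 := sz_nat_le (I.v : ℕ)
  have h3 := I.u.2
  have h4 := I.v.2
  change sz (I.toGraphPair, ((I.u : ℕ), (I.v : ℕ))) ≤ _
  rw [sz_prod, sz_prod]
  dsimp only
  omega

/-! ### Access to the parts of the input. -/

namespace PT
variable {α : Type} [Enc α]

@[fun_prop]
theorem toGraphPair {f : α → VertexPair} (hf : PT f) : PT fun x => (f x).toGraphPair :=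
  fst (comp (ofEnc (f := fun I : VertexPair => (I.toGraphPair, ((I.u : ℕ), (I.v : ℕ))))
    fun _ => rfl) hf)

@[fun_prop]
theorem vertexU {f : α → VertexPair} (hf : PT f) : PT fun x => ((f x).u : ℕ) :=
  fst (snd (comp (ofEnc (f := fun I : VertexPair => (I.toGraphPair, ((I.u : ℕ), (I.v : ℕ))))
    fun _ => rfl) hf))

@[fun_prop]
theorem vertexV {f : α → VertexPair} (hf : PT f) : PT fun x => ((f x).v : ℕ) :=
  snd (snd (comp (ofEnc (f := fun I : VertexPair => (I.toGraphPair, ((I.u : ℕ), (I.v : ℕ))))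
    fun _ => rfl) hf))

theorem graphs : PT fun I : GraphPair => ((I.n, adjList I.G), (I.m, adjList I.H)) :=
  ofEnc fun I => by
    change Data.pair (enc (I.n, adjList I.G)) (enc (I.m, adjList I.H)) =
      Data.pair (encGraph I.G) (encGraph I.H)
    rw [encGraph_eq, encGraph_eq]

@[fun_prop]
theorem adjListG {f : α → GraphPair} (hf : PT f) : PT fun x => adjList (f x).G :=
  snd (fst (comp graphs hf))

@[fun_prop]
theorem adjListH {f : α → GraphPair} (hf : PT f) : PT fun x => adjList (f x).H :=
  snd (snd (comp graphs hf))

end PT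

/-! ### The distances computed in polynomial time. -/

section Results

variable {S : List (List ℕ) → ℕ → ℕ} {V : (n m : ℕ) → (Fin n → Fin m → ℝ) → ℝ}

/-- A number computed from a table and its scale. -/
def vertexAnswer (t : List (List ℕ) × ℕ) (u v : ℕ) : ℕ × ℕ := (entry t.1 u v, t.2)

/-- The distance of the distributions, computed from a table and its scale. -/
def graphAnswer (S : List (List ℕ) → ℕ → ℕ) (n m : ℕ) (t : List (List ℕ) × ℕ) : ℕ × ℕ :=
  (S t.1 t.2, n * m * t.2)

theorem graphAnswer_spec (hS : Solves S V) {n m : ℕ} [NeZero n] [NeZero m] {t : List (List ℕ) × ℕ}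
    {f : ℕ → ℕ → ℕ} {d : Fin n → Fin m → ℝ} (hK : 0 < t.2) (hf : t.1 = mat n m f)
    (hd : ∀ (u : Fin n) (v : Fin m), (f u v : ℝ) / (t.2 : ℝ) = d u v) :
    0 < (graphAnswer S n m t).2 ∧
      V n m d = ((graphAnswer S n m t).1 : ℝ) / (graphAnswer S n m t).2 := by
  have hnm : 0 < n * m := Nat.pos_of_ne_zero (mul_ne_zero (NeZero.ne n) (NeZero.ne m))
  have h1 : 0 < n * m * t.2 := by positivity
  have h2 : (n : ℝ) * m * t.2 ≠ 0 := by exact_mod_cast h1.ne'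
  refine ⟨h1, ?_⟩
  rw [graphAnswer, hf, hS n m f t.2 hK, Nat.cast_mul, Nat.cast_mul, mul_div_cancel_left₀ _ h2]
  congr 1
  funext u v
  exact (hd u v).symm

theorem vertexAnswer_spec {n m : ℕ} {t : List (List ℕ) × ℕ}
    {f : ℕ → ℕ → ℕ} {d : Fin n → Fin m → ℝ} (hK : 0 < t.2) (hf : t.1 = mat n m f)
    (hd : ∀ (u : Fin n) (v : Fin m), (f u v : ℝ) / (t.2 : ℝ) = d u v) (u : Fin n) (v : Fin m) :
    0 < (vertexAnswer t u v).2 ∧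
      d u v = ((vertexAnswer t u v).1 : ℝ) / (vertexAnswer t u v).2 := by
  refine ⟨hK, ?_⟩
  rw [vertexAnswer, hf, entry_mat _ u.2 v.2, hd]

/-- The table of maxima together with its scale. -/
def maxTableS (S : List (List ℕ) → ℕ → ℕ) (g h : List (List ℕ)) (k : ℕ) : List (List ℕ) × ℕ :=
  (maxTable S g h k.factorial k, (table S g h k).2 * k.factorial)

theorem table_pos (S : List (List ℕ) → ℕ → ℕ) {n m : ℕ} [NeZero n] [NeZero m]
    (G : SimpleGraph (Fin n)) (H : SimpleGraph (Fin m)) (k : ℕ) :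
    0 < (table S (adjList G) (adjList H) k).2 := by
  have hnm : 0 < n * m := Nat.pos_of_ne_zero (mul_ne_zero (NeZero.ne n) (NeZero.ne m))
  rw [table_scale, length_adjList, length_adjList]
  positivity

theorem table_spec' (hS : Solves S V) {n m : ℕ} [NeZero n] [NeZero m]
    (G : SimpleGraph (Fin n)) (H : SimpleGraph (Fin m)) (k : ℕ) :
    ∃ f : ℕ → ℕ → ℕ, (table S (adjList G) (adjList H) k).1 = mat n m f ∧
      ∀ (u : Fin n) (v : Fin m), (f u v : ℝ) / ((table S (adjList G) (adjList H) k).2 : ℝ) =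
        iterV V G H k u v := by
  obtain ⟨f, hf, h⟩ := table_spec G H hS k
  refine ⟨f, hf, fun u v => ?_⟩
  rw [table_scale, length_adjList, length_adjList, h]

theorem maxTableS_spec (hS : Solves S V) {n m : ℕ} [NeZero n] [NeZero m]
    (G : SimpleGraph (Fin n)) (H : SimpleGraph (Fin m)) (k : ℕ) :
    ∃ f : ℕ → ℕ → ℕ, (maxTableS S (adjList G) (adjList H) k).1 = mat n m f ∧
      ∀ (u : Fin n) (v : Fin m), (f u v : ℝ) / ((maxTableS S (adjList G) (adjList H) k).2 : ℝ) =
        maxV V G H k u v := by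
  obtain ⟨f, hf, h⟩ := maxTable_spec G H hS k.factorial k.factorial_pos k
    fun i hi => Nat.dvd_factorial (by omega) hi
  refine ⟨f, hf, fun u v => ?_⟩
  rw [maxTableS, table_scale, length_adjList, length_adjList, h]

theorem maxTableS_pos (S : List (List ℕ) → ℕ → ℕ) {n m : ℕ} [NeZero n] [NeZero m]
    (G : SimpleGraph (Fin n)) (H : SimpleGraph (Fin m)) (k : ℕ) :
    0 < (maxTableS S (adjList G) (adjList H) k).2 :=
  Nat.mul_pos (table_pos S G H k) k.factorial_pos

namespace PT
variable {α : Type} [Enc α]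

theorem maxTableS (hS : PT fun x : List (List ℕ) × ℕ => S x.1 x.2) (hSV : Solves S V)
    (hV : UnitBounded V) {g h : α → List (List ℕ)} {k : α → ℕ} (hg : PT g) (hh : PT h) (hk : PT k)
    (hkb : SB k) : PT fun x => maxTableS S (g x) (h x) (k x) :=
  prodMk (maxTable hS hSV hV hg hh hk hkb)
    (mul (snd (table hS hSV hV hg hh hk hkb)) (factorial hk hkb))

theorem vertexAnswer {t : α → List (List ℕ) × ℕ} {u v : α → ℕ} (ht : PT t) (hu : PT u)
    (hv : PT v) : PT fun x => vertexAnswer (t x) (u x) (v x) := by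
  unfold IDMetric.vertexAnswer
  fun_prop

theorem graphAnswer (hS : PT fun x : List (List ℕ) × ℕ => S x.1 x.2)
    {t : α → List (List ℕ) × ℕ} {n m : α → ℕ} (ht : PT t) (hn : PT n) (hm : PT m) :
    PT fun x => graphAnswer S (n x) (m x) (t x) := by
  have := comp hS ht
  unfold IDMetric.graphAnswer
  fun_prop

theorem numG {f : α → GraphPair} (hf : PT f) : PT fun x => (f x).n :=
  fst (fst (comp graphs hf))

theorem numH {f : α → GraphPair} (hf : PT f) : PT fun x => (f x).m :=
  fst (snd (comp graphs hf))

theorem sb_numG {f : α → GraphPair} (hf : PT f) : SB fun x => (f x).n :=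
  (sb_lengthList (adjListG hf)).mono fun x => by rw [length_adjList]

theorem sb_numH {f : α → GraphPair} (hf : PT f) : SB fun x => (f x).m :=
  (sb_lengthList (adjListH hf)).mono fun x => by rw [length_adjList]

end PT

/-- The number of rounds is given in binary, but time polynomial in its value is allowed. It is
first replaced by a list of that length, after which polynomial time in the input size suffices. -/
theorem polyTime_vertex (hP : PT fun x : List (List ℕ) × ℕ => S x.1 x.2) (hS : Solves S V)
    (hV : UnitBounded V) :
    PolyTime (withRounds VertexPair.enc) (fun i => i.1.size + i.2)
      (fun i => iterV V i.1.G i.1.H i.2 i.1.u i.1.v) := by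
  have hs : PolyBdd (fun i : VertexPair × ℕ => i.1.size + i.2) fun i => sz i.1 :=
    PolyBdd.trans (PolyBdd.self.mono fun i => Nat.le_add_right _ _)
      (polyBdd_vertexPair.comp Prod.fst)
  have hu := PT.unary hs (PolyBdd.self.mono fun i => Nat.le_add_left _ _)
  have hsz : PolyBdd (fun i : VertexPair × ℕ => i.1.size + i.2) sz :=
    (hs.add ((PolyBdd.self.mono fun i => Nat.le_add_left _ _).add (.const 2))).mono fun i => by
      have := sz_nat_le i.2
      rw [sz_prod]
      omega
  have hT : PT fun x : VertexPair × List ℕ =>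
      vertexAnswer (table S (adjList x.1.G) (adjList x.1.H) x.2.length) x.1.u x.1.v :=
    PT.vertexAnswer (PT.table hP hS hV (by fun_prop) (by fun_prop) (by fun_prop)
      (PT.sb_lengthNat (by fun_prop))) (by fun_prop) (by fun_prop)
  refine polyTime_of_PTOn (PT.compOn hT hu hsz) fun i => ?_
  dsimp only
  rw [List.length_replicate]
  obtain ⟨f, hf, hd⟩ := table_spec' hS i.1.G i.1.H i.2
  exact vertexAnswer_spec (table_pos S _ _ _) hf hd _ _

theorem polyTime_graph (hP : PT fun x : List (List ℕ) × ℕ => S x.1 x.2) (hS : Solves S V)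
    (hV : UnitBounded V) :
    PolyTime (withRounds GraphPair.enc) (fun i => i.1.size + i.2)
      (fun i => V _ _ (iterV V i.1.G i.1.H i.2)) := by
  have hs : PolyBdd (fun i : GraphPair × ℕ => i.1.size + i.2) fun i => sz i.1 :=
    PolyBdd.trans (PolyBdd.self.mono fun i => Nat.le_add_right _ _)
      (polyBdd_graphPair.comp Prod.fst)
  have hu := PT.unary hs (PolyBdd.self.mono fun i => Nat.le_add_left _ _)
  have hsz : PolyBdd (fun i : GraphPair × ℕ => i.1.size + i.2) sz :=
    (hs.add ((PolyBdd.self.mono fun i => Nat.le_add_left _ _).add (.const 2))).mono fun i => by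
      have := sz_nat_le i.2
      rw [sz_prod]
      omega
  have hT : PT fun x : GraphPair × List ℕ =>
      graphAnswer S x.1.n x.1.m (table S (adjList x.1.G) (adjList x.1.H) x.2.length) :=
    PT.graphAnswer hP (PT.table hP hS hV (by fun_prop) (by fun_prop) (by fun_prop)
      (PT.sb_lengthNat (by fun_prop))) (PT.numG (by fun_prop)) (PT.numH (by fun_prop))
  refine polyTime_of_PTOn (PT.compOn hT hu hsz) fun i => ?_
  dsimp only
  rw [List.length_replicate]
  obtain ⟨f, hf, hd⟩ := table_spec' hS i.1.G i.1.H i.2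
  exact graphAnswer_spec hS (table_pos S _ _ _) hf hd

/-- By `supV_PV_eq`, a number of rounds that is polynomial in the numbers of vertices gives the
supremum exactly. -/
theorem polyTime_vertex_sup_PV : PolyTime VertexPair.enc (fun i => i.size)
    (fun i => supV (fun _ _ => PV) i.G i.H i.u i.v) := by
  have hT : PT fun x : VertexPair => vertexAnswer
      (maxTableS solveP (adjList x.G) (adjList x.H) ((x.n * x.m) ^ 2 + 1)) x.u x.v := by
    have hn : PT fun x : VertexPair => x.n := PT.numG (by fun_prop)
    have hm : PT fun x : VertexPair => x.m := PT.numH (by fun_prop)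
    simp only [pow_two]
    exact PT.vertexAnswer (PT.maxTableS PT.solveP solves_P unitBounded_PV (by fun_prop)
      (by fun_prop) (by fun_prop) ((((PT.sb_numG (by fun_prop)).mul (PT.sb_numH (by fun_prop))).mul
        ((PT.sb_numG (by fun_prop)).mul (PT.sb_numH (by fun_prop)))).add (.const 1)))
      (by fun_prop) (by fun_prop)
  refine polyTime_of_PTOn (PT.on hT polyBdd_vertexPair) fun i => ?_
  obtain ⟨f, hf, hd⟩ := maxTableS_spec solves_P i.G i.H ((i.n * i.m) ^ 2 + 1)
  rw [← supV_PV_eq] at hd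
  exact vertexAnswer_spec (maxTableS_pos _ _ _ _) hf hd _ _

theorem polyTime_graph_sup_PV : PolyTime GraphPair.enc (fun i => i.size)
    (fun i => PV (supV (fun _ _ => PV) i.G i.H)) := by
  have hT : PT fun x : GraphPair => graphAnswer solveP x.n x.m
      (maxTableS solveP (adjList x.G) (adjList x.H) ((x.n * x.m) ^ 2 + 1)) := by
    have hn : PT fun x : GraphPair => x.n := PT.numG (by fun_prop)
    have hm : PT fun x : GraphPair => x.m := PT.numH (by fun_prop)
    simp only [pow_two]
    exact PT.graphAnswer PT.solveP (PT.maxTableS PT.solveP solves_P unitBounded_PV (by fun_prop)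
      (by fun_prop) (by fun_prop) ((((PT.sb_numG (by fun_prop)).mul (PT.sb_numH (by fun_prop))).mul
        ((PT.sb_numG (by fun_prop)).mul (PT.sb_numH (by fun_prop)))).add (.const 1)))
      (by fun_prop) (by fun_prop)
  refine polyTime_of_PTOn (PT.on hT polyBdd_graphPair) fun i => ?_
  obtain ⟨f, hf, hd⟩ := maxTableS_spec solves_P i.G i.H ((i.n * i.m) ^ 2 + 1)
  rw [← supV_PV_eq] at hd
  exact graphAnswer_spec solves_P (maxTableS_pos _ _ _ _) hf hd

theorem polyTimeApprox_of_PTOn {ι : Type} [Enc ι] {size : ι → ℕ} {f : ι × ℕ → ℕ × ℕ}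
    (hf : PTOn (fun i => size i.1 + i.2) f)
    {F : ι → ℝ} (hF : ∀ i k, 0 < (f (i, k)).2 ∧
      |F i - ((f (i, k)).1 : ℝ) / (f (i, k)).2| ≤ (1 / 2 : ℝ) ^ k) :
    PolyTimeApprox enc size F := by
  obtain ⟨P, p, h⟩ := hf
  refine ⟨P, p, fun i k => ?_⟩
  obtain ⟨t, ht, htp⟩ := h (i, k)
  exact ⟨_, _, t, ht, htp, hF i k⟩

/-- The maximum over `n * (k + 1)` rounds is computed exactly. It lies below the supremum, and by
`supV_OT_le` it misses at most `2⁻ᵏ`. -/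
theorem polyTimeApprox_vertex_sup_OT : PolyTimeApprox VertexPair.enc (fun i => i.size)
    (fun i => supV (fun _ _ => OT) i.G i.H i.u i.v) := by
  have hs : PolyBdd (fun i : VertexPair × ℕ => i.1.size + i.2) fun i => sz i.1 :=
    PolyBdd.trans (PolyBdd.self.mono fun i => Nat.le_add_right _ _)
      (polyBdd_vertexPair.comp Prod.fst)
  have hu := PT.unary hs (PolyBdd.self.mono fun i => Nat.le_add_left _ _)
  have hsz : PolyBdd (fun i : VertexPair × ℕ => i.1.size + i.2) sz :=
    (hs.add ((PolyBdd.self.mono fun i => Nat.le_add_left _ _).add (.const 2))).mono fun i => by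
      have := sz_nat_le i.2
      rw [sz_prod]
      omega
  have hT : PT fun x : VertexPair × List ℕ => vertexAnswer
      (maxTableS solveW (adjList x.1.G) (adjList x.1.H) (x.1.n * (x.2.length + 1)))
      x.1.u x.1.v := by
    have hn : PT fun x : VertexPair × List ℕ => x.1.n := PT.numG (by fun_prop)
    exact PT.vertexAnswer (PT.maxTableS PT.solveW solves_W unitBounded_OT (by fun_prop)
      (by fun_prop) (by fun_prop) ((PT.sb_numG (by fun_prop)).mul
        ((PT.sb_lengthNat (by fun_prop)).add (.const 1)))) (by fun_prop) (by fun_prop)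
  refine polyTimeApprox_of_PTOn (PT.compOn hT hu hsz) fun i k => ?_
  dsimp only
  rw [List.length_replicate]
  obtain ⟨f, hf, hd⟩ := maxTableS_spec solves_W i.G i.H (i.n * (k + 1))
  obtain ⟨h1, h2⟩ := vertexAnswer_spec (maxTableS_pos _ _ _ _) hf hd i.u i.v
  refine ⟨h1, ?_⟩
  rw [← h2, abs_of_nonneg (sub_nonneg.2 (maxV_le_supV _ _ unitBounded_OT _ _ _))]
  have := supV_OT_le i.G i.H k i.u i.v
  linarith

theorem polyTimeApprox_graph_sup_OT : PolyTimeApprox GraphPair.enc (fun i => i.size)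
    (fun i => OT (supV (fun _ _ => OT) i.G i.H)) := by
  have hs : PolyBdd (fun i : GraphPair × ℕ => i.1.size + i.2) fun i => sz i.1 :=
    PolyBdd.trans (PolyBdd.self.mono fun i => Nat.le_add_right _ _)
      (polyBdd_graphPair.comp Prod.fst)
  have hu := PT.unary hs (PolyBdd.self.mono fun i => Nat.le_add_left _ _)
  have hsz : PolyBdd (fun i : GraphPair × ℕ => i.1.size + i.2) sz :=
    (hs.add ((PolyBdd.self.mono fun i => Nat.le_add_left _ _).add (.const 2))).mono fun i => by
      have := sz_nat_le i.2
      rw [sz_prod]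
      omega
  have hT : PT fun x : GraphPair × List ℕ => graphAnswer solveW x.1.n x.1.m
      (maxTableS solveW (adjList x.1.G) (adjList x.1.H) (x.1.n * (x.2.length + 1))) := by
    have hn : PT fun x : GraphPair × List ℕ => x.1.n := PT.numG (by fun_prop)
    have hm : PT fun x : GraphPair × List ℕ => x.1.m := PT.numH (by fun_prop)
    exact PT.graphAnswer PT.solveW (PT.maxTableS PT.solveW solves_W unitBounded_OT (by fun_prop)
      (by fun_prop) (by fun_prop) ((PT.sb_numG (by fun_prop)).mul
        ((PT.sb_lengthNat (by fun_prop)).add (.const 1)))) (by fun_prop) (by fun_prop)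
  refine polyTimeApprox_of_PTOn (PT.compOn hT hu hsz) fun i k => ?_
  dsimp only
  rw [List.length_replicate]
  obtain ⟨f, hf, hd⟩ := maxTableS_spec solves_W i.G i.H (i.n * (k + 1))
  obtain ⟨h1, h2⟩ := graphAnswer_spec solves_W (maxTableS_pos _ _ _ _) hf hd
  refine ⟨h1, ?_⟩
  have h3 : OT (maxV (fun _ _ => OT) i.G i.H (i.n * (k + 1))) ≤
      OT (supV (fun _ _ => OT) i.G i.H) :=
    OT_mono fun u v => maxV_le_supV _ _ unitBounded_OT _ _ _
  rw [← h2, abs_of_nonneg (sub_nonneg.2 h3)]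
  -- A uniform error in the costs is not enlarged by `OT`.
  have := OT_le_add (supV_OT_le i.G i.H k)
  linarith

end Results

/-! ### The unbalanced Wasserstein distance is a metric -/

section Wasserstein

open ProbabilityTheory

variable {X : Type} [MeasurableSpace X]

/-- Plans that transport a part of `μ` onto a part of `ν`. -/
def PartialPlan (γ : Measure (X × X)) (μ ν : Measure X) : Prop :=
  γ.map Prod.fst ≤ μ ∧ γ.map Prod.snd ≤ ν

theorem map_fst_univ (γ : Measure (X × X)) : γ.map Prod.fst Set.univ = γ Set.univ := by
  rw [Measure.map_apply measurable_fst MeasurableSet.univ, Set.preimage_univ]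

theorem map_snd_univ (γ : Measure (X × X)) : γ.map Prod.snd Set.univ = γ Set.univ := by
  rw [Measure.map_apply measurable_snd MeasurableSet.univ, Set.preimage_univ]

namespace PartialPlan

variable {γ : Measure (X × X)} {μ ν : Measure X}

theorem univ_le_left (h : PartialPlan γ μ ν) : γ Set.univ ≤ μ Set.univ :=
  (map_fst_univ γ).symm.trans_le (h.1 _)

theorem univ_le_right (h : PartialPlan γ μ ν) : γ Set.univ ≤ ν Set.univ :=
  (map_snd_univ γ).symm.trans_le (h.2 _)

theorem swap (h : PartialPlan γ μ ν) : PartialPlan (γ.map Prod.swap) ν μ := by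
  constructor
  · rw [Measure.map_map measurable_fst measurable_swap]
    exact h.2
  · rw [Measure.map_map measurable_snd measurable_swap]
    exact h.1

end PartialPlan

theorem map_swap_univ (γ : Measure (X × X)) : γ.map Prod.swap Set.univ = γ Set.univ := by
  rw [Measure.map_apply measurable_swap MeasurableSet.univ, Set.preimage_univ]

theorem cost_swap {d : X → X → ℝ} (hd : Measurable fun z : X × X => d z.1 z.2)
    (hs : ∀ x y, d x y = d y x) (γ : Measure (X × X)) : cost d (γ.map Prod.swap) = cost d γ := by
  rw [cost, lintegral_map hd.ennreal_ofReal measurable_swap]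
  exact lintegral_congr fun z => by simp [hs z.1 z.2]

theorem cost_le_univ {d : X → X → ℝ} (h1 : ∀ x y, d x y ≤ 1) (γ : Measure (X × X)) :
    cost d γ ≤ γ Set.univ :=
  calc cost d γ ≤ ∫⁻ _, 1 ∂γ := lintegral_mono fun z => by
        simpa using ENNReal.ofReal_le_ofReal (h1 z.1 z.2)
    _ = γ Set.univ := by simp

/-- A partial plan can be completed. -/
theorem exists_plan {d : X → X → ℝ} (h1 : ∀ x y, d x y ≤ 1) {μ ν : Measure X}
    [IsFiniteMeasure μ] [IsFiniteMeasure ν] (hμ : μ Set.univ ≤ 1)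
    (hle : ν Set.univ ≤ μ Set.univ) {γ : Measure (X × X)} (h : PartialPlan γ μ ν) :
    ∃ γ' ∈ plans μ ν, cost d γ' ≤ cost d γ + (ν Set.univ - γ Set.univ) := by
  have hγ : IsFiniteMeasure γ := ⟨h.univ_le_left.trans_lt (measure_lt_top _ _)⟩
  have e1 := Measure.sub_add_cancel_of_le h.1
  have e2 := Measure.sub_add_cancel_of_le h.2
  set μ' := μ - γ.map Prod.fst with hμ'
  set ν' := ν - γ.map Prod.snd with hν'
  have u1 : μ' Set.univ + γ Set.univ = μ Set.univ := by
    rw [← map_fst_univ γ, ← Measure.add_apply, e1]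
  have u2 : ν' Set.univ + γ Set.univ = ν Set.univ := by
    rw [← map_snd_univ γ, ← Measure.add_apply, e2]
  have u3 : ν' Set.univ ≤ μ' Set.univ := by
    rw [← u1, ← u2] at hle
    exact (ENNReal.add_le_add_iff_right (measure_ne_top _ _)).1 hle
  have u4 : ν' Set.univ = ν Set.univ - γ Set.univ :=
    ENNReal.eq_sub_of_add_eq (measure_ne_top _ _) u2
  -- The remainders are joined by a rescaled product. If `μ'` vanishes then so does `ν'`, and the
  -- infinite factor is harmless.
  set γ₁ := (μ' Set.univ)⁻¹ • μ'.prod ν' with hγ₁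
  have f1 : γ₁.map Prod.fst ≤ μ' := by
    rw [hγ₁, Measure.map_smul, Measure.map_fst_prod, smul_smul]
    refine Measure.le_iff.2 fun s _ => ?_
    rw [Measure.smul_apply, smul_eq_mul]
    refine mul_le_of_le_one_left zero_le ?_
    exact (mul_le_mul_right u3 _).trans (ENNReal.inv_mul_le_one _)
  have f2 : γ₁.map Prod.snd = ν' := by
    rw [hγ₁, Measure.map_smul, Measure.map_snd_prod, smul_smul]
    by_cases h0 : μ' Set.univ = 0
    · have : ν' = 0 := Measure.measure_univ_eq_zero.1 (le_antisymm (u3.trans_eq h0) zero_le)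
      rw [this, smul_zero]
    · rw [ENNReal.inv_mul_cancel h0 (measure_ne_top _ _), one_smul]
  have f3 : (γ + γ₁).map Prod.snd = ν := by
    rw [Measure.map_add _ _ measurable_snd, f2, add_comm, e2]
  refine ⟨γ + γ₁, ⟨?_, ?_, f3⟩, ?_⟩
  · rw [← map_snd_univ, f3]
    exact hle.trans hμ
  · rw [Measure.map_add _ _ measurable_fst, ← e1, add_comm]
    gcongr
  · rw [cost, lintegral_add_measure, ← u4]
    refine add_le_add le_rfl ((cost_le_univ h1 γ₁).trans ?_)
    rw [← map_snd_univ, f2]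

/-- The right-hand side is the symmetric form of the distance. What `γ` leaves out of the lighter
measure can be transported at cost at most 1 per unit of mass, so completing the plan does not
exceed it. -/
theorem wasserstein_le {d : X → X → ℝ} (hd : Measurable fun z : X × X => d z.1 z.2)
    (hs : ∀ x y, d x y = d y x) (h1 : ∀ x y, d x y ≤ 1) {μ ν : Measure X}
    [IsFiniteMeasure μ] [IsFiniteMeasure ν] (hμ : μ Set.univ ≤ 1) (hν : ν Set.univ ≤ 1)
    {γ : Measure (X × X)} (h : PartialPlan γ μ ν) :
    wasserstein d μ ν ≤ (cost d γ).toReal + (μ.real Set.univ - γ.real Set.univ) +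
      (ν.real Set.univ - γ.real Set.univ) := by
  have key : ∀ {μ ν : Measure X} [IsFiniteMeasure μ] [IsFiniteMeasure ν] (_ : μ Set.univ ≤ 1)
      (_ : ν Set.univ ≤ μ Set.univ) {γ : Measure (X × X)} (_ : PartialPlan γ μ ν),
      μ.real Set.univ - ν.real Set.univ + (⨅ γ ∈ plans μ ν, cost d γ).toReal ≤
      (cost d γ).toReal + (μ.real Set.univ - γ.real Set.univ) +
      (ν.real Set.univ - γ.real Set.univ) := by
    intro μ ν _ _ hμ hle γ h
    obtain ⟨γ', hγ', hc⟩ := exists_plan h1 hμ hle h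
    have hγ : IsFiniteMeasure γ := ⟨h.univ_le_left.trans_lt (measure_lt_top _ _)⟩
    have hfin : cost d γ ≠ ⊤ := ne_top_of_le_ne_top (measure_ne_top γ _) (cost_le_univ h1 γ)
    have hfin' : ν Set.univ - γ Set.univ ≠ ⊤ := ENNReal.sub_ne_top (measure_ne_top _ _)
    have h2 : (⨅ γ ∈ plans μ ν, cost d γ).toReal ≤
        (cost d γ + (ν Set.univ - γ Set.univ)).toReal :=
      ENNReal.toReal_mono (ENNReal.add_ne_top.2 ⟨hfin, hfin'⟩) ((iInf₂_le γ' hγ').trans hc)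
    rw [ENNReal.toReal_add hfin hfin', ENNReal.toReal_sub_of_le h.univ_le_right
      (measure_ne_top _ _)] at h2
    have h3 : γ.real Set.univ ≤ ν.real Set.univ :=
      ENNReal.toReal_mono (measure_ne_top _ _) h.univ_le_right
    simp only [Measure.real] at *
    linarith
  unfold wasserstein
  split_ifs with hle
  · exact key hμ hle h
  · have h2 := key hν (le_of_not_ge hle) h.swap
    rw [cost_swap hd hs] at h2
    have h3 : (γ.map Prod.swap).real Set.univ = γ.real Set.univ := by
      simp only [Measure.real, map_swap_univ]
    rw [h3] at h2
    linarith

/-- The empty partial plan can be completed. -/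
theorem exists_plan_product {d : X → X → ℝ} (h1 : ∀ x y, d x y ≤ 1) {μ ν : Measure X}
    (hμ : μ Set.univ ≤ 1) (hle : ν Set.univ ≤ μ Set.univ) :
    ∃ γ ∈ plans μ ν, cost d γ < ⊤ := by
  have : IsFiniteMeasure μ := ⟨hμ.trans_lt ENNReal.one_lt_top⟩
  have : IsFiniteMeasure ν := ⟨(hle.trans hμ).trans_lt ENNReal.one_lt_top⟩
  have h0 : PartialPlan (0 : Measure (X × X)) μ ν := by
    constructor
    · rw [Measure.map_zero]
      exact Measure.zero_le _
    · rw [Measure.map_zero]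
      exact Measure.zero_le _
  obtain ⟨γ, hγ, -⟩ := exists_plan h1 hμ hle h0
  exact ⟨γ, hγ, ((cost_le_univ h1 γ).trans hγ.1).trans_lt ENNReal.one_lt_top⟩

/-- Converse to `wasserstein_le`: a nearly optimal plan is a partial plan that uses up the lighter
measure. -/
theorem exists_lt_wasserstein_add {d : X → X → ℝ} (hd : Measurable fun z : X × X => d z.1 z.2)
    (hs : ∀ x y, d x y = d y x) (h1 : ∀ x y, d x y ≤ 1) {μ ν : Measure X}
    (hμ : μ Set.univ ≤ 1) (hν : ν Set.univ ≤ 1) {δ : ℝ} (hδ : 0 < δ) :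
    ∃ γ, PartialPlan γ μ ν ∧ (cost d γ).toReal + (μ.real Set.univ - γ.real Set.univ) +
      (ν.real Set.univ - γ.real Set.univ) < wasserstein d μ ν + δ := by
  have key : ∀ {μ ν : Measure X} (_ : μ Set.univ ≤ 1) (_ : ν Set.univ ≤ μ Set.univ),
      ∃ γ, PartialPlan γ μ ν ∧ (cost d γ).toReal + (μ.real Set.univ - γ.real Set.univ) +
      (ν.real Set.univ - γ.real Set.univ) <
      μ.real Set.univ - ν.real Set.univ + (⨅ γ ∈ plans μ ν, cost d γ).toReal + δ := by
    intro μ ν hμ hle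
    obtain ⟨γ₀, hγ₀, hc₀⟩ := exists_plan_product h1 hμ hle
    have hfin : (⨅ γ ∈ plans μ ν, cost d γ) ≠ ⊤ :=
      ((iInf₂_le γ₀ hγ₀).trans_lt hc₀).ne
    have hlt : (⨅ γ ∈ plans μ ν, cost d γ) < (⨅ γ ∈ plans μ ν, cost d γ) + ENNReal.ofReal δ :=
      ENNReal.lt_add_right hfin (by simpa using hδ)
    obtain ⟨γ, hγ, hc⟩ : ∃ γ ∈ plans μ ν, cost d γ <
        (⨅ γ ∈ plans μ ν, cost d γ) + ENNReal.ofReal δ := by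
      by_contra! hcon
      exact absurd (le_iInf₂ hcon) (not_le.2 hlt)
    refine ⟨γ, ⟨hγ.2.1, hγ.2.2.le⟩, ?_⟩
    have h2 : γ.real Set.univ = ν.real Set.univ := by
      rw [Measure.real, Measure.real, ← map_snd_univ, hγ.2.2]
    have h3 := (ENNReal.toReal_lt_toReal hc.ne_top (by finiteness)).2 hc
    rw [ENNReal.toReal_add hfin ENNReal.ofReal_ne_top, ENNReal.toReal_ofReal hδ.le] at h3
    rw [h2]
    linarith
  unfold wasserstein
  split_ifs with hle
  · exact key hμ hle
  · obtain ⟨γ, hγ, hc⟩ := key hν (le_of_not_ge hle)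
    refine ⟨_, hγ.swap, ?_⟩
    have h3 : (γ.map Prod.swap).real Set.univ = γ.real Set.univ := by
      simp only [Measure.real, map_swap_univ]
    rw [cost_swap hd hs, h3]
    linarith

theorem wasserstein_nonneg (d : X → X → ℝ) (μ ν : Measure X) (hμ : μ Set.univ ≤ 1)
    (hν : ν Set.univ ≤ 1) : 0 ≤ wasserstein d μ ν := by
  have f : ∀ μ : Measure X, μ Set.univ ≤ 1 → μ Set.univ ≠ ⊤ :=
    fun μ h => ne_top_of_le_ne_top ENNReal.one_ne_top h
  unfold wasserstein
  split_ifs with hle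
  · have := ENNReal.toReal_mono (f _ hμ) hle
    exact add_nonneg (sub_nonneg.2 this) ENNReal.toReal_nonneg
  · have := ENNReal.toReal_mono (f _ hν) (le_of_not_ge hle)
    exact add_nonneg (sub_nonneg.2 this) ENNReal.toReal_nonneg

theorem le_of_forall_lt_wasserstein_add {d : X → X → ℝ}
    (hd : Measurable fun z : X × X => d z.1 z.2)
    (hs : ∀ x y, d x y = d y x) (h1 : ∀ x y, d x y ≤ 1) {μ ν : Measure X}
    (hμ : μ Set.univ ≤ 1) (hν : ν Set.univ ≤ 1) {a : ℝ}
    (h : ∀ γ, PartialPlan γ μ ν → a ≤ (cost d γ).toReal + (μ.real Set.univ - γ.real Set.univ) +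
      (ν.real Set.univ - γ.real Set.univ)) : a ≤ wasserstein d μ ν := by
  refine le_of_forall_pos_le_add fun δ hδ => ?_
  obtain ⟨γ, hγ, hc⟩ := exists_lt_wasserstein_add hd hs h1 hμ hν hδ
  exact (h γ hγ).trans hc.le

/-- The form with partial plans is invariant under swapping the coordinates, whereas the definition
is not visibly symmetric when the masses are equal. -/
theorem wasserstein_comm {d : X → X → ℝ} (hd : Measurable fun z : X × X => d z.1 z.2)
    (hs : ∀ x y, d x y = d y x) (h1 : ∀ x y, d x y ≤ 1) {μ ν : Measure X}
    (hμ : μ Set.univ ≤ 1) (hν : ν Set.univ ≤ 1) : wasserstein d μ ν = wasserstein d ν μ := by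
  have key : ∀ {μ ν : Measure X}, μ Set.univ ≤ 1 → ν Set.univ ≤ 1 →
      wasserstein d μ ν ≤ wasserstein d ν μ := by
    intro μ ν hμ hν
    have : IsFiniteMeasure μ := ⟨hμ.trans_lt ENNReal.one_lt_top⟩
    have : IsFiniteMeasure ν := ⟨hν.trans_lt ENNReal.one_lt_top⟩
    refine le_of_forall_lt_wasserstein_add hd hs h1 hν hμ fun γ hγ => ?_
    have h2 := wasserstein_le hd hs h1 hμ hν hγ.swap
    have h3 : (γ.map Prod.swap).real Set.univ = γ.real Set.univ := by
      simp only [Measure.real, map_swap_univ]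
    rw [cost_swap hd hs, h3] at h2
    linarith
  exact le_antisymm (key hμ hν) (key hν hμ)

/-- The diagonal plan transports everything at cost 0. -/
theorem wasserstein_self {d : X → X → ℝ} (hd : Measurable fun z : X × X => d z.1 z.2)
    (hs : ∀ x y, d x y = d y x) (h1 : ∀ x y, d x y ≤ 1) (h0 : ∀ x, d x x = 0) {μ : Measure X}
    (hμ : μ Set.univ ≤ 1) : wasserstein d μ μ = 0 := by
  have : IsFiniteMeasure μ := ⟨hμ.trans_lt ENNReal.one_lt_top⟩
  refine le_antisymm ?_ (wasserstein_nonneg d μ μ hμ hμ)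
  have hm : Measurable fun x : X => (x, x) := by fun_prop
  have hp : PartialPlan (μ.map fun x => (x, x)) μ μ := by
    constructor
    · rw [Measure.map_map measurable_fst hm]
      exact Measure.map_id.le
    · rw [Measure.map_map measurable_snd hm]
      exact Measure.map_id.le
  refine (wasserstein_le hd hs h1 hμ hμ hp).trans (le_of_eq ?_)
  have h2 : cost d (μ.map fun x => (x, x)) = 0 := by
    rw [cost, lintegral_map hd.ennreal_ofReal hm]
    simp [h0]
  have h3 : (μ.map fun x => (x, x)).real Set.univ = μ.real Set.univ := by
    rw [Measure.real, Measure.map_apply hm MeasurableSet.univ, Set.preimage_univ, Measure.real]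
  rw [h2, h3]
  simp

theorem wasserstein_le_one {d : X → X → ℝ} (h1 : ∀ x y, d x y ≤ 1) {μ ν : Measure X}
    (hμ : μ Set.univ ≤ 1) (hν : ν Set.univ ≤ 1) : wasserstein d μ ν ≤ 1 := by
  have key : ∀ {μ ν : Measure X} (_ : μ Set.univ ≤ 1) (_ : ν Set.univ ≤ μ Set.univ),
      μ.real Set.univ - ν.real Set.univ + (⨅ γ ∈ plans μ ν, cost d γ).toReal ≤ 1 := by
    intro μ ν hμ hle
    obtain ⟨γ, hγ, -⟩ := exists_plan_product h1 hμ hle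
    have hν : ν Set.univ ≠ ⊤ := ne_top_of_le_ne_top ENNReal.one_ne_top (hle.trans hμ)
    have h2 : (⨅ γ ∈ plans μ ν, cost d γ) ≤ ν Set.univ := by
      refine (iInf₂_le γ hγ).trans ((cost_le_univ h1 γ).trans_eq ?_)
      rw [← map_snd_univ, hγ.2.2]
    have h3 := ENNReal.toReal_mono hν h2
    have h4 := ENNReal.toReal_mono ENNReal.one_ne_top hμ
    rw [ENNReal.toReal_one] at h4
    simp only [Measure.real]
    linarith
  unfold wasserstein
  split_ifs with hle
  · exact key hμ hle
  · exact key hν (le_of_not_ge hle)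

/-- Gluing of partial plans. -/
theorem PartialPlan.glue [StandardBorelSpace X] [Nonempty X] {d : X → X → ℝ}
    (hd : Measurable fun z : X × X => d z.1 z.2) (ht : ∀ x y z, d x z ≤ d x y + d y z)
    (h0 : ∀ x y, 0 ≤ d x y)
    {μ ν ρ : Measure X} [IsFiniteMeasure μ] [IsFiniteMeasure ν] [IsFiniteMeasure ρ]
    {γ γ' : Measure (X × X)} (h : PartialPlan γ μ ν) (h' : PartialPlan γ' ν ρ) :
    ∃ γ'', PartialPlan γ'' μ ρ ∧ cost d γ'' ≤ cost d γ + cost d γ' ∧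
      γ Set.univ + γ' Set.univ ≤ γ'' Set.univ + ν Set.univ := by
  have hγ : IsFiniteMeasure γ := ⟨h.univ_le_left.trans_lt (measure_lt_top _ _)⟩
  have hγ' : IsFiniteMeasure γ' := ⟨h'.univ_le_left.trans_lt (measure_lt_top _ _)⟩
  -- After the swap both plans start in the middle space and can be disintegrated over it.
  set γs := γ.map Prod.swap with hγs
  set ν₁ := γs.fst with hν₁
  set ν₂ := γ'.fst with hν₂
  have hν₁le : ν₁ ≤ ν := h.swap.1
  have hν₂le : ν₂ ≤ ν := h'.1
  have d1 : ν₁ ⊗ₘ γs.condKernel = γs := γs.disintegrate _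
  have d2 : ν₂ ⊗ₘ γ'.condKernel = γ' := γ'.disintegrate _
  set κ := γs.condKernel
  set κ' := γ'.condKernel
  have w1 : ν.withDensity (ν₁.rnDeriv ν) = ν₁ :=
    Measure.withDensity_rnDeriv_eq _ _ (Measure.absolutelyContinuous_of_le hν₁le)
  have w2 : ν.withDensity (ν₂.rnDeriv ν) = ν₂ :=
    Measure.withDensity_rnDeriv_eq _ _ (Measure.absolutelyContinuous_of_le hν₂le)
  have b1 := Measure.rnDeriv_le_one_of_le hν₁le
  have b2 := Measure.rnDeriv_le_one_of_le hν₂le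
  have m1 := Measure.measurable_rnDeriv ν₁ ν
  have m2 := Measure.measurable_rnDeriv ν₂ ν
  set f := ν₁.rnDeriv ν
  set g := ν₂.rnDeriv ν
  -- The middle marginals have densities `f` and `g`, at most 1, with respect to `ν`. The density `f
  -- * g` lies below both, so either plan can be restricted to it, and `f + g ≤ f * g + 1` bounds
  -- the loss of mass.
  set l := ν.withDensity (fun y => f y * g y) with hl
  have l1 : l ≤ ν₁ := by
    rw [← w1]
    refine withDensity_mono ?_
    filter_upwards [b2] with y hy
    exact mul_le_of_le_one_right zero_le hy
  have l2 : l ≤ ν₂ := by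
    rw [← w2]
    refine withDensity_mono ?_
    filter_upwards [b1] with y hy
    exact mul_le_of_le_one_left zero_le hy
  have hlfin : IsFiniteMeasure l := ⟨(l1 Set.univ).trans_lt (measure_lt_top _ _)⟩
  have hmass : γ Set.univ + γ' Set.univ ≤ l Set.univ + ν Set.univ := by
    have e1 : γ Set.univ = ∫⁻ y, f y ∂ν := by
      rw [← map_swap_univ, ← map_fst_univ]
      change ν₁ Set.univ = _
      conv_lhs => rw [← w1]
      rw [withDensity_apply _ MeasurableSet.univ, Measure.restrict_univ]
    have e2 : γ' Set.univ = ∫⁻ y, g y ∂ν := by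
      rw [← map_fst_univ]
      change ν₂ Set.univ = _
      conv_lhs => rw [← w2]
      rw [withDensity_apply _ MeasurableSet.univ, Measure.restrict_univ]
    have e3 : ν Set.univ = ∫⁻ _, 1 ∂ν := by simp
    rw [e1, e2, e3, hl, withDensity_apply _ MeasurableSet.univ, Measure.restrict_univ,
      ← lintegral_add_left m1,
      ← lintegral_add_left (f := fun y => f y * g y) (m1.mul m2)]
    refine lintegral_mono_ae ?_
    filter_upwards [b1, b2] with y hy1 hy2
    simp only [Pi.one_apply] at hy1 hy2
    have t1 : f y ≠ ⊤ := ne_top_of_le_ne_top ENNReal.one_ne_top hy1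
    have t2 : g y ≠ ⊤ := ne_top_of_le_ne_top ENNReal.one_ne_top hy2
    lift f y to NNReal using t1 with a
    lift g y to NNReal using t2 with b
    norm_cast at hy1 hy2 ⊢
    have ha : (a : ℝ) ≤ 1 := hy1
    have hb : (b : ℝ) ≤ 1 := hy2
    rw [← NNReal.coe_le_coe]
    push_cast
    -- This is `0 ≤ (1 - a) * (1 - b)`.
    nlinarith
  have hint : ∀ φ : X × X → ENNReal, Measurable φ →
      ∫⁻ z, φ z ∂((l ⊗ₘ (κ ×ₖ κ')).map Prod.snd) =
        ∫⁻ y, ∫⁻ x, ∫⁻ z, φ (x, z) ∂κ' y ∂κ y ∂l := by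
    intro φ hφ
    have hm : Measurable fun a : X × X × X => φ a.2 := hφ.comp measurable_snd
    rw [lintegral_map hφ measurable_snd, Measure.lintegral_compProd hm]
    refine lintegral_congr fun y => ?_
    rw [Kernel.lintegral_prod _ _ _ hφ]
  have int1 : ∀ φ : X → X → ENNReal, Measurable (fun z : X × X => φ z.1 z.2) →
      ∫⁻ y, ∫⁻ x, φ y x ∂κ y ∂l ≤ ∫⁻ z, φ z.2 z.1 ∂γ := by
    intro φ hφ
    calc _ ≤ ∫⁻ y, ∫⁻ x, φ y x ∂κ y ∂ν₁ := lintegral_mono' l1 le_rfl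
      _ = ∫⁻ z, φ z.1 z.2 ∂(ν₁ ⊗ₘ κ) := (Measure.lintegral_compProd hφ).symm
      _ = _ := by
        rw [d1, hγs, lintegral_map hφ measurable_swap]
        rfl
  have int2 : ∀ φ : X → X → ENNReal, Measurable (fun z : X × X => φ z.1 z.2) →
      ∫⁻ y, ∫⁻ z, φ y z ∂κ' y ∂l ≤ ∫⁻ z, φ z.1 z.2 ∂γ' := by
    intro φ hφ
    calc _ ≤ ∫⁻ y, ∫⁻ x, φ y x ∂κ' y ∂ν₂ := lintegral_mono' l2 le_rfl
      _ = ∫⁻ z, φ z.1 z.2 ∂(ν₂ ⊗ₘ κ') := (Measure.lintegral_compProd hφ).symm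
      _ = _ := by rw [d2]
  -- Given the middle point, the two ends are chosen independently, and the middle point is then
  -- forgotten.
  refine ⟨(l ⊗ₘ (κ ×ₖ κ')).map Prod.snd, ⟨?_, ?_⟩, ?_, ?_⟩
  · refine Measure.le_iff.2 fun s hs => ?_
    rw [← lintegral_indicator_one hs, lintegral_map (measurable_one.indicator hs) measurable_fst,
      hint (fun z => s.indicator 1 z.1) ((measurable_one.indicator hs).comp measurable_fst)]
    simp only [lintegral_const, measure_univ, mul_one]
    refine (int1 (fun _ x => s.indicator 1 x)
      ((measurable_one.indicator hs).comp measurable_snd)).trans ?_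
    rw [← lintegral_map (f := fun x => s.indicator 1 x) (measurable_one.indicator hs)
      measurable_fst, lintegral_indicator_one hs]
    exact h.1 s
  · refine Measure.le_iff.2 fun s hs => ?_
    rw [← lintegral_indicator_one hs, lintegral_map (measurable_one.indicator hs) measurable_snd,
      hint (fun z => s.indicator 1 z.2) ((measurable_one.indicator hs).comp measurable_snd)]
    simp only [lintegral_const, measure_univ, mul_one]
    refine (int2 (fun _ x => s.indicator 1 x)
      ((measurable_one.indicator hs).comp measurable_snd)).trans ?_
    rw [← lintegral_map (f := fun x => s.indicator 1 x) (measurable_one.indicator hs)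
      measurable_snd, lintegral_indicator_one hs]
    exact h'.2 s
  · rw [cost, hint _ hd.ennreal_ofReal]
    have hd1 : ∀ y, Measurable fun x => ENNReal.ofReal (d x y) := fun y =>
      (hd.comp (measurable_id.prodMk measurable_const)).ennreal_ofReal
    have hd2 : ∀ y, Measurable fun x => ENNReal.ofReal (d y x) := fun y =>
      (hd.comp (measurable_const.prodMk measurable_id)).ennreal_ofReal
    have hdm : Measurable fun z : X × X => ENNReal.ofReal (d z.2 z.1) :=
      (hd.comp measurable_swap).ennreal_ofReal
    calc _ ≤ ∫⁻ y, ∫⁻ x, ∫⁻ z, (ENNReal.ofReal (d x y) + ENNReal.ofReal (d y z)) ∂κ' y ∂κ y ∂l := by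
          gcongr with y x z
          rw [← ENNReal.ofReal_add (h0 _ _) (h0 _ _)]
          exact ENNReal.ofReal_le_ofReal (ht x y z)
      _ = ∫⁻ y, (∫⁻ x, ENNReal.ofReal (d x y) ∂κ y + ∫⁻ z, ENNReal.ofReal (d y z) ∂κ' y) ∂l := by
          refine lintegral_congr fun y => ?_
          simp only [lintegral_add_left measurable_const, lintegral_const, measure_univ, mul_one]
          rw [lintegral_add_left (hd1 y), lintegral_const, measure_univ, mul_one]
      _ = ∫⁻ y, ∫⁻ x, ENNReal.ofReal (d x y) ∂κ y ∂l +
            ∫⁻ y, ∫⁻ z, ENNReal.ofReal (d y z) ∂κ' y ∂l := by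
          rw [lintegral_add_left]
          exact Measurable.lintegral_kernel_prod_right hdm
      _ ≤ _ := add_le_add
          (int1 (fun y x => ENNReal.ofReal (d x y)) hdm)
          (int2 (fun y x => ENNReal.ofReal (d y x)) hd.ennreal_ofReal)
  · rw [Measure.map_apply measurable_snd MeasurableSet.univ, Set.preimage_univ,
      Measure.compProd_apply_univ]
    exact hmass

/-- The mass bound of the glued plan says precisely that its two untransported masses together are
at most the four untransported masses of the given plans. -/
theorem wasserstein_triangle [StandardBorelSpace X] [Nonempty X] {d : X → X → ℝ}
    (hd : Measurable fun z : X × X => d z.1 z.2) (hs : ∀ x y, d x y = d y x)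
    (h1 : ∀ x y, d x y ≤ 1) (ht : ∀ x y z, d x z ≤ d x y + d y z)
    (h0 : ∀ x y, 0 ≤ d x y) {μ ν ρ : Measure X} (hμ : μ Set.univ ≤ 1) (hν : ν Set.univ ≤ 1)
    (hρ : ρ Set.univ ≤ 1) :
    wasserstein d μ ρ ≤ wasserstein d μ ν + wasserstein d ν ρ := by
  have : IsFiniteMeasure μ := ⟨hμ.trans_lt ENNReal.one_lt_top⟩
  have : IsFiniteMeasure ν := ⟨hν.trans_lt ENNReal.one_lt_top⟩
  have : IsFiniteMeasure ρ := ⟨hρ.trans_lt ENNReal.one_lt_top⟩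
  have hfin : ∀ γ : Measure (X × X), γ Set.univ ≤ 1 → cost d γ ≠ ⊤ := fun γ h =>
    ne_top_of_le_ne_top ENNReal.one_ne_top ((cost_le_univ h1 γ).trans h)
  rw [← sub_le_iff_le_add]
  refine le_of_forall_lt_wasserstein_add hd hs h1 hμ hν fun γ hγ => ?_
  rw [sub_le_comm]
  refine le_of_forall_lt_wasserstein_add hd hs h1 hν hρ fun γ' hγ' => ?_
  obtain ⟨γ'', hγ'', hc, hm⟩ := hγ.glue hd ht h0 hγ'
  have h2 := wasserstein_le hd hs h1 hμ hρ hγ''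
  have n1 := hγ.univ_le_left.trans hμ
  have n2 := hγ'.univ_le_left.trans hν
  have n3 := hγ''.univ_le_left.trans hμ
  have h3 := ENNReal.toReal_mono (ENNReal.add_ne_top.2 ⟨hfin γ n1, hfin γ' n2⟩) hc
  rw [ENNReal.toReal_add (hfin γ n1) (hfin γ' n2)] at h3
  have t : ∀ a : ENNReal, a ≤ 1 → a ≠ ⊤ := fun a h => ne_top_of_le_ne_top ENNReal.one_ne_top h
  have h4 := ENNReal.toReal_mono (ENNReal.add_ne_top.2 ⟨t _ n3, t _ hν⟩) hm
  rw [ENNReal.toReal_add (t _ n1) (t _ n2), ENNReal.toReal_add (t _ n3) (t _ hν)] at h4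
  simp only [Measure.real] at *
  linarith

end Wasserstein

/-! ### The Prokhorov distance is a metric -/

section Prokhorov

theorem thicken_dist {X : Type} [MetricSpace X] (ε : ℝ) (A : Set X) : thicken dist ε A = Metric.thickening ε A := by
  ext y
  simp [thicken, Metric.mem_thickening_iff, dist_comm]

variable {X : Type} [MetricSpace X] [MeasurableSpace X]

theorem one_mem_prokhorovRadii {X : Type} [MeasurableSpace X] (d : X → X → ℝ) {μ ν : Measure X}
    (hμ : μ Set.univ ≤ 1) (hν : ν Set.univ ≤ 1) : (1 : ℝ) ∈ prokhorovRadii d μ ν := by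
  refine ⟨one_pos, fun A _ => ?_⟩
  rw [ENNReal.ofReal_one]
  exact ⟨((measure_mono A.subset_univ).trans hμ).trans le_add_self,
    ((measure_mono A.subset_univ).trans hν).trans le_add_self⟩

theorem prokhorovRadii_bddBelow {X : Type} [MeasurableSpace X] (d : X → X → ℝ) (μ ν : Measure X) :
    BddBelow (prokhorovRadii d μ ν) := ⟨0, fun _ h => h.1.le⟩

theorem prokhorov_nonneg {X : Type} [MeasurableSpace X] (d : X → X → ℝ) (μ ν : Measure X) :
    0 ≤ prokhorov d μ ν := Real.sInf_nonneg fun _ h => h.1.le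

theorem prokhorov_le_one {X : Type} [MeasurableSpace X] (d : X → X → ℝ) {μ ν : Measure X}
    (hμ : μ Set.univ ≤ 1) (hν : ν Set.univ ≤ 1) : prokhorov d μ ν ≤ 1 :=
  csInf_le (prokhorovRadii_bddBelow d μ ν) (one_mem_prokhorovRadii d hμ hν)

/-- Identification with the Lévy–Prokhorov distance, for which symmetry and the triangle inequality
are known. Real and extended radii give the same infimum because the distance of finite measures is
finite. -/
theorem prokhorov_dist {μ ν : Measure X} (hμ : μ Set.univ ≤ 1) (hν : ν Set.univ ≤ 1) :
    prokhorov dist μ ν = levyProkhorovDist μ ν := by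
  have : IsFiniteMeasure μ := ⟨hμ.trans_lt ENNReal.one_lt_top⟩
  have : IsFiniteMeasure ν := ⟨hν.trans_lt ENNReal.one_lt_top⟩
  have hfin := levyProkhorovEDist_ne_top μ ν
  refine le_antisymm (le_of_forall_gt_imp_ge_of_dense fun ε hε => ?_)
    (le_csInf ⟨1, one_mem_prokhorovRadii _ hμ hν⟩ fun ε hε => ?_)
  · have h0 : 0 < ε := ENNReal.toReal_nonneg.trans_lt hε
    have h1 : levyProkhorovEDist μ ν < ENNReal.ofReal ε :=
      (ENNReal.lt_ofReal_iff_toReal_lt hfin).2 hε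
    refine csInf_le (prokhorovRadii_bddBelow _ _ _) ⟨h0, fun A hA => ?_⟩
    have h2 := left_measure_le_of_levyProkhorovEDist_lt h1 hA
    have h3 := right_measure_le_of_levyProkhorovEDist_lt h1 hA
    rw [ENNReal.toReal_ofReal h0.le, ← thicken_dist] at h2 h3
    exact ⟨h2, h3⟩
  · refine ENNReal.toReal_le_of_le_ofReal hε.1.le (sInf_le fun A hA => ?_)
    rw [ENNReal.toReal_ofReal hε.1.le, ← thicken_dist]
    exact hε.2 A hA

/-- At distance 0 the measures agree on closed sets, a generating π-system. -/
theorem eq_of_prokhorov_eq_zero [BorelSpace X] {μ ν : Measure X} (hμ : μ Set.univ ≤ 1)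
    (hν : ν Set.univ ≤ 1) (h : prokhorov dist μ ν = 0) : μ = ν := by
  have : IsFiniteMeasure μ := ⟨hμ.trans_lt ENNReal.one_lt_top⟩
  have : IsFiniteMeasure ν := ⟨hν.trans_lt ENNReal.one_lt_top⟩
  rw [prokhorov_dist hμ hν, levyProkhorovDist, ENNReal.toReal_eq_zero_iff] at h
  have h0 := h.resolve_right (levyProkhorovEDist_ne_top μ ν)
  have key : ∀ A : Set X, IsClosed A → μ A = ν A := fun A hA =>
    measure_eq_measure_of_levyProkhorovEDist_eq_zero_of_isClosed h0 hA
      ⟨1, one_pos, measure_ne_top _ _⟩ ⟨1, one_pos, measure_ne_top _ _⟩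
  refine ext_of_generate_finite _ ?_ isPiSystem_isClosed key (key _ isClosed_univ)
  rw [BorelSpace.measurable_eq (α := X), borel_eq_generateFrom_isClosed]

variable [BorelSpace X] [SecondCountableTopology X]

/-- A bound for the Prokhorov distance in terms of the Wasserstein distance. -/
theorem prokhorov_le_of_wasserstein_lt (h1 : ∀ x y : X, dist x y ≤ 1) {μ ν : Measure X}
    (hμ : μ Set.univ ≤ 1) (hν : ν Set.univ ≤ 1) {ε : ℝ} (hε : 0 < ε) (hε1 : ε ≤ 1)
    (h : wasserstein dist μ ν < ε ^ 2) : prokhorov dist μ ν ≤ ε := by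
  have hd : Measurable fun z : X × X => dist z.1 z.2 := measurable_dist
  have key : ∀ {μ ν : Measure X}, μ Set.univ ≤ 1 → ν Set.univ ≤ 1 →
      wasserstein dist μ ν < ε ^ 2 → ∀ A : Set X, MeasurableSet A →
      μ A ≤ ν (thicken dist ε A) + ENNReal.ofReal ε := by
    intro μ ν hμ hν h A hA
    have i1 : IsFiniteMeasure μ := ⟨hμ.trans_lt ENNReal.one_lt_top⟩
    have i2 : IsFiniteMeasure ν := ⟨hν.trans_lt ENNReal.one_lt_top⟩
    obtain ⟨γ, hγ, hc⟩ := exists_lt_wasserstein_add hd dist_comm h1 hμ hν (sub_pos.2 h)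
    rw [add_sub_cancel] at hc
    have i3 : IsFiniteMeasure γ := ⟨hγ.univ_le_left.trans_lt (measure_lt_top _ _)⟩
    have hB : MeasurableSet (thicken dist ε A) := by
      rw [thicken_dist]
      exact Metric.isOpen_thickening.measurableSet
    have e1 : γ (Prod.fst ⁻¹' A) ≤ μ A := by
      rw [← Measure.map_apply measurable_fst hA]
      exact hγ.1 A
    have e1' : γ (Prod.fst ⁻¹' Aᶜ) ≤ μ Aᶜ := by
      rw [← Measure.map_apply measurable_fst hA.compl]
      exact hγ.1 Aᶜ
    have e2 : γ (Prod.snd ⁻¹' thicken dist ε A) ≤ ν (thicken dist ε A) := by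
      rw [← Measure.map_apply measurable_snd hB]
      exact hγ.2 _
    -- Markov's inequality: little mass is transported over distances of at least `ε`.
    have e3 : γ {z | ENNReal.ofReal ε ≤ ENNReal.ofReal (dist z.1 z.2)} ≤
        cost dist γ / ENNReal.ofReal ε :=
      meas_ge_le_lintegral_div hd.ennreal_ofReal.aemeasurable (by simpa using hε)
        ENNReal.ofReal_ne_top
    have e4 : γ (Prod.fst ⁻¹' A) ≤ γ (Prod.snd ⁻¹' thicken dist ε A) +
        γ {z | ENNReal.ofReal ε ≤ ENNReal.ofReal (dist z.1 z.2)} := by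
      refine (measure_mono fun z hz => ?_).trans (measure_union_le _ _)
      by_cases hd : dist z.1 z.2 < ε
      · exact Or.inl ⟨z.1, hz, hd⟩
      · exact Or.inr (ENNReal.ofReal_le_ofReal (not_lt.1 hd))
    have hcf : cost dist γ ≠ ⊤ := ne_top_of_le_ne_top (measure_ne_top γ _) (cost_le_univ h1 γ)
    have hcd : cost dist γ / ENNReal.ofReal ε ≠ ⊤ := ENNReal.div_ne_top hcf (by simpa using hε)
    have r1' := ENNReal.toReal_mono (measure_ne_top μ _) e1'
    have r2 := ENNReal.toReal_mono (measure_ne_top ν _) e2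
    have r3 := ENNReal.toReal_mono hcd e3
    have r4 := ENNReal.toReal_mono (by finiteness) e4
    rw [ENNReal.toReal_div, ENNReal.toReal_ofReal hε.le] at r3
    rw [ENNReal.toReal_add (measure_ne_top _ _) (measure_ne_top _ _)] at r4
    have s1 : μ.real A + μ.real Aᶜ = μ.real Set.univ := measureReal_add_measureReal_compl hA
    have s2 : γ.real (Prod.fst ⁻¹' A) + γ.real (Prod.fst ⁻¹' Aᶜ) = γ.real Set.univ :=
      measureReal_add_measureReal_compl (measurable_fst hA)
    have s3 : γ.real Set.univ ≤ μ.real Set.univ :=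
      ENNReal.toReal_mono (measure_ne_top _ _) hγ.univ_le_left
    have s4 : γ.real Set.univ ≤ ν.real Set.univ :=
      ENNReal.toReal_mono (measure_ne_top _ _) hγ.univ_le_right
    simp only [Measure.real] at s1 s2 s3 s4 hc
    -- As `ε ≤ 1`, dividing the untransported mass by `ε` does not decrease it; the total is then
    -- below `ε ^ 2 / ε`.
    have s5 : (cost dist γ).toReal / ε + ((μ Set.univ).toReal - (γ Set.univ).toReal) ≤ ε := by
      have : (cost dist γ).toReal / ε + ((μ Set.univ).toReal - (γ Set.univ).toReal) ≤
          (cost dist γ).toReal / ε + ((μ Set.univ).toReal - (γ Set.univ).toReal) / ε := by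
        gcongr
        exact le_div_self (sub_nonneg.2 s3) hε hε1
      refine this.trans ?_
      rw [← add_div, div_le_iff₀ hε]
      nlinarith
    rw [← ENNReal.toReal_le_toReal (measure_ne_top _ _) (by finiteness),
      ENNReal.toReal_add (measure_ne_top _ _) ENNReal.ofReal_ne_top, ENNReal.toReal_ofReal hε.le]
    linarith
  refine csInf_le (prokhorovRadii_bddBelow _ _ _) ⟨hε, fun A hA => ⟨key hμ hν h A hA, ?_⟩⟩
  rw [wasserstein_comm hd dist_comm h1 hμ hν] at h
  exact key hν hμ h A hA

theorem eq_of_wasserstein_eq_zero (h1 : ∀ x y : X, dist x y ≤ 1) {μ ν : Measure X}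
    (hμ : μ Set.univ ≤ 1) (hν : ν Set.univ ≤ 1) (h : wasserstein dist μ ν = 0) : μ = ν := by
  refine eq_of_prokhorov_eq_zero hμ hν (le_antisymm ?_ (prokhorov_nonneg _ _ _))
  refine le_of_forall_gt_imp_ge_of_dense fun ε hε => ?_
  refine (prokhorov_le_of_wasserstein_lt h1 hμ hν (lt_min hε one_pos) (min_le_right ε 1) ?_).trans
    (min_le_left _ _)
  rw [h]
  have := lt_min hε one_pos
  positivity

end Prokhorov

/-! ### Continuity with respect to the weak topology -/

section Continuity

variable {X : Type} [MetricSpace X] [MeasurableSpace X] [BorelSpace X]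

/-- A partial plan from a partition of unity. -/
theorem wasserstein_le_of_partition (h1 : ∀ x y : X, dist x y ≤ 1) [SecondCountableTopology X]
    {μ ν : Measure X}
    (hμ : μ Set.univ ≤ 1) (hν : ν Set.univ ≤ 1) {n : ℕ} (φ : Fin n → X → ENNReal)
    (hφ : ∀ i, Measurable (φ i)) (hsum : ∀ x, ∑ i, φ i x = 1) {δ : ℝ} (hδ : 0 ≤ δ)
    (hsmall : ∀ i x y, φ i x ≠ 0 → φ i y ≠ 0 → dist x y ≤ δ) :
    wasserstein dist μ ν ≤ δ + ∑ i, |(∫⁻ x, φ i x ∂μ).toReal - (∫⁻ x, φ i x ∂ν).toReal| := by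
  have i1 : IsFiniteMeasure μ := ⟨hμ.trans_lt ENNReal.one_lt_top⟩
  have i2 : IsFiniteMeasure ν := ⟨hν.trans_lt ENNReal.one_lt_top⟩
  have hd : Measurable fun z : X × X => dist z.1 z.2 := measurable_dist
  have dec : ∀ μ : Measure X, ∑ i, μ.withDensity (φ i) = μ := by
    intro μ
    ext s hs
    rw [Measure.finsetSum_apply]
    simp only [withDensity_apply _ hs]
    rw [← lintegral_finsetSum _ fun i _ => hφ i]
    simp [hsum]
  have tot : ∀ (μ : Measure X) i, μ.withDensity (φ i) Set.univ = ∫⁻ x, φ i x ∂μ := fun μ i => by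
    rw [withDensity_apply _ MeasurableSet.univ, Measure.restrict_univ]
  have hφ1 : ∀ i x, φ i x ≤ 1 := fun i x => by
    rw [← hsum x]
    exact Finset.single_le_sum (f := fun i => φ i x) (fun _ _ => zero_le) (Finset.mem_univ i)
  have fin : ∀ (μ : Measure X) [IsFiniteMeasure μ] i, ∫⁻ x, φ i x ∂μ ≠ ⊤ := fun μ _ i => by
    refine ne_top_of_le_ne_top (measure_ne_top μ Set.univ) ?_
    calc _ ≤ ∫⁻ _, 1 ∂μ := lintegral_mono fun x => hφ1 i x
      _ = _ := by simp
  have ifin : ∀ (μ : Measure X) [IsFiniteMeasure μ] i, IsFiniteMeasure (μ.withDensity (φ i)) :=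
    fun μ _ i => ⟨by rw [tot]; exact (fin μ i).lt_top⟩
  set a : Fin n → ENNReal := fun i => ∫⁻ x, φ i x ∂μ with ha
  set b : Fin n → ENNReal := fun i => ∫⁻ x, φ i x ∂ν with hb
  have j1 : ∀ i, IsFiniteMeasure (μ.withDensity (φ i)) := ifin μ
  have j2 : ∀ i, IsFiniteMeasure (ν.withDensity (φ i)) := ifin ν
  -- On each piece a rescaled product moves the mass that both measures have there, `min (a i) (b
  -- i)`. Normalizing by the maximum keeps both marginals below the given measures.
  set γ : Measure (X × X) := ∑ i, (max (a i) (b i))⁻¹ •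
    (μ.withDensity (φ i)).prod (ν.withDensity (φ i)) with hγ
  have hplan : PartialPlan γ μ ν := by
    constructor
    · rw [hγ, Measure.map_finset_sum measurable_fst.aemeasurable]
      conv_rhs => rw [← dec μ]
      refine Finset.sum_le_sum fun i _ => ?_
      rw [Measure.map_smul, Measure.map_fst_prod, smul_smul, tot]
      refine Measure.le_iff.2 fun s _ => ?_
      rw [Measure.smul_apply, smul_eq_mul]
      refine mul_le_of_le_one_left zero_le ?_
      exact (mul_le_mul_right (le_max_right _ _) _).trans (ENNReal.inv_mul_le_one _)
    · rw [hγ, Measure.map_finset_sum measurable_snd.aemeasurable]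
      conv_rhs => rw [← dec ν]
      refine Finset.sum_le_sum fun i _ => ?_
      rw [Measure.map_smul, Measure.map_snd_prod, smul_smul, tot]
      refine Measure.le_iff.2 fun s _ => ?_
      rw [Measure.smul_apply, smul_eq_mul]
      refine mul_le_of_le_one_left zero_le ?_
      exact (mul_le_mul_right (le_max_left _ _) _).trans (ENNReal.inv_mul_le_one _)
  have hprod : ∀ i, (μ.withDensity (φ i)).prod (ν.withDensity (φ i)) Set.univ = a i * b i := by
    intro i
    rw [← Set.univ_prod_univ, Measure.prod_prod, tot, tot]
  have hmass : γ.real Set.univ = ∑ i, min (a i).toReal (b i).toReal := by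
    have h2 : ∀ i, ((max (a i) (b i))⁻¹ * (a i * b i)).toReal = min (a i).toReal (b i).toReal := by
      intro i
      rw [ENNReal.toReal_mul, ENNReal.toReal_inv, ENNReal.toReal_max (fin μ i) (fin ν i),
        ENNReal.toReal_mul, ← min_mul_max (a i).toReal, mul_comm, mul_assoc]
      by_cases h0 : max (a i).toReal (b i).toReal = 0
      · rw [h0, zero_mul, mul_zero]
        have := max_eq_iff.1 h0
        have p1 := ENNReal.toReal_nonneg (a := a i)
        have p2 := ENNReal.toReal_nonneg (a := b i)
        rcases this with h | h
        · rw [h.1, min_eq_left p2]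
        · rw [h.1, min_eq_right p1]
      · rw [mul_inv_cancel₀ h0, mul_one]
    rw [Measure.real, hγ, Measure.finsetSum_apply]
    simp only [Measure.smul_apply, smul_eq_mul, hprod]
    rw [ENNReal.toReal_sum]
    · exact Finset.sum_congr rfl fun i _ => h2 i
    · intro i _
      by_cases h0 : max (a i) (b i) = 0
      · have : a i = 0 := le_antisymm ((le_max_left _ _).trans h0.le) zero_le
        simp [this]
      · exact ENNReal.mul_ne_top (ENNReal.inv_ne_top.2 h0) (ENNReal.mul_ne_top (fin μ i) (fin ν i))
  have i3 : IsFiniteMeasure γ := ⟨hplan.univ_le_left.trans_lt (measure_lt_top _ _)⟩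
  have hae : ∀ᵐ z ∂γ, ENNReal.ofReal (dist z.1 z.2) ≤ ENNReal.ofReal δ := by
    rw [hγ, ae_finsetSum_measure_iff]
    intro i _
    refine Measure.ae_smul_measure ?_ _
    rw [prod_withDensity (hφ i) (hφ i), ae_withDensity_iff (by fun_prop)]
    refine Filter.Eventually.of_forall fun z hz => ENNReal.ofReal_le_ofReal ?_
    exact hsmall i _ _ (left_ne_zero_of_mul hz) (right_ne_zero_of_mul hz)
  have hcost : (cost dist γ).toReal ≤ δ := by
    refine ENNReal.toReal_le_of_le_ofReal hδ ?_
    calc cost dist γ ≤ ∫⁻ _, ENNReal.ofReal δ ∂γ := lintegral_mono_ae hae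
      _ = ENNReal.ofReal δ * γ Set.univ := by rw [lintegral_const]
      _ ≤ _ := mul_le_of_le_one_right zero_le (hplan.univ_le_left.trans hμ)
  have tm : ∀ (μ : Measure X) [IsFiniteMeasure μ],
      μ.real Set.univ = ∑ i, (∫⁻ x, φ i x ∂μ).toReal := by
    intro μ _
    rw [← ENNReal.toReal_sum fun i _ => fin μ i, Measure.real]
    conv_lhs => rw [← dec μ, Measure.finsetSum_apply]
    simp only [tot]
  refine (wasserstein_le hd dist_comm h1 hμ hν hplan).trans ?_
  rw [add_assoc]
  refine add_le_add hcost (le_of_eq ?_)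
  -- The two untransported masses on a piece add up to `|a i - b i|`.
  rw [hmass, tm μ, tm ν, ← Finset.sum_sub_distrib, ← Finset.sum_sub_distrib,
    ← Finset.sum_add_distrib]
  refine Finset.sum_congr rfl fun i _ => ?_
  rcases le_total (a i).toReal (b i).toReal with h | h
  · rw [min_eq_left h, abs_of_nonpos (sub_nonpos.2 h)]
    ring
  · rw [min_eq_right h, abs_of_nonneg (sub_nonneg.2 h)]
    ring

/-- For a partition of unity subordinate to finitely many balls of radius `e / 4`, transport within
the pieces costs at most `e / 2`. The rest is a finite sum of differences of integrals of continuous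
functions, which tends to 0 weakly. -/
theorem eventually_wasserstein_lt [CompactSpace X] (h1 : ∀ x y : X, dist x y ≤ 1)
    {μ : FiniteMeasure X} (hμ : μ.mass ≤ 1) {e : ℝ} (he : 0 < e) :
    ∀ᶠ ν : FiniteMeasure X in nhds μ, ν.mass ≤ 1 → wasserstein dist (μ : Measure X) (ν : Measure X) < e := by
  have uni : ∀ μ : FiniteMeasure X, μ.mass ≤ 1 → (μ : Measure X) Set.univ ≤ 1 := by
    intro μ h
    rw [← FiniteMeasure.ennreal_mass]
    exact_mod_cast h
  obtain ⟨t, ht⟩ := CompactSpace.elim_nhds_subcover (fun x : X => Metric.ball x (e / 4))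
    fun x => Metric.ball_mem_nhds x (by linarith)
  obtain ⟨f, hf1, hf2, hf3, -⟩ := exists_continuous_sum_one_of_isOpen_isCompact
    (s := fun i => Metric.ball (t.equivFin.symm i : X) (e / 4)) (fun i => Metric.isOpen_ball)
    (isCompact_univ (X := X)) (fun x _ => by
      have hx : x ∈ ⋃ y ∈ t, Metric.ball y (e / 4) := ht ▸ Set.mem_univ x
      simp only [Set.mem_iUnion] at hx ⊢
      obtain ⟨y, hy, hxy⟩ := hx
      exact ⟨t.equivFin ⟨y, hy⟩, by simpa using hxy⟩)
  have hint : ∀ (ν : FiniteMeasure X) i,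
      (∫⁻ x, ENNReal.ofReal (f i x) ∂(ν : Measure X)).toReal = ∫ x, f i x ∂(ν : Measure X) := by
    intro ν i
    rw [integral_eq_lintegral_of_nonneg_ae (Filter.Eventually.of_forall fun x => (hf3 i x).1)
      (f i).continuous.measurable.aestronglyMeasurable]
  have htend : Filter.Tendsto (fun ν : FiniteMeasure X =>
      ∑ i, |∫ x, f i x ∂(μ : Measure X) - ∫ x, f i x ∂(ν : Measure X)|) (nhds μ) (nhds 0) := by
    have h0 : (0 : ℝ) =
        ∑ i, |∫ x, f i x ∂(μ : Measure X) - ∫ x, f i x ∂(μ : Measure X)| := by simp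
    rw [h0]
    refine tendsto_finsetSum _ fun i _ => (Filter.Tendsto.abs ?_)
    exact tendsto_const_nhds.sub (FiniteMeasure.tendsto_iff_forall_integral_tendsto.1
      Filter.tendsto_id (BoundedContinuousFunction.mkOfCompact (f i)))
  filter_upwards [htend.eventually_lt_const (half_pos he)] with ν hν hν1
  have key := wasserstein_le_of_partition h1 (uni μ hμ) (uni ν hν1)
    (fun i x => ENNReal.ofReal (f i x)) (fun i => (f i).continuous.measurable.ennreal_ofReal)
    (fun x => ?_) (half_pos he).le (fun i x y hx hy => ?_)
  · simp only [hint] at key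
    linarith
  · rw [← ENNReal.ofReal_sum_of_nonneg fun i _ => (hf3 i x).1, ← ENNReal.ofReal_one]
    have := hf2 (Set.mem_univ x)
    rw [Finset.sum_apply] at this
    rw [this, Pi.one_apply]
  · have hb : ∀ x, ENNReal.ofReal (f i x) ≠ 0 → dist x (t.equivFin.symm i : X) < e / 4 := by
      intro x hx
      refine hf1 i (subset_tsupport _ ?_)
      intro h0
      exact hx (by rw [h0, ENNReal.ofReal_zero])
    have hx := hb x hx
    have hy := hb y hy
    have := dist_triangle_right x y (t.equivFin.symm i : X)
    linarith

end Continuity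

/-! ### Metrizing compact spaces of measures -/

/-- A distance between measures that, over every compact metric space of diameter at most one, is
a metric and is continuous with respect to the weak topology. -/
structure WeakMetric
    (D : {X : Type} → [MeasurableSpace X] → (X → X → ℝ) → Measure X → Measure X → ℝ) : Prop where
  self : ∀ {X : Type} [MetricSpace X] [CompactSpace X] [Nonempty X] [MeasurableSpace X]
    [BorelSpace X], (∀ x y : X, dist x y ≤ 1) → ∀ {μ : Measure X}, μ Set.univ ≤ 1 →
    D dist μ μ = 0
  comm : ∀ {X : Type} [MetricSpace X] [CompactSpace X] [Nonempty X] [MeasurableSpace X]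
    [BorelSpace X], (∀ x y : X, dist x y ≤ 1) → ∀ {μ ν : Measure X}, μ Set.univ ≤ 1 →
    ν Set.univ ≤ 1 → D dist μ ν = D dist ν μ
  triangle : ∀ {X : Type} [MetricSpace X] [CompactSpace X] [Nonempty X] [MeasurableSpace X]
    [BorelSpace X], (∀ x y : X, dist x y ≤ 1) → ∀ {μ ν ρ : Measure X}, μ Set.univ ≤ 1 →
    ν Set.univ ≤ 1 → ρ Set.univ ≤ 1 → D dist μ ρ ≤ D dist μ ν + D dist ν ρ
  eq_of_eq_zero : ∀ {X : Type} [MetricSpace X] [CompactSpace X] [Nonempty X] [MeasurableSpace X]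
    [BorelSpace X], (∀ x y : X, dist x y ≤ 1) → ∀ {μ ν : Measure X}, μ Set.univ ≤ 1 →
    ν Set.univ ≤ 1 → D dist μ ν = 0 → μ = ν
  le_one : ∀ {X : Type} [MeasurableSpace X] {d : X → X → ℝ}, (∀ x y : X, d x y ≤ 1) →
    ∀ {μ ν : Measure X}, μ Set.univ ≤ 1 → ν Set.univ ≤ 1 → D d μ ν ≤ 1
  small : ∀ {X : Type} [MetricSpace X] [CompactSpace X] [Nonempty X] [MeasurableSpace X]
    [BorelSpace X], (∀ x y : X, dist x y ≤ 1) → ∀ {μ : FiniteMeasure X}, μ.mass ≤ 1 →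
    ∀ {e : ℝ}, 0 < e → ∀ᶠ ν : FiniteMeasure X in nhds μ, ν.mass ≤ 1 →
    D dist (μ : Measure X) (ν : Measure X) < e

theorem FiniteMeasure.univ_le_one {X : Type} [MeasurableSpace X] {μ : FiniteMeasure X}
    (h : μ.mass ≤ 1) : (μ : Measure X) Set.univ ≤ 1 := by
  rw [← FiniteMeasure.ennreal_mass]
  exact_mod_cast h

theorem weakMetric_wasserstein : WeakMetric wasserstein where
  self h1 _ hμ := wasserstein_self measurable_dist dist_comm h1 dist_self hμ
  comm h1 _ _ hμ hν := wasserstein_comm measurable_dist dist_comm h1 hμ hν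
  triangle h1 _ _ _ hμ hν hρ := wasserstein_triangle measurable_dist dist_comm h1 dist_triangle
    (fun _ _ => dist_nonneg) hμ hν hρ
  eq_of_eq_zero h1 _ _ hμ hν h := eq_of_wasserstein_eq_zero h1 hμ hν h
  le_one h1 _ _ hμ hν := wasserstein_le_one h1 hμ hν
  small h1 _ hμ _ he := eventually_wasserstein_lt h1 hμ he

/-- The metric axioms come from the Lévy–Prokhorov distance; weak continuity is inherited from the
Wasserstein distance. -/
theorem weakMetric_prokhorov : WeakMetric prokhorov where
  self _ _ hμ := by rw [prokhorov_dist hμ hμ, levyProkhorovDist_self]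
  comm _ _ _ hμ hν := by rw [prokhorov_dist hμ hν, prokhorov_dist hν hμ, levyProkhorovDist_comm]
  triangle _ μ ν ρ hμ hν hρ := by
    have : IsFiniteMeasure μ := ⟨hμ.trans_lt ENNReal.one_lt_top⟩
    have : IsFiniteMeasure ν := ⟨hν.trans_lt ENNReal.one_lt_top⟩
    have : IsFiniteMeasure ρ := ⟨hρ.trans_lt ENNReal.one_lt_top⟩
    rw [prokhorov_dist hμ hν, prokhorov_dist hν hρ, prokhorov_dist hμ hρ]
    exact levyProkhorovDist_triangle μ ν ρ
  eq_of_eq_zero _ _ _ hμ hν h := eq_of_prokhorov_eq_zero hμ hν h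
  le_one _ _ _ hμ hν := prokhorov_le_one _ hμ hν
  small h1 μ hμ e he := by
    have hm : 0 < min (e / 2) 1 := lt_min (half_pos he) one_pos
    filter_upwards [eventually_wasserstein_lt h1 hμ (pow_pos hm 2)] with ν hν hν1
    have := prokhorov_le_of_wasserstein_lt h1 (FiniteMeasure.univ_le_one hμ)
      (FiniteMeasure.univ_le_one hν1) hm (min_le_right _ _) (hν hν1)
    have := min_le_left (e / 2) 1
    linarith

/-- A continuous bijection from a compact space to a Hausdorff space is a homeomorphism. -/
theorem eq_induced_of_bijective {Y Z : Type} [t : TopologicalSpace Y] [CompactSpace Y]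
    [m : MetricSpace Z] {f : Y → Z} (hf : Function.Bijective f)
    (h : ∀ x, ∀ e > 0, ∀ᶠ y in nhds x, dist (f y) (f x) < e) :
    t = TopologicalSpace.induced f m.toUniformSpace.toTopologicalSpace :=
  (isHomeomorph_iff_continuous_bijective.2
    ⟨continuous_iff_continuousAt.2 fun x => Metric.tendsto_nhds.2 (h x), hf⟩).isInducing.eq_induced

/-- Compactness supplies one half of the comparison of topologies, so only continuity of the
distance at each point has to be checked. -/
theorem metrizes_of_compact {Y : Type} [t : TopologicalSpace Y] [CompactSpace Y] {d : Y → Y → ℝ}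
    (hself : ∀ x, d x x = 0) (hcomm : ∀ x y, d x y = d y x)
    (htri : ∀ x y z, d x z ≤ d x y + d y z) (heq : ∀ x y, d x y = 0 → x = y)
    (hcont : ∀ x, ∀ e > 0, ∀ᶠ y in nhds x, d x y < e) : Metrizes d := by
  let m : MetricSpace Y :=
    { dist := d
      dist_self := hself
      dist_comm := hcomm
      dist_triangle := htri
      eq_of_dist_eq_zero := fun {x y} => heq x y }
  refine ⟨m, fun _ _ => rfl, ?_⟩
  have key := @eq_induced_of_bijective Y Y t _ m id Function.bijective_id
    fun x e he => (hcont x e he).mono fun y hy => (hcomm y x).trans_lt hy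
  exact (key.trans (@induced_id Y m.toUniformSpace.toTopologicalSpace)).symm

theorem completeSeparable_of_compact {Y : Type} [TopologicalSpace Y] [CompactSpace Y]
    [MeasurableSpace Y] [BorelSpace Y] {d : Y → Y → ℝ} (h : Metrizes d) : CompleteSeparable d := by
  obtain ⟨m, hm, rfl⟩ := h
  exact ⟨m, hm, inferInstance, inferInstance, BorelSpace.measurable_eq⟩

/-! ### From a metric on a compact space to metrics on its spaces of measures. -/

section

variable {D : {X : Type} → [MeasurableSpace X] → (X → X → ℝ) → Measure X → Measure X → ℝ}
  {X : Type} [TopologicalSpace X] [CompactSpace X] [Nonempty X] [MeasurableSpace X] [BorelSpace X]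
  {d : X → X → ℝ}

theorem SubProb.univ_le {X : Type} [MeasurableSpace X] (α : SubProb X) :
    α.measure Set.univ ≤ 1 := FiniteMeasure.univ_le_one α.2

instance : Nonempty (SubProb X) := ⟨⟨0, by simp⟩⟩

theorem compactSpace_subProb {X : Type} [TopologicalSpace X] [CompactSpace X] [MeasurableSpace X]
    [BorelSpace X] [T2Space X] : CompactSpace (SubProb X) :=
  isCompact_iff_compactSpace.1 (isCompact_setOfPred_finiteMeasure_le_of_compactSpace X 1)

/-- Compactness passes from `X` to its measures of mass at most one, so weak continuity of `D` is
enough. -/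
theorem WeakMetric.metrizes_subProb (hD : WeakMetric D) (hd : Metrizes d)
    (h1 : ∀ x y, d x y ≤ 1) :
    Metrizes (fun α β : SubProb X => D d α.measure β.measure) := by
  obtain ⟨m, hm, rfl⟩ := hd
  obtain rfl : m.dist = d := by ext x y; exact hm x y
  have := compactSpace_subProb (X := X)
  refine metrizes_of_compact (fun α => hD.self h1 α.univ_le)
    (fun α β => hD.comm h1 α.univ_le β.univ_le)
    (fun α β γ => hD.triangle h1 α.univ_le β.univ_le γ.univ_le)
    (fun α β h => Subtype.ext (Subtype.ext (hD.eq_of_eq_zero h1 α.univ_le β.univ_le h)))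
    fun α e he => ?_
  have h2 := (continuous_subtype_val.continuousAt (x := α)).eventually (hD.small h1 α.2 he)
  filter_upwards [h2] with β hβ
  exact hβ β.2

theorem WeakMetric.metrizes_probabilityMeasure (hD : WeakMetric D) (hd : Metrizes d)
    (h1 : ∀ x y, d x y ≤ 1) :
    Metrizes (fun μ ν : ProbabilityMeasure X => D d (μ : Measure X) (ν : Measure X)) := by
  obtain ⟨m, hm, rfl⟩ := hd
  obtain rfl : m.dist = d := by ext x y; exact hm x y
  have u : ∀ μ : ProbabilityMeasure X, (μ : Measure X) Set.univ ≤ 1 := fun μ => measure_univ.le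
  refine metrizes_of_compact (fun α => hD.self h1 (u α))
    (fun α β => hD.comm h1 (u α) (u β))
    (fun α β γ => hD.triangle h1 (u α) (u β) (u γ))
    (fun α β h => Subtype.ext (hD.eq_of_eq_zero h1 (u α) (u β) h))
    fun α e he => ?_
  have h2 := (ProbabilityMeasure.toFiniteMeasure_continuous.continuousAt (x := α)).eventually
    (hD.small h1 α.mass_toFiniteMeasure.le he)
  filter_upwards [h2] with β hβ
  exact hβ β.mass_toFiniteMeasure.le

end

/-! ### The iterated metrics -/

namespace Metrizes

variable {X : Type} [TopologicalSpace X] {d : X → X → ℝ}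

theorem self (h : Metrizes d) (x : X) : d x x = 0 := by
  obtain ⟨m, hm, -⟩ := h
  rw [← hm, dist_self]

theorem comm (h : Metrizes d) (x y : X) : d x y = d y x := by
  obtain ⟨m, hm, -⟩ := h
  rw [← hm, ← hm, dist_comm]

theorem triangle (h : Metrizes d) (x y z : X) : d x z ≤ d x y + d y z := by
  obtain ⟨m, hm, -⟩ := h
  rw [← hm, ← hm, ← hm]
  exact dist_triangle x y z

theorem eq_of_eq_zero (h : Metrizes d) {x y : X} (hxy : d x y = 0) : x = y := by
  obtain ⟨m, hm, -⟩ := h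
  rw [← hm] at hxy
  exact dist_eq_zero.1 hxy

theorem nonneg (h : Metrizes d) (x y : X) : 0 ≤ d x y := by
  obtain ⟨m, hm, -⟩ := h
  rw [← hm]
  exact dist_nonneg

theorem eventually_lt (h : Metrizes d) (x : X) {e : ℝ} (he : 0 < e) : ∀ᶠ y in nhds x, d x y < e := by
  obtain ⟨m, hm, rfl⟩ := h
  filter_upwards [Metric.ball_mem_nhds x he] with y hy
  rw [← hm, dist_comm]
  exact hy

theorem t2Space (h : Metrizes d) : T2Space X := by
  obtain ⟨m, hm, rfl⟩ := h
  infer_instance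

theorem measurable [MeasurableSpace X] [BorelSpace X] [CompactSpace X] (h : Metrizes d) :
    Measurable fun z : X × X => d z.1 z.2 := by
  obtain ⟨m, hm, rfl⟩ := h
  simp only [← hm]
  exact measurable_dist

end Metrizes

theorem prokhorovDefined_of_compact {X : Type} [TopologicalSpace X] [CompactSpace X]
    [MeasurableSpace X] [BorelSpace X] {d : X → X → ℝ} (h : Metrizes d) : ProkhorovDefined d :=
  ⟨completeSeparable_of_compact h, fun _ _ hμ hν => ⟨1, one_mem_prokhorovRadii d hμ hν⟩⟩

theorem wassersteinDefined_of_compact {X : Type} [TopologicalSpace X] [CompactSpace X]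
    [MeasurableSpace X] [BorelSpace X] {d : X → X → ℝ} (h : Metrizes d) (h1 : ∀ x y, d x y ≤ 1) :
    WassersteinDefined d :=
  ⟨completeSeparable_of_compact h, fun _ _ hμ hle => exists_plan_product h1 hμ hle⟩

section Iterate

variable {D : {X : Type} → [MeasurableSpace X] → (X → X → ℝ) → Measure X → Measure X → ℝ}

/-- Compactness, diameter at most one and metrizability are proved together, because each level uses
all of them for the level below. -/
theorem WeakMetric.idm (hD : WeakMetric D) (h : ℕ) : CompactSpace (IDM h) ∧ Nonempty (IDM h) ∧
    Metrizes (iterDist D h) ∧ ∀ x y, iterDist D h x y ≤ 1 := by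
  induction h with
  | zero =>
    have hc : CompactSpace (IDM 0) := inferInstanceAs (CompactSpace Unit)
    have : Subsingleton (IDM 0) := inferInstanceAs (Subsingleton Unit)
    refine ⟨hc, inferInstanceAs (Nonempty Unit), metrizes_of_compact (fun _ => rfl)
      (fun _ _ => rfl) (fun _ _ _ => (add_zero (0 : ℝ)).ge) (fun _ _ _ => Subsingleton.elim _ _)
      (fun _ e he => Filter.Eventually.of_forall fun _ => he), fun _ _ => zero_le_one⟩
  | succ h ih =>
    obtain ⟨_, _, i3, i4⟩ := ih
    have := i3.t2Space
    exact ⟨compactSpace_subProb (X := IDM h), inferInstanceAs (Nonempty (SubProb (IDM h))),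
      hD.metrizes_subProb i3 i4, fun x y => hD.le_one i4 (SubProb.univ_le (X := IDM h) x)
        (SubProb.univ_le (X := IDM h) y)⟩

instance (h : ℕ) : CompactSpace (IDM h) := (weakMetric_prokhorov.idm h).1

instance (h : ℕ) : Nonempty (IDM h) := (weakMetric_prokhorov.idm h).2.1

instance (h : ℕ) : T2Space (IDM h) := (weakMetric_prokhorov.idm h).2.2.1.t2Space

theorem WeakMetric.metrizes_iterDist (hD : WeakMetric D) (h : ℕ) : Metrizes (iterDist D h) :=
  (hD.idm h).2.2.1

theorem WeakMetric.iterDist_le_one (hD : WeakMetric D) {h : ℕ} (x y : IDM h) :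
    iterDist D h x y ≤ 1 :=
  (hD.idm h).2.2.2 x y

/-- The inverse limit is closed in a product of compact Hausdorff spaces, as the projections are
continuous. -/
instance : CompactSpace IDMInf := by
  have : IsClosed {α : (h : ℕ) → IDM h | ∀ h, proj h (α (h + 1)) = α h} := by
    rw [Set.ofPred_forall]
    exact isClosed_iInter fun h =>
      isClosed_eq ((continuous_proj h).comp (continuous_apply _)) (continuous_apply _)
  exact isCompact_iff_compactSpace.1 this.isCompact

instance : Nonempty IDMInf := ⟨idmInf (⊥ : SimpleGraph (Fin 1)) 0⟩

/-- The supremum of the iterated distances, divided by their depths. -/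
def supDist (D : {X : Type} → [MeasurableSpace X] → (X → X → ℝ) → Measure X → Measure X → ℝ)
    (α β : IDMInf) : ℝ :=
  ⨆ h : ℕ, iterDist D (h + 1) (α.1 (h + 1)) (β.1 (h + 1)) / ((h : ℝ) + 1)

theorem WeakMetric.iterDist_div_le (hD : WeakMetric D) (h : ℕ) (x y : IDM (h + 1)) :
    iterDist D (h + 1) x y / ((h : ℝ) + 1) ≤ 1 / ((h : ℝ) + 1) := by
  gcongr
  exact hD.iterDist_le_one x y

theorem WeakMetric.iterDist_div_le_one (hD : WeakMetric D) (h : ℕ) (x y : IDM (h + 1)) :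
    iterDist D (h + 1) x y / ((h : ℝ) + 1) ≤ 1 :=
  (hD.iterDist_div_le h x y).trans
    ((div_le_one (by positivity)).2 (le_add_of_nonneg_left (Nat.cast_nonneg h)))

theorem WeakMetric.bddAbove (hD : WeakMetric D) (α β : IDMInf) : BddAbove (Set.range fun h : ℕ =>
    iterDist D (h + 1) (α.1 (h + 1)) (β.1 (h + 1)) / ((h : ℝ) + 1)) :=
  ⟨1, Set.forall_mem_range.2 fun h => hD.iterDist_div_le_one h _ _⟩

theorem WeakMetric.supDist_le_one (hD : WeakMetric D) (α β : IDMInf) : supDist D α β ≤ 1 :=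
  ciSup_le fun h => hD.iterDist_div_le_one h _ _

theorem WeakMetric.metrizes_supDist (hD : WeakMetric D) : Metrizes (supDist D) := by
  have hm := fun h => hD.metrizes_iterDist h
  refine metrizes_of_compact (fun α => ?_) (fun α β => ?_) (fun α β γ => ?_) (fun α β h0 => ?_)
    fun α e he => ?_
  · simp [supDist, (hm _).self]
  · exact congrArg iSup (funext fun h => by rw [(hm _).comm])
  · refine ciSup_le fun h => ?_
    refine le_trans ?_ (add_le_add (le_ciSup (hD.bddAbove α β) h) (le_ciSup (hD.bddAbove β γ) h))
    rw [← add_div]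
    gcongr
    exact (hm _).triangle _ _ _
  · have h1 : ∀ h, α.1 (h + 1) = β.1 (h + 1) := by
      intro h
      have h2 := (le_ciSup (hD.bddAbove α β) h).trans_eq h0
      have hp : (0 : ℝ) < (h : ℝ) + 1 := by positivity
      rw [div_le_iff₀ hp, zero_mul] at h2
      exact (hm _).eq_of_eq_zero (le_antisymm h2 ((hm _).nonneg _ _))
    -- The supremum starts at depth 1, but every component, also the one at depth 0, is the
    -- projection of the next.
    refine Subtype.ext (funext fun h => ?_)
    rw [← α.2 h, ← β.2 h, h1]
  -- The factors `1 / (h + 1)` make all terms from `N` on small at once, so only finitely many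
  -- continuity conditions remain.
  · obtain ⟨N, hN⟩ := exists_nat_one_div_lt (half_pos he)
    have h1 : ∀ᶠ β in nhds α, ∀ h ∈ Finset.range N,
        iterDist D (h + 1) (α.1 (h + 1)) (β.1 (h + 1)) < e / 2 := by
      rw [Filter.eventually_all_finset]
      intro h _
      have hc : Continuous fun β : IDMInf => β.1 (h + 1) :=
        (continuous_apply _).comp continuous_subtype_val
      exact hc.continuousAt.eventually ((hm (h + 1)).eventually_lt (α.1 (h + 1)) (half_pos he))
    filter_upwards [h1] with β hβ
    refine lt_of_le_of_lt (ciSup_le fun h => ?_) (half_lt_self he)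
    by_cases hh : h < N
    · refine le_trans (div_le_self ((hm _).nonneg _ _) ?_) (hβ h (Finset.mem_range.2 hh)).le
      exact le_add_of_nonneg_left (Nat.cast_nonneg h)
    · refine (hD.iterDist_div_le h _ _).trans (le_trans ?_ hN.le)
      gcongr
      exact not_lt.1 hh

end Iterate

/-! ### Measures with finitely many atoms -/

section Atoms

open Classical

variable {X : Type} [MeasurableSpace X] {n m : ℕ}

/-- The measure that gives mass `1/n` to each of the points `i u` with `A u`. -/
def atoms (A : Fin n → Prop) (i : Fin n → X) : Measure X :=
  ∑ u, (if A u then (n : ENNReal)⁻¹ else 0) • Measure.dirac (i u)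

/-- The cost of transporting an atom to another one, or to nowhere. -/
def atomCost (d : X → X → ℝ) (A : Fin n → Prop) (B : Fin m → Prop) (i : Fin n → X)
    (j : Fin m → X) (u : Fin n) (v : Fin m) : ℝ :=
  if A u then (if B v then d (i u) (j v) else 1) else if B v then 1 else 0

theorem atoms_apply [MeasurableSingletonClass X] (A : Fin n → Prop) (i : Fin n → X) (S : Set X) :
    atoms A i S = ({u | A u ∧ i u ∈ S} : Finset (Fin n)).card * (n : ENNReal)⁻¹ := by
  simp only [atoms, Measure.finsetSum_apply, Measure.smul_apply, Measure.dirac_apply, smul_eq_mul,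
    Set.indicator_apply, Pi.one_apply, mul_ite, mul_one, mul_zero]
  rw [Finset.sum_ite, Finset.sum_const_zero, add_zero, Finset.sum_ite, Finset.sum_const_zero,
    add_zero, Finset.sum_const, nsmul_eq_mul, Finset.filter_filter]
  simp only [and_comm]

theorem atoms_real [MeasurableSingletonClass X] (A : Fin n → Prop) (i : Fin n → X) (S : Set X) :
    (atoms A i).real S = ({u | A u ∧ i u ∈ S} : Finset (Fin n)).card / (n : ℝ) := by
  rw [Measure.real, atoms_apply, ENNReal.toReal_mul, ENNReal.toReal_inv, div_eq_mul_inv,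
    ENNReal.toReal_natCast, ENNReal.toReal_natCast]

theorem atoms_real_univ [MeasurableSingletonClass X] (A : Fin n → Prop) (i : Fin n → X) :
    (atoms A i).real Set.univ = ∑ u, 1 / (n : ℝ) * if A u then 1 else 0 := by
  rw [atoms_real, ← Finset.mul_sum, Finset.sum_boole]
  simp only [Set.mem_univ, and_true]
  ring

theorem atoms_univ_le [NeZero n] [MeasurableSingletonClass X] (A : Fin n → Prop) (i : Fin n → X) :
    atoms A i Set.univ ≤ 1 := by
  rw [atoms_apply]
  refine (mul_le_mul_left ?_ _).trans (ENNReal.mul_inv_le_one (n : ENNReal))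
  exact Nat.cast_le.2 ((Finset.card_le_univ _).trans_eq (Fintype.card_fin n))

/-- Different indices may have the same point; each takes the reciprocal of their number as its
share. -/
theorem sum_indicator_atoms {X : Type} {n : ℕ} (A : Fin n → Prop) (i : Fin n → X) (x : X) :
    ∑ u, ({i u} : Set X).indicator (fun _ => if A u then
        ((({u' | A u' ∧ i u' = i u} : Finset (Fin n)).card : ENNReal))⁻¹ else 0) x =
      if ∃ u, A u ∧ i u = x then 1 else 0 := by
  simp only [Set.indicator_apply, Set.mem_singleton_iff]
  have h : ∀ u, (if x = i u then if A u then
      ((({u' | A u' ∧ i u' = i u} : Finset (Fin n)).card : ENNReal))⁻¹ else 0 else 0) =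
      if A u ∧ i u = x then
      ((({u' | A u' ∧ i u' = x} : Finset (Fin n)).card : ENNReal))⁻¹ else 0 := by
    intro u
    by_cases hx : x = i u
    · subst hx
      simp
    · simp [hx, Ne.symm hx]
  simp only [h]
  rw [← Finset.sum_filter, Finset.sum_const, nsmul_eq_mul]
  split_ifs with hx
  · obtain ⟨u, hu⟩ := hx
    refine ENNReal.mul_inv_cancel ?_ (ENNReal.natCast_ne_top _)
    rw [Nat.cast_ne_zero, Finset.card_ne_zero]
    exact ⟨u, by simpa using hu⟩
  · push Not at hx
    rw [Finset.filter_false_of_mem (fun u _ h => hx u h.1 h.2)]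
    simp

/-- Functions that distribute the points among the indices of the atoms. -/
theorem exists_shares [MeasurableSingletonClass X] (A : Fin n → Prop) (i : Fin n → X) :
    ∃ w : Fin n → X → ENNReal, (∀ u, Measurable (w u)) ∧ (∀ u x, w u x ≠ 0 → A u ∧ i u = x) ∧
      (∀ x, ∑ u, w u x ≤ 1) ∧ (∀ᵐ x ∂atoms A i, ∑ u, w u x = 1) ∧
      ∀ u, ∫⁻ x, w u x ∂atoms A i ≤ (n : ENNReal)⁻¹ := by
  refine ⟨fun u => ({i u} : Set X).indicator fun _ => if A u then
        ((({u' | A u' ∧ i u' = i u} : Finset (Fin n)).card : ENNReal))⁻¹ else 0,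
    fun u => measurable_const.indicator (measurableSet_singleton _), fun u x hx => ?_,
    fun x => ?_, ?_, fun u => ?_⟩
  · have h1 : x ∈ ({i u} : Set X) := by
      by_contra h
      exact hx (Set.indicator_of_notMem h _)
    beta_reduce at hx
    rw [Set.indicator_of_mem h1] at hx
    refine ⟨?_, (Set.mem_singleton_iff.1 h1).symm⟩
    by_contra h
    exact hx (if_neg h)
  · rw [sum_indicator_atoms]
    split_ifs <;> simp
  · simp only [sum_indicator_atoms]
    rw [atoms, ae_finsetSum_measure_iff]
    intro u _
    by_cases hu : A u
    · refine Measure.ae_smul_measure ?_ _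
      rw [ae_dirac_eq]
      exact Filter.eventually_pure.2 (if_pos ⟨u, hu, rfl⟩)
    · rw [if_neg hu, zero_smul]
      simp
  · rw [lintegral_indicator (measurableSet_singleton _), setLIntegral_const, atoms_apply]
    split_ifs with hu
    · simp only [Set.mem_singleton_iff]
      rw [← mul_assoc]
      exact mul_le_of_le_one_left zero_le (ENNReal.inv_mul_le_one _)
    · simp

end Atoms

/-- A subcoupling can be completed. -/
theorem OT_le_subcoupling {n m : ℕ} [NeZero n] [NeZero m] {c G : Fin n → Fin m → ℝ}
    (hG : ∀ u v, 0 ≤ G u v) (hr : ∀ u, ∑ v, G u v ≤ 1 / n) (hc : ∀ v, ∑ u, G u v ≤ 1 / m)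
    {p : Fin n → ℝ} {q : Fin m → ℝ} (hpq : ∀ u v, c u v ≤ p u + q v) :
    OT c ≤ ∑ u, ∑ v, G u v * c u v + ∑ u, (1 / n - ∑ v, G u v) * p u +
      ∑ v, (1 / m - ∑ u, G u v) * q v := by
  have hn : (n : ℝ) ≠ 0 := NeZero.ne _
  have hm : (m : ℝ) ≠ 0 := NeZero.ne _
  set a : Fin n → ℝ := fun u => 1 / n - ∑ v, G u v with ha
  set b : Fin m → ℝ := fun v => 1 / m - ∑ u, G u v with hb
  have ha0 : ∀ u, 0 ≤ a u := fun u => sub_nonneg.2 (hr u)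
  have hb0 : ∀ v, 0 ≤ b v := fun v => sub_nonneg.2 (hc v)
  -- Both margins have total mass 1, so equal masses are missing on the two sides, and the product
  -- of the deficits divided by `D` fills the gap.
  have hab : ∑ u, a u = ∑ v, b v := by
    simp only [ha, hb, Finset.sum_sub_distrib, Finset.sum_const, Finset.card_univ,
      Fintype.card_fin, nsmul_eq_mul]
    rw [mul_one_div_cancel hn, mul_one_div_cancel hm, Finset.sum_comm]
  set D := ∑ u, a u with hD
  have hD0 : 0 ≤ D := Finset.sum_nonneg fun u _ => ha0 u
  -- If nothing is missing then `D = 0`, and division by zero gives the desired value 0.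
  have e1 : ∀ u, ∑ v, a u * b v / D = a u := by
    intro u
    rw [← Finset.sum_div, ← Finset.mul_sum, ← hab]
    by_cases h : D = 0
    · rw [h, div_zero]
      exact ((Finset.sum_eq_zero_iff_of_nonneg fun u _ => ha0 u).1 h u (Finset.mem_univ u)).symm
    · rw [mul_div_cancel_right₀ _ h]
  have e2 : ∀ v, ∑ u, a u * b v / D = b v := by
    intro v
    rw [← Finset.sum_div, ← Finset.sum_mul, ← hD]
    by_cases h : D = 0
    · rw [h, div_zero]
      exact ((Finset.sum_eq_zero_iff_of_nonneg fun u _ => hb0 u).1 (hab.symm.trans h) v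
        (Finset.mem_univ v)).symm
    · rw [mul_div_cancel_left₀ _ h]
  have hx : ∀ u v, 0 ≤ a u * b v / D := fun u v => div_nonneg (mul_nonneg (ha0 u) (hb0 v)) hD0
  refine (OT_le_coupling c (fun u v => G u v + a u * b v / D)
    (fun u v => add_nonneg (hG u v) (hx u v)) (fun u => ?_) (fun v => ?_)).trans ?_
  · rw [Finset.sum_add_distrib, e1]
    simp only [ha]
    ring
  · rw [Finset.sum_add_distrib, e2]
    simp only [hb]
    ring
  · have e3 : ∑ u, ∑ v, a u * b v / D * c u v ≤ ∑ u, a u * p u + ∑ v, b v * q v := by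
      calc _ ≤ ∑ u, ∑ v, (a u * b v / D * p u + a u * b v / D * q v) := by
            refine Finset.sum_le_sum fun u _ => Finset.sum_le_sum fun v _ => ?_
            rw [← mul_add]
            exact mul_le_mul_of_nonneg_left (hpq u v) (hx u v)
        _ = ∑ u, ∑ v, a u * b v / D * p u + ∑ v, ∑ u, a u * b v / D * q v := by
            simp only [Finset.sum_add_distrib]
            congr 1
            exact Finset.sum_comm
        _ = _ := by simp only [← Finset.sum_mul, e1, e2]
    simp only [add_mul, Finset.sum_add_distrib]
    linarith

/-! ### The Wasserstein distance of measures with finitely many atoms. -/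

section Wasserstein

open Classical

variable {X : Type} [MeasurableSpace X] [MeasurableSingletonClass X] {n m : ℕ} [NeZero n] [NeZero m]

/-- An optimal coupling of the indices, restricted to pairs of actual atoms, is a partial plan.
Pairs with exactly one actual atom, at cost 1, account for the untransported masses. -/
theorem wasserstein_atoms_le {d : X → X → ℝ} (hd : Measurable fun z : X × X => d z.1 z.2)
    (hs : ∀ x y, d x y = d y x) (h1 : ∀ x y, d x y ≤ 1) (h0 : ∀ x y, 0 ≤ d x y)
    (A : Fin n → Prop) (B : Fin m → Prop) (i : Fin n → X) (j : Fin m → X) :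
    wasserstein d (atoms A i) (atoms B j) ≤ OT (atomCost d A B i j) := by
  have hμ := atoms_univ_le A i
  have hν := atoms_univ_le B j
  have i1 : IsFiniteMeasure (atoms A i) := ⟨hμ.trans_lt ENNReal.one_lt_top⟩
  have i2 : IsFiniteMeasure (atoms B j) := ⟨hν.trans_lt ENNReal.one_lt_top⟩
  obtain ⟨Γ, g0, gr, gc, gs⟩ := exists_coupling (atomCost d A B i j)
  set Γ' : Fin n → Fin m → ℝ := fun u v => if A u ∧ B v then Γ u v else 0 with hΓ'
  have g0' : ∀ u v, 0 ≤ Γ' u v := fun u v => by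
    simp only [hΓ']
    split_ifs
    exacts [g0 u v, le_rfl]
  have gle : ∀ u v, Γ' u v ≤ Γ u v := fun u v => by
    simp only [hΓ']
    split_ifs
    exacts [le_rfl, g0 u v]
  set γ : Measure (X × X) := ∑ u, ∑ v, ENNReal.ofReal (Γ' u v) • Measure.dirac (i u, j v) with hγ
  have inv : ∀ k : ℕ, k ≠ 0 → (k : ENNReal)⁻¹ = ENNReal.ofReal (1 / k) := by
    intro k hk
    rw [one_div, ENNReal.ofReal_inv_of_pos (by positivity), ENNReal.ofReal_natCast]
  have smul_le : ∀ {Y : Type} [MeasurableSpace Y] (μ : Measure Y) {a b : ENNReal}, a ≤ b →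
      a • μ ≤ b • μ := by
    intro Y _ μ a b hab
    refine Measure.le_iff.2 fun s _ => ?_
    simp only [Measure.smul_apply, smul_eq_mul]
    gcongr
  have hp : PartialPlan γ (atoms A i) (atoms B j) := by
    constructor
    · rw [hγ, Measure.map_finset_sum measurable_fst.aemeasurable, atoms]
      refine Finset.sum_le_sum fun u _ => ?_
      rw [Measure.map_finset_sum measurable_fst.aemeasurable]
      simp only [Measure.map_smul, Measure.map_dirac' measurable_fst]
      rw [← Finset.sum_smul, ← ENNReal.ofReal_sum_of_nonneg fun v _ => g0' u v]
      refine smul_le _ ?_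
      split_ifs with hu
      · rw [inv _ (NeZero.ne n), ← gr u]
        exact ENNReal.ofReal_le_ofReal (Finset.sum_le_sum fun v _ => gle u v)
      · simp [hΓ', hu]
    · rw [hγ, Finset.sum_comm, Measure.map_finset_sum measurable_snd.aemeasurable, atoms]
      refine Finset.sum_le_sum fun v _ => ?_
      rw [Measure.map_finset_sum measurable_snd.aemeasurable]
      simp only [Measure.map_smul, Measure.map_dirac' measurable_snd]
      rw [← Finset.sum_smul, ← ENNReal.ofReal_sum_of_nonneg fun u _ => g0' u v]
      refine smul_le _ ?_
      split_ifs with hv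
      · rw [inv _ (NeZero.ne m), ← gc v]
        exact ENNReal.ofReal_le_ofReal (Finset.sum_le_sum fun u _ => gle u v)
      · simp [hΓ', hv]
  have hcost : (cost d γ).toReal = ∑ u, ∑ v, Γ' u v * d (i u) (j v) := by
    have hnn : ∀ u v, 0 ≤ Γ' u v * d (i u) (j v) := fun u v => mul_nonneg (g0' u v) (h0 _ _)
    rw [cost, hγ]
    simp only [lintegral_finsetSum_measure, lintegral_smul_measure, lintegral_dirac, smul_eq_mul,
      ← ENNReal.ofReal_mul (g0' _ _)]
    simp only [← ENNReal.ofReal_sum_of_nonneg fun v _ => hnn _ v]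
    rw [← ENNReal.ofReal_sum_of_nonneg fun u _ => Finset.sum_nonneg fun v _ => hnn u v,
      ENNReal.toReal_ofReal (Finset.sum_nonneg fun u _ => Finset.sum_nonneg fun v _ => hnn u v)]
  have hmass : γ.real Set.univ = ∑ u, ∑ v, Γ' u v := by
    rw [Measure.real, hγ]
    simp only [Measure.finsetSum_apply, Measure.smul_apply, measure_univ, smul_eq_mul, mul_one]
    simp only [← ENNReal.ofReal_sum_of_nonneg fun v _ => g0' _ v]
    rw [← ENNReal.ofReal_sum_of_nonneg fun u _ => Finset.sum_nonneg fun v _ => g0' u v,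
      ENNReal.toReal_ofReal (Finset.sum_nonneg fun u _ => Finset.sum_nonneg fun v _ => g0' u v)]
  refine (wasserstein_le hd hs h1 hμ hν hp).trans (le_of_eq ?_)
  have er : ∑ u, 1 / (n : ℝ) * (if A u then 1 else 0) = ∑ u, ∑ v, Γ u v * if A u then 1 else 0 :=
    Finset.sum_congr rfl fun u _ => by rw [← gr u, Finset.sum_mul]
  have ec : ∑ v, 1 / (m : ℝ) * (if B v then 1 else 0) = ∑ u, ∑ v, Γ u v * if B v then 1 else 0 := by
    rw [Finset.sum_comm]
    exact Finset.sum_congr rfl fun v _ => by rw [← gc v, Finset.sum_mul]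
  rw [hcost, hmass, atoms_real_univ, atoms_real_univ, ← gs, er, ec]
  simp only [← Finset.sum_sub_distrib, ← Finset.sum_add_distrib]
  refine Finset.sum_congr rfl fun u _ => Finset.sum_congr rfl fun v _ => ?_
  by_cases hu : A u <;> by_cases hv : B v <;> simp [hΓ', atomCost, hu, hv]

/-- The shares turn a partial plan into a subcoupling of the indices. In its completion every actual
atom costs at most 1 per unit of missing mass, which the untransported masses pay for. -/
theorem le_wasserstein_atoms {d : X → X → ℝ} (hd : Measurable fun z : X × X => d z.1 z.2)
    (hs : ∀ x y, d x y = d y x) (h1 : ∀ x y, d x y ≤ 1) (h0 : ∀ x y, 0 ≤ d x y)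
    (A : Fin n → Prop) (B : Fin m → Prop) (i : Fin n → X) (j : Fin m → X) :
    OT (atomCost d A B i j) ≤ wasserstein d (atoms A i) (atoms B j) := by
  have hμ := atoms_univ_le A i
  have hν := atoms_univ_le B j
  refine le_of_forall_lt_wasserstein_add hd hs h1 hμ hν fun γ hγ => ?_
  obtain ⟨w, wm, ws, wle, wae, wint⟩ := exists_shares A i
  obtain ⟨w', wm', ws', wle', wae', wint'⟩ := exists_shares B j
  have i3 : IsFiniteMeasure γ := ⟨(hγ.univ_le_left.trans hμ).trans_lt ENNReal.one_lt_top⟩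
  -- The mass that `γ` transports from the share of `u` to the share of `v`.
  set G : Fin n → Fin m → ENNReal := fun u v => ∫⁻ z, w u z.1 * w' v z.2 ∂γ with hG
  have mm : ∀ u v, Measurable fun z : X × X => w u z.1 * w' v z.2 := fun u v =>
    ((wm u).comp measurable_fst).mul ((wm' v).comp measurable_snd)
  have hrow : ∀ u, ∑ v, G u v ≤ (n : ENNReal)⁻¹ := fun u =>
    calc ∑ v, G u v = ∫⁻ z, w u z.1 * ∑ v, w' v z.2 ∂γ := by
          rw [hG, ← lintegral_finsetSum _ fun v _ => mm u v]
          simp only [Finset.mul_sum]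
      _ ≤ ∫⁻ z, w u z.1 ∂γ := lintegral_mono fun z => mul_le_of_le_one_right zero_le (wle' _)
      _ = ∫⁻ x, w u x ∂γ.map Prod.fst := (lintegral_map (wm u) measurable_fst).symm
      _ ≤ ∫⁻ x, w u x ∂atoms A i := lintegral_mono' hγ.1 le_rfl
      _ ≤ _ := wint u
  have hcol : ∀ v, ∑ u, G u v ≤ (m : ENNReal)⁻¹ := fun v =>
    calc ∑ u, G u v = ∫⁻ z, (∑ u, w u z.1) * w' v z.2 ∂γ := by
          rw [hG, ← lintegral_finsetSum _ fun u _ => mm u v]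
          simp only [Finset.sum_mul]
      _ ≤ ∫⁻ z, w' v z.2 ∂γ := lintegral_mono fun z => mul_le_of_le_one_left zero_le (wle _)
      _ = ∫⁻ x, w' v x ∂γ.map Prod.snd := (lintegral_map (wm' v) measurable_snd).symm
      _ ≤ ∫⁻ x, w' v x ∂atoms B j := lintegral_mono' hγ.2 le_rfl
      _ ≤ _ := wint' v
  have htot : ∑ u, ∑ v, G u v = γ Set.univ := by
    have a1 : ∀ᵐ z ∂γ, ∑ u, w u z.1 = 1 := by
      have : ∀ᵐ x ∂γ.map Prod.fst, ∑ u, w u x = 1 :=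
        (Measure.absolutelyContinuous_of_le hγ.1).ae_le wae
      exact ae_of_ae_map measurable_fst.aemeasurable this
    have a2 : ∀ᵐ z ∂γ, ∑ v, w' v z.2 = 1 := by
      have : ∀ᵐ x ∂γ.map Prod.snd, ∑ v, w' v x = 1 :=
        (Measure.absolutelyContinuous_of_le hγ.2).ae_le wae'
      exact ae_of_ae_map measurable_snd.aemeasurable this
    calc ∑ u, ∑ v, G u v = ∫⁻ z, (∑ u, w u z.1) * ∑ v, w' v z.2 ∂γ := by
          simp only [Finset.sum_mul_sum]
          rw [lintegral_finsetSum _ fun u _ => Finset.measurable_sum _ fun v _ => mm u v]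
          exact Finset.sum_congr rfl fun u _ => (lintegral_finsetSum _ fun v _ => mm u v).symm
      _ = ∫⁻ _, 1 ∂γ := by
          refine lintegral_congr_ae ?_
          filter_upwards [a1, a2] with z h1 h2
          rw [h1, h2, one_mul]
      _ = _ := by simp
  have hcost : ∑ u, ∑ v, G u v * ENNReal.ofReal (d (i u) (j v)) ≤ cost d γ := by
    calc ∑ u, ∑ v, G u v * ENNReal.ofReal (d (i u) (j v)) =
          ∫⁻ z, ∑ u, ∑ v, w u z.1 * w' v z.2 * ENNReal.ofReal (d z.1 z.2) ∂γ := by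
          have md : ∀ u v, Measurable fun z : X × X =>
              w u z.1 * w' v z.2 * ENNReal.ofReal (d z.1 z.2) := fun u v =>
            (mm u v).mul hd.ennreal_ofReal
          rw [lintegral_finsetSum _ fun u _ => Finset.measurable_sum _ fun v _ => md u v]
          refine Finset.sum_congr rfl fun u _ => ?_
          rw [lintegral_finsetSum _ fun v _ => md u v]
          refine Finset.sum_congr rfl fun v _ => ?_
          rw [hG, ← lintegral_mul_const _ (mm u v)]
          refine lintegral_congr fun z => ?_
          by_cases hz : w u z.1 * w' v z.2 = 0
          · rw [hz, zero_mul, zero_mul]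
          · rw [(ws u z.1 (left_ne_zero_of_mul hz)).2, (ws' v z.2 (right_ne_zero_of_mul hz)).2]
      _ ≤ _ := by
          refine lintegral_mono fun z => ?_
          simp only [← Finset.sum_mul, ← Finset.sum_mul_sum]
          exact mul_le_of_le_one_left zero_le (mul_le_one' (wle _) (wle' _))
  have hzero : ∀ u v, ¬(A u ∧ B v) → G u v = 0 := by
    intro u v h
    refine (lintegral_congr fun z => ?_).trans lintegral_zero
    by_contra hz
    exact h ⟨(ws u z.1 (left_ne_zero_of_mul hz)).1, (ws' v z.2 (right_ne_zero_of_mul hz)).1⟩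
  have hfin : ∀ u v, G u v ≠ ⊤ := fun u v => by
    refine ne_top_of_le_ne_top ?_
      ((Finset.single_le_sum (f := fun v => G u v) (fun _ _ => zero_le)
        (Finset.mem_univ v)).trans (hrow u))
    exact ENNReal.inv_ne_top.2 (Nat.cast_ne_zero.2 (NeZero.ne n))
  -- With the indicators of `A` and `B` as potentials, the weighted deficits are exactly the
  -- untransported masses.
  have key := OT_le_subcoupling (c := atomCost d A B i j) (G := fun u v => (G u v).toReal)
    (p := fun u => if A u then 1 else 0) (q := fun v => if B v then 1 else 0)
    (fun _ _ => ENNReal.toReal_nonneg) (fun u => ?_) (fun v => ?_) (fun u v => ?_)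
  · refine key.trans ?_
    have e0 : (γ Set.univ).toReal = ∑ u, ∑ v, (G u v).toReal := by
      rw [← htot, ENNReal.toReal_sum fun u _ => ENNReal.sum_ne_top.2 fun v _ => hfin u v]
      exact Finset.sum_congr rfl fun u _ => ENNReal.toReal_sum fun v _ => hfin u v
    have e1 : ∑ u, ∑ v, (G u v).toReal * atomCost d A B i j u v ≤ (cost d γ).toReal := by
      have hc : cost d γ ≠ ⊤ := ne_top_of_le_ne_top (measure_ne_top γ _) (cost_le_univ h1 γ)
      refine le_trans (le_of_eq ?_) (ENNReal.toReal_mono hc hcost)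
      have hf : ∀ u v, G u v * ENNReal.ofReal (d (i u) (j v)) ≠ ⊤ := fun u v =>
        ENNReal.mul_ne_top (hfin u v) ENNReal.ofReal_ne_top
      rw [ENNReal.toReal_sum fun u _ => ENNReal.sum_ne_top.2 fun v _ => hf u v]
      refine Finset.sum_congr rfl fun u _ => ?_
      rw [ENNReal.toReal_sum fun v _ => hf u v]
      refine Finset.sum_congr rfl fun v _ => ?_
      rw [ENNReal.toReal_mul, ENNReal.toReal_ofReal (h0 _ _)]
      by_cases huv : A u ∧ B v
      · rw [atomCost, if_pos huv.1, if_pos huv.2]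
      · rw [hzero u v huv, ENNReal.toReal_zero, zero_mul, zero_mul]
    have e2 : ∑ u, (1 / (n : ℝ) - ∑ v, (G u v).toReal) * (if A u then 1 else 0) =
        (atoms A i).real Set.univ - γ.real Set.univ := by
      rw [atoms_real_univ, Measure.real, e0, ← Finset.sum_sub_distrib]
      refine Finset.sum_congr rfl fun u _ => ?_
      by_cases hu : A u
      · simp [hu]
      · simp [hu, fun v => hzero u v fun h => hu h.1]
    have e3 : ∑ v, (1 / (m : ℝ) - ∑ u, (G u v).toReal) * (if B v then 1 else 0) =
        (atoms B j).real Set.univ - γ.real Set.univ := by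
      rw [atoms_real_univ, Measure.real, e0, Finset.sum_comm, ← Finset.sum_sub_distrib]
      refine Finset.sum_congr rfl fun v _ => ?_
      by_cases hv : B v
      · simp [hv]
      · simp [hv, fun u => hzero u v fun h => hv h.2]
    rw [e2, e3]
    linarith
  · rw [← ENNReal.toReal_sum fun v _ => hfin u v]
    refine (ENNReal.toReal_mono ?_ (hrow u)).trans_eq ?_
    · exact ENNReal.inv_ne_top.2 (Nat.cast_ne_zero.2 (NeZero.ne n))
    · simp
  · rw [← ENNReal.toReal_sum fun u _ => hfin u v]
    refine (ENNReal.toReal_mono ?_ (hcol v)).trans_eq ?_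
    · exact ENNReal.inv_ne_top.2 (Nat.cast_ne_zero.2 (NeZero.ne m))
    · simp
  · have := h1 (i u) (j v)
    by_cases hu : A u <;> by_cases hv : B v <;> simp [atomCost, hu, hv]
    linarith

theorem wasserstein_atoms {d : X → X → ℝ} (hd : Measurable fun z : X × X => d z.1 z.2)
    (hs : ∀ x y, d x y = d y x) (h1 : ∀ x y, d x y ≤ 1) (h0 : ∀ x y, 0 ≤ d x y)
    (A : Fin n → Prop) (B : Fin m → Prop) (i : Fin n → X) (j : Fin m → X) :
    wasserstein d (atoms A i) (atoms B j) = OT (atomCost d A B i j) :=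
  le_antisymm (wasserstein_atoms_le hd hs h1 h0 A B i j) (le_wasserstein_atoms hd hs h1 h0 A B i j)

end Wasserstein

open Classical in
/-- Hall's theorem with deficiency. -/
theorem exists_perm_of_deficiency {α : Type} [Fintype α] (R : α → α → Prop) (k : ℕ)
    (h : ∀ S : Finset α, S.Nonempty → S.card ≤ ({y | ∃ x ∈ S, R x y} : Finset α).card + k) :
    ∃ π : Equiv.Perm α, ({x | ¬R x (π x)} : Finset α).card ≤ k := by
  obtain ⟨f, hf, hft⟩ := (Finset.all_card_le_biUnion_card_iff_exists_injective
    -- Joining every point to `k` extra targets makes up for the deficiency, so Hall's condition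
    -- holds.
    (fun x : α => (({y | R x y} : Finset α).disjSum (Finset.univ : Finset (Fin k))))).1 <| by
    intro S
    rcases S.eq_empty_or_nonempty with rfl | hS
    · simp
    · refine (h S hS).trans ?_
      obtain ⟨x₀, hx₀⟩ := hS
      have hsub : ({y | ∃ x ∈ S, R x y} : Finset α).disjSum (Finset.univ : Finset (Fin k)) ⊆
          S.biUnion fun x => ({y | R x y} : Finset α).disjSum (Finset.univ : Finset (Fin k)) := by
        rintro (y | y) hy
        · simpa using hy
        · simpa using ⟨x₀, hx₀⟩
      refine le_trans (le_of_eq ?_) (Finset.card_le_card hsub)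
      rw [Finset.card_disjSum, Finset.card_univ, Fintype.card_fin]
  let p : α → Prop := fun x => ∃ y, f x = Sum.inl y
  let q : α → Prop := fun y => ∃ x, f x = Sum.inl y
  -- The points matched to genuine targets give a bijection between two subsets of `α`, which
  -- extends to a permutation. All other points occupy distinct extra targets, so there are at most
  -- `k` of them.
  let e : {x // p x} ≃ {y // q y} := Equiv.ofBijective
    (fun x => ⟨x.2.choose, x.1, x.2.choose_spec⟩) <| by
    constructor
    · intro x x' hx
      have h1 := x.2.choose_spec
      have h2 := x'.2.choose_spec
      rw [Subtype.mk.inj hx] at h1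
      exact Subtype.ext (hf (h1.trans h2.symm))
    · rintro ⟨y, x, hx⟩
      refine ⟨⟨x, y, hx⟩, Subtype.ext ?_⟩
      have h1 : p x := ⟨y, hx⟩
      exact Sum.inl_injective (h1.choose_spec.symm.trans hx)
  refine ⟨e.extendSubtype, ?_⟩
  have hR : ∀ x, p x → R x (e.extendSubtype x) := by
    intro x hx
    rw [Equiv.extendSubtype_apply_of_mem e x hx]
    have h1 := hft x
    change R x hx.choose
    rw [hx.choose_spec] at h1
    simpa using h1
  calc _ ≤ ((Finset.univ : Finset (Fin k)).map ⟨Sum.inr, Sum.inr_injective (α := α)⟩).card := by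
        refine Finset.card_le_card_of_injOn f (fun x hx => ?_) hf.injOn
        have hx' : ¬R x (e.extendSubtype x) := by simpa using hx
        rcases hfx : f x with y | y
        · exact absurd (hR x ⟨y, hfx⟩) hx'
        · simp
    _ = k := by simp

/-! ### The Prokhorov distance of measures with finitely many atoms. -/

section Prokhorov

open Classical

variable {X : Type} [MeasurableSpace X] [MeasurableSingletonClass X] {n m : ℕ}

theorem atoms_real_eq_sum (A : Fin n → Prop) (i : Fin n → X) (S : Set X) :
    (atoms A i).real S = ∑ u, 1 / (n : ℝ) * if A u ∧ i u ∈ S then 1 else 0 := by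
  rw [atoms_real, ← Finset.mul_sum, Finset.sum_boole]
  ring

variable [NeZero n] [NeZero m]

theorem atoms_le_iff (A : Fin n → Prop) (B : Fin m → Prop) (i : Fin n → X) (j : Fin m → X)
    (S T : Set X) {ε : ℝ} (hε : 0 ≤ ε) :
    atoms A i S ≤ atoms B j T + ENNReal.ofReal ε ↔ (atoms A i).real S ≤ (atoms B j).real T + ε := by
  have i1 : IsFiniteMeasure (atoms A i) := ⟨(atoms_univ_le A i).trans_lt ENNReal.one_lt_top⟩
  have i2 : IsFiniteMeasure (atoms B j) := ⟨(atoms_univ_le B j).trans_lt ENNReal.one_lt_top⟩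
  rw [← ENNReal.toReal_le_toReal (measure_ne_top _ _) (by finiteness),
    ENNReal.toReal_add (measure_ne_top _ _) ENNReal.ofReal_ne_top, ENNReal.toReal_ofReal hε]
  rfl

/-- The easy direction of Strassen's theorem: under the coupling, pairs of cost below `ε` carry
atoms in a set to atoms in its neighbourhood, and the other pairs have total weight at most `ε`. -/
theorem mem_radii_of_OT_le {d : X → X → ℝ} (hs : ∀ x y, d x y = d y x) (A : Fin n → Prop)
    (B : Fin m → Prop) (i : Fin n → X) (j : Fin m → X) {ε : ℝ} (hε : 0 < ε) (hε1 : ε ≤ 1)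
    (h : OT (fun u v => if ε ≤ atomCost d A B i j u v then 1 else 0) ≤ ε) :
    ε ∈ prokhorovRadii d (atoms A i) (atoms B j) := by
  obtain ⟨Γ, g0, gr, gc, gs⟩ :=
    exists_coupling fun u v => if ε ≤ atomCost d A B i j u v then (1 : ℝ) else 0
  have er : ∀ S : Set X, (atoms A i).real S =
      ∑ u, ∑ v, Γ u v * if A u ∧ i u ∈ S then 1 else 0 := fun S => by
    rw [atoms_real_eq_sum]
    exact Finset.sum_congr rfl fun u _ => by rw [← gr u, Finset.sum_mul]
  have ec : ∀ S : Set X, (atoms B j).real S =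
      ∑ u, ∑ v, Γ u v * if B v ∧ j v ∈ S then 1 else 0 := fun S => by
    rw [Finset.sum_comm, atoms_real_eq_sum]
    exact Finset.sum_congr rfl fun v _ => by rw [← gc v, Finset.sum_mul]
  refine ⟨hε, fun S _ => ?_⟩
  rw [atoms_le_iff _ _ _ _ _ _ hε.le, atoms_le_iff _ _ _ _ _ _ hε.le, er, ec, er, ec]
  have hle := gs.trans_le h
  constructor
  · refine le_trans ?_ (add_le_add le_rfl hle)
    rw [← Finset.sum_add_distrib]
    refine Finset.sum_le_sum fun u _ => ?_
    rw [← Finset.sum_add_distrib]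
    refine Finset.sum_le_sum fun v _ => ?_
    rw [← mul_add]
    refine mul_le_mul_of_nonneg_left ?_ (g0 u v)
    by_cases hu : A u ∧ i u ∈ S
    · by_cases hc : ε ≤ atomCost d A B i j u v
      · rw [if_pos hu, if_pos hc]
        split_ifs <;> norm_num
      · have hv : B v ∧ j v ∈ thicken d ε S := by
          rw [atomCost, if_pos hu.1] at hc
          by_cases hv : B v
          · rw [if_pos hv] at hc
            exact ⟨hv, i u, hu.2, not_le.1 hc⟩
          · rw [if_neg hv] at hc
            -- An actual atom paired with a dummy costs 1, which is not below `ε`.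
            exact absurd hε1 hc
        rw [if_pos hu, if_pos hv, if_neg hc, add_zero]
    · rw [if_neg hu]
      split_ifs <;> norm_num
  · refine le_trans ?_ (add_le_add le_rfl hle)
    rw [← Finset.sum_add_distrib]
    refine Finset.sum_le_sum fun u _ => ?_
    rw [← Finset.sum_add_distrib]
    refine Finset.sum_le_sum fun v _ => ?_
    rw [← mul_add]
    refine mul_le_mul_of_nonneg_left ?_ (g0 u v)
    by_cases hv : B v ∧ j v ∈ S
    · by_cases hc : ε ≤ atomCost d A B i j u v
      · rw [if_pos hv, if_pos hc]
        split_ifs <;> norm_num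
      · have hu : A u ∧ i u ∈ thicken d ε S := by
          rw [atomCost, if_pos hv.1, if_pos hv.1] at hc
          by_cases hu : A u
          · rw [if_pos hu] at hc
            exact ⟨hu, j v, hv.2, (hs _ _).trans_lt (not_le.1 hc)⟩
          · rw [if_neg hu] at hc
            exact absurd hε1 hc
        rw [if_pos hu, if_pos hv, if_neg hc, add_zero]
    · rw [if_neg hv]
      split_ifs <;> norm_num

/-- This is Hall's condition with deficiency for the relation "cost below `ε`"; the radius condition
is tested on finite sets only. -/
theorem card_le_of_mem_radii {d : X → X → ℝ} (hs : ∀ x y, d x y = d y x) (A : Fin n → Prop)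
    (B : Fin m → Prop) (i : Fin n → X) (j : Fin m → X) {ε : ℝ}
    (h : ε ∈ prokhorovRadii d (atoms A i) (atoms B j)) (S : Finset (Fin n × Fin m)) :
    (S.card : ℝ) ≤ ({y | ∃ x ∈ S, atomCost d A B i j x.1 y.2 < ε} : Finset (Fin n × Fin m)).card +
      ε * (n * m) := by
  have hn : (0 : ℝ) < n := Nat.cast_pos.2 (NeZero.pos n)
  have hm : (0 : ℝ) < m := Nat.cast_pos.2 (NeZero.pos m)
  obtain ⟨hε, h⟩ := h
  set N := ({y | ∃ x ∈ S, atomCost d A B i j x.1 y.2 < ε} : Finset (Fin n × Fin m)) with hN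
  have cn : (Finset.univ : Finset (Fin n)).card = n := Finset.card_fin n
  have cm : (Finset.univ : Finset (Fin m)).card = m := Finset.card_fin m
  by_cases hA : ∀ x ∈ S, A x.1
  -- If `S` contains actual atoms only, the first inequality is applied to their positions: copies
  -- of atoms in the neighbourhood are all related to `S`.
  · set T : Set X := (fun x : Fin n × Fin m => i x.1) '' S with hT
    have hTm : MeasurableSet T := (S.finite_toSet.image _).measurableSet
    have h1 := (h T hTm).1
    rw [atoms_le_iff _ _ _ _ _ _ hε.le, atoms_real, atoms_real] at h1
    set a := ({u | A u ∧ i u ∈ T} : Finset (Fin n)) with ha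
    set b := ({v | B v ∧ j v ∈ thicken d ε T} : Finset (Fin m)) with hb
    have h2 : S ⊆ a ×ˢ Finset.univ := fun x hx => by
      rw [Finset.mem_product, ha, Finset.mem_filter]
      exact ⟨⟨Finset.mem_univ _, hA x hx, x, hx, rfl⟩, Finset.mem_univ _⟩
    have h3 : (Finset.univ : Finset (Fin n)) ×ˢ b ⊆ N := fun y hy => by
      rw [Finset.mem_product, hb, Finset.mem_filter] at hy
      obtain ⟨-, -, hB, -, ⟨x, hx, rfl⟩, hd⟩ := hy
      rw [hN, Finset.mem_filter]
      refine ⟨Finset.mem_univ _, x, hx, ?_⟩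
      rw [atomCost, if_pos (hA x hx), if_pos hB]
      exact hd
    have h4 := Finset.card_le_card h2
    have h5 := Finset.card_le_card h3
    rw [Finset.card_product, cm] at h4
    rw [Finset.card_product, cn] at h5
    have h4' : (S.card : ℝ) ≤ a.card * m := by exact_mod_cast h4
    have h5' : (n : ℝ) * b.card ≤ N.card := by exact_mod_cast h5
    have h6 : (a.card : ℝ) * m ≤ n * b.card + ε * (n * m) := by
      have := mul_le_mul_of_nonneg_right h1 (mul_pos hn hm).le
      field_simp at this
      linarith
    linarith
  · push Not at hA
    obtain ⟨x₀, hx₀, hAx₀⟩ := hA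
    -- A dummy in `S` is related to all dummy targets. The targets that are not related to `S` are
    -- atoms far from all actual atoms in `S`; the second inequality is applied to these, and `S`
    -- avoids the atoms in their neighbourhood.
    set T : Set X := j '' {v | B v ∧ ∀ x ∈ S, A x.1 → ¬d (i x.1) (j v) < ε} with hT
    have hTm : MeasurableSet T := ((Set.toFinite _).image _).measurableSet
    have h1 := (h T hTm).2
    rw [atoms_le_iff _ _ _ _ _ _ hε.le, atoms_real, atoms_real] at h1
    set a := ({u | A u ∧ i u ∈ thicken d ε T} : Finset (Fin n)) with ha
    set b := ({v | B v ∧ j v ∈ T} : Finset (Fin m)) with hb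
    have h2 : Disjoint S (a ×ˢ Finset.univ) := by
      refine Finset.disjoint_left.2 fun x hx hxa => ?_
      rw [Finset.mem_product, ha, Finset.mem_filter] at hxa
      obtain ⟨⟨-, hAx, -, ⟨v, ⟨-, hv⟩, rfl⟩, hd⟩, -⟩ := hxa
      exact hv x hx hAx ((hs _ _).trans_lt hd)
    have h3 : Finset.univ ⊆ N ∪ (Finset.univ : Finset (Fin n)) ×ˢ b := fun y _ => by
      rw [Finset.mem_union, Finset.mem_product, hN, Finset.mem_filter, hb, Finset.mem_filter]
      by_cases hB : B y.2
      · by_cases hy : ∀ x ∈ S, A x.1 → ¬d (i x.1) (j y.2) < ε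
        · exact Or.inr ⟨Finset.mem_univ _, Finset.mem_univ _, hB, y.2, ⟨hB, hy⟩, rfl⟩
        · push Not at hy
          obtain ⟨x, hx, hAx, hd⟩ := hy
          refine Or.inl ⟨Finset.mem_univ _, x, hx, ?_⟩
          rw [atomCost, if_pos hAx, if_pos hB]
          exact hd
      · refine Or.inl ⟨Finset.mem_univ _, x₀, hx₀, ?_⟩
        rw [atomCost, if_neg hAx₀, if_neg hB]
        exact hε
    have h4 := (Finset.card_union_of_disjoint h2).symm.trans_le (Finset.card_le_univ _)
    have h5 := (Finset.card_le_card h3).trans (Finset.card_union_le _ _)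
    rw [Finset.card_product, cm, Fintype.card_prod, Fintype.card_fin, Fintype.card_fin] at h4
    rw [Finset.card_product, cn, Finset.card_univ, Fintype.card_prod, Fintype.card_fin,
      Fintype.card_fin] at h5
    have h4' : (S.card : ℝ) + a.card * m ≤ n * m := by exact_mod_cast h4
    have h5' : (n : ℝ) * m ≤ N.card + n * b.card := by exact_mod_cast h5
    have h6 : (n : ℝ) * b.card ≤ a.card * m + ε * (n * m) := by
      have := mul_le_mul_of_nonneg_right h1 (mul_pos hn hm).le
      field_simp at this
      linarith
    linarith

/-- The hard direction of Strassen's theorem: Hall's theorem with deficiency `⌊ε * (n * m)⌋` yields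
a permutation with at most that many pairs of cost at least `ε`. -/
theorem OT_le_of_mem_radii {d : X → X → ℝ} (hs : ∀ x y, d x y = d y x) (A : Fin n → Prop)
    (B : Fin m → Prop) (i : Fin n → X) (j : Fin m → X) {ε : ℝ}
    (h : ε ∈ prokhorovRadii d (atoms A i) (atoms B j)) :
    OT (fun u v => if ε ≤ atomCost d A B i j u v then 1 else 0) ≤ ε := by
  have hn : (0 : ℝ) < n := Nat.cast_pos.2 (NeZero.pos n)
  have hm : (0 : ℝ) < m := Nat.cast_pos.2 (NeZero.pos m)
  have h0 : 0 ≤ ε * (n * m) := mul_nonneg h.1.le (mul_pos hn hm).le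
  obtain ⟨π, hπ⟩ := exists_perm_of_deficiency
    (fun x y : Fin n × Fin m => atomCost d A B i j x.1 y.2 < ε) ⌊ε * (n * m)⌋₊ fun S _ => by
      have h1 := card_le_of_mem_radii hs A B i j h S
      rw [← Nat.sub_le_iff_le_add']
      refine Nat.le_floor ?_
      rcases le_total S.card
        ({y | ∃ x ∈ S, atomCost d A B i j x.1 y.2 < ε} : Finset (Fin n × Fin m)).card with h2 | h2
      · rw [Nat.sub_eq_zero_of_le h2]
        simpa using h0
      · rw [Nat.cast_sub h2]
        linarith
  refine (OT_le_perm _ π).trans ?_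
  rw [div_le_iff₀ (mul_pos hn hm), Finset.sum_boole]
  simp only [not_lt] at hπ
  exact (Nat.cast_le.2 hπ).trans (Nat.floor_le h0)

/-- Both numbers are infima of the same set. Radii of at least 1 are treated apart, since pairing an
actual atom with a dummy may then cost less than `ε`; they are admissible simply because the masses
are at most 1. -/
theorem prokhorov_atoms {d : X → X → ℝ} (hs : ∀ x y, d x y = d y x) (A : Fin n → Prop)
    (B : Fin m → Prop) (i : Fin n → X) (j : Fin m → X) :
    prokhorov d (atoms A i) (atoms B j) = PV (atomCost d A B i j) := by
  refine congrArg sInf (Set.ext fun ε => ⟨fun h => ⟨h.1, OT_le_of_mem_radii hs A B i j h⟩, ?_⟩)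
  rintro ⟨hε, h⟩
  rcases le_total ε 1 with h1 | h1
  · exact mem_radii_of_OT_le hs A B i j hε h1 h
  · refine ⟨hε, fun S _ => ?_⟩
    have h2 : 1 ≤ ENNReal.ofReal ε := ENNReal.one_le_ofReal.2 h1
    exact ⟨((measure_mono S.subset_univ).trans (atoms_univ_le A i)).trans (h2.trans le_add_self),
      ((measure_mono S.subset_univ).trans (atoms_univ_le B j)).trans (h2.trans le_add_self)⟩

end Prokhorov

/-! ### Iterated degree measures of graphs -/

section Blocks

open Classical

variable {n : ℕ} [NeZero n]

/-- A block lies between a half-open and a closed interval of length `1 / n`, which covers the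
closed last block as well. -/
theorem volume_block (u : Fin n) :
    (volume : Measure unitInterval) (block n ⁻¹' {u}) = (n : ENNReal)⁻¹ := by
  have hn : (0 : ℝ) < n := Nat.cast_pos.2 (NeZero.pos n)
  have hu : ((u : ℕ) : ℝ) + 1 ≤ n := by exact_mod_cast u.2
  let q : unitInterval := ⟨((u : ℕ) + 1 : ℝ) / n, by positivity, (div_le_one hn).2 hu⟩
  have hlen : ENNReal.ofReal ((q : ℝ) - (point u : unitInterval)) = (n : ENNReal)⁻¹ := by
    change ENNReal.ofReal (((u : ℕ) + 1 : ℝ) / n - ((u : ℕ) : ℝ) / n) = _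
    rw [← sub_div, add_sub_cancel_left, one_div, ENNReal.ofReal_inv_of_pos hn,
      ENNReal.ofReal_natCast]
  refine le_antisymm ?_ ?_
  · rw [← hlen, ← unitInterval.volume_Icc]
    refine measure_mono fun x hx => ?_
    have hx' : min ⌊(n : ℝ) * (x : ℝ)⌋₊ (n - 1) = u := Fin.ext_iff.1 hx
    have h0 : 0 ≤ (n : ℝ) * (x : ℝ) := mul_nonneg hn.le x.2.1
    have h1 : ((u : ℕ) : ℝ) ≤ (n : ℝ) * (x : ℝ) :=
      (Nat.le_floor_iff h0).1 (hx'.symm.trans_le (min_le_left _ _))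
    refine ⟨Subtype.coe_le_coe.1 ((div_le_iff₀' hn).2 h1), Subtype.coe_le_coe.1 ?_⟩
    refine (le_div_iff₀' hn).2 ?_
    rcases min_choice ⌊(n : ℝ) * (x : ℝ)⌋₊ (n - 1) with h | h
    · rw [h] at hx'
      rw [← hx']
      exact (Nat.lt_floor_add_one _).le
    · have h2 : ((u : ℕ) : ℝ) + 1 = n := by
        have := NeZero.pos n
        have : (u : ℕ) + 1 = n := by omega
        exact_mod_cast this
      rw [h2]
      exact mul_le_of_le_one_right hn.le x.2.2
  · rw [← hlen, ← unitInterval.volume_Ico]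
    refine measure_mono fun x hx => ?_
    have h1 : ((u : ℕ) : ℝ) ≤ (n : ℝ) * (x : ℝ) := (div_le_iff₀' hn).1 hx.1
    have h2 : (n : ℝ) * (x : ℝ) < ((u : ℕ) : ℝ) + 1 :=
      (lt_div_iff₀' hn).1 (show (x : ℝ) < (((u : ℕ) + 1 : ℝ) / n) from hx.2)
    refine Fin.ext ?_
    change min ⌊(n : ℝ) * (x : ℝ)⌋₊ (n - 1) = u
    rw [(Nat.floor_eq_iff (mul_nonneg hn.le x.2.1)).2 ⟨h1, h2⟩]
    have := u.2
    omega

theorem lintegral_block (g : Fin n → ENNReal) :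
    ∫⁻ y : unitInterval, g (block n y) = ∑ u, (n : ENNReal)⁻¹ * g u := by
  rw [← lintegral_map (measurable_of_finite g) (measurable_block n), lintegral_fintype]
  refine Finset.sum_congr rfl fun u _ => ?_
  rw [Measure.map_apply (measurable_block n) (measurableSet_singleton u), volume_block, mul_comm]

variable {Y : Type} [MeasurableSpace Y] [MeasurableSingletonClass Y]

/-- The graphon and `f` are constant on blocks, and each block has measure `1 / n`. -/
theorem map_row (G : SimpleGraph (Fin n)) (x : unitInterval) {f : unitInterval → Y}
    (hf : ∀ x y, block n x = block n y → f x = f y) :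
    ((graphon G).row x).map f = atoms (G.Adj (block n x)) fun u => f (point u) := by
  ext S hS
  have hm := measurable_of_block n f hf
  rw [Measure.map_apply hm hS, Graphon.row, withDensity_apply _ (hm hS),
    ← lintegral_indicator (hm hS), atoms_apply]
  have h1 : ∀ y, (f ⁻¹' S).indicator (fun y => ENNReal.ofReal ((graphon G).toFun x y)) y =
      (fun u => if G.Adj (block n x) u ∧ f (point u) ∈ S then (1 : ENNReal) else 0)
        (block n y) := by
    intro y
    have h2 : f (point (block n y)) = f y := hf _ _ (block_point _)
    simp only [Set.indicator_apply, Set.mem_preimage, graphon, h2]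
    by_cases hy : f y ∈ S <;> by_cases ha : G.Adj (block n x) (block n y) <;> simp [hy, ha]
  refine (lintegral_congr h1).trans ((lintegral_block fun u : Fin n =>
    if G.Adj (block n x) u ∧ f (point u) ∈ S then 1 else 0).trans ?_)
  rw [← Finset.mul_sum, Finset.sum_boole, mul_comm]

theorem map_volume {f : unitInterval → Y} (hf : ∀ x y, block n x = block n y → f x = f y) :
    (volume : Measure unitInterval).map f = atoms (fun _ : Fin n => True) fun u => f (point u) := by
  ext S hS
  have hm := measurable_of_block n f hf
  rw [Measure.map_apply hm hS, ← lintegral_indicator_one (hm hS), atoms_apply]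
  have h1 : ∀ y, (f ⁻¹' S).indicator (1 : unitInterval → ENNReal) y =
      (fun u => if True ∧ f (point u) ∈ S then (1 : ENNReal) else 0) (block n y) := by
    intro y
    have h2 : f (point (block n y)) = f y := hf _ _ (block_point _)
    simp only [Set.indicator_apply, Set.mem_preimage, h2, true_and, Pi.one_apply]
  refine (lintegral_congr h1).trans ((lintegral_block fun u : Fin n =>
    if True ∧ f (point u) ∈ S then 1 else 0).trans ?_)
  simp only [true_and]
  rw [← Finset.mul_sum, Finset.sum_boole, mul_comm]

end Blocks

/-- The distance `D` between measures with finitely many atoms is given by `V`. -/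
def AtomicValue (D : {X : Type} → [MeasurableSpace X] → (X → X → ℝ) → Measure X → Measure X → ℝ)
    (V : (n m : ℕ) → (Fin n → Fin m → ℝ) → ℝ) : Prop :=
  ∀ {X : Type} [MeasurableSpace X] [MeasurableSingletonClass X] {n m : ℕ} [NeZero n] [NeZero m]
    {d : X → X → ℝ}, (Measurable fun z : X × X => d z.1 z.2) → (∀ x y, d x y = d y x) →
    (∀ x y, d x y ≤ 1) → (∀ x y, 0 ≤ d x y) → ∀ (A : Fin n → Prop) (B : Fin m → Prop)
    (i : Fin n → X) (j : Fin m → X), D d (atoms A i) (atoms B j) = V n m (atomCost d A B i j)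

theorem atomicValue_wasserstein : AtomicValue wasserstein fun _ _ => OT :=
  fun hd hs h1 h0 => wasserstein_atoms hd hs h1 h0

theorem atomicValue_prokhorov : AtomicValue prokhorov fun _ _ => PV :=
  fun _ hs _ _ => prokhorov_atoms hs

/-! ### Distances of graphs as values of the transport recursion. -/

section Graphs

variable {D : {X : Type} → [MeasurableSpace X] → (X → X → ℝ) → Measure X → Measure X → ℝ}
  {V : (n m : ℕ) → (Fin n → Fin m → ℝ) → ℝ} {n m : ℕ} [NeZero n] [NeZero m]
  (G : SimpleGraph (Fin n)) (H : SimpleGraph (Fin m))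

/-- The measure of a vertex at depth `h + 1` has an atom of mass `1 / n` for each neighbour, at that
neighbour's measure of depth `h`, so the atomic costs are those of the recursion. -/
theorem iterDist_graph (hD : WeakMetric D) (hV : AtomicValue D V) (h : ℕ) (u : Fin n) (v : Fin m) :
    iterDist D h ((graphon G).idm h (point u)) ((graphon H).idm h (point v)) =
      iterV V G H h u v := by
  induction h generalizing u v with
  | zero => rfl
  | succ h ih =>
    have hm := hD.metrizes_iterDist h
    change D (X := IDM h) (iterDist D h) (((graphon G).row (point u)).map ((graphon G).idm h))
      (((graphon H).row (point v)).map ((graphon H).idm h)) = V n m _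
    rw [map_row G _ (idm_graphon_congr G h), map_row H _ (idm_graphon_congr H h), block_point,
      block_point]
    refine (hV hm.measurable hm.comm (fun _ _ => hD.iterDist_le_one _ _) hm.nonneg _ _ _ _).trans
      (congrArg (V n m) ?_)
    funext u' v'
    simp only [atomCost, costR, ih]

/-- Here every vertex is an actual atom, so there are no dummies and the cost matrix is the matrix
of distances itself. -/
theorem delta_graph (hD : WeakMetric D) (hV : AtomicValue D V) (h : ℕ) :
    D (X := IDM h) (iterDist D h) (didm G h : Measure (IDM h)) (didm H h : Measure (IDM h)) =
      V n m (iterV V G H h) := by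
  have hm := hD.metrizes_iterDist h
  change D (X := IDM h) (iterDist D h) ((volume : Measure unitInterval).map ((graphon G).idm h))
      ((volume : Measure unitInterval).map ((graphon H).idm h)) = V n m _
  rw [map_volume (idm_graphon_congr G h), map_volume (idm_graphon_congr H h)]
  refine (hV hm.measurable hm.comm (fun _ _ => hD.iterDist_le_one _ _) hm.nonneg _ _ _ _).trans
    (congrArg (V n m) ?_)
  funext u' v'
  simp only [atomCost, if_true, iterDist_graph G H hD hV]

theorem supDist_graph (hD : WeakMetric D) (hV : AtomicValue D V) (u : Fin n) (v : Fin m) :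
    supDist D (idmInf G (point u)) (idmInf H (point v)) = supV V G H u v :=
  congrArg iSup (funext fun h => by rw [← iterDist_graph G H hD hV]; rfl)

theorem deltaInf_graph (hD : WeakMetric D) (hV : AtomicValue D V) :
    D (supDist D) (didmInf G : Measure IDMInf) (didmInf H : Measure IDMInf) =
      V n m (supV V G H) := by
  have hm := hD.metrizes_supDist
  have := hm.t2Space
  have hG : ∀ x y, block n x = block n y → idmInf G x = idmInf G y := fun x y hxy =>
    Subtype.ext (funext fun h => idm_graphon_congr G h x y hxy)
  have hH : ∀ x y, block m x = block m y → idmInf H x = idmInf H y := fun x y hxy =>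
    Subtype.ext (funext fun h => idm_graphon_congr H h x y hxy)
  change D (supDist D) ((volume : Measure unitInterval).map (idmInf G))
      ((volume : Measure unitInterval).map (idmInf H)) = V n m _
  rw [map_volume hG, map_volume hH]
  refine (hV hm.measurable hm.comm (fun _ _ => hD.supDist_le_one _ _) hm.nonneg _ _ _ _).trans
    (congrArg (V n m) ?_)
  funext u' v'
  simp only [atomCost, if_true, supDist_graph G H hD hV]

end Graphs

end IDMetric

end

open IDMetric in
theorem mainTheorem6 :
    -- the metrics based on the Prokhorov metric, for finite `h` and for `h = ∞`
    (∀ h : ℕ, ProkhorovDefined (dP h) ∧ Metrizes (dP h) ∧ Metrizes (deltaP h)) ∧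
    (∀ α β : IDMInf, BddAbove (Set.range fun h : ℕ =>
      dP (h + 1) (α.1 (h + 1)) (β.1 (h + 1)) / ((h : ℝ) + 1))) ∧
    (ProkhorovDefined dPInf ∧ Metrizes dPInf ∧ Metrizes deltaPInf) ∧
    -- the metrics based on the unbalanced Wasserstein metric
    (∀ h : ℕ, WassersteinDefined (dW h) ∧ Metrizes (dW h) ∧ Metrizes (deltaW h)) ∧
    (∀ α β : IDMInf, BddAbove (Set.range fun h : ℕ =>
      dW (h + 1) (α.1 (h + 1)) (β.1 (h + 1)) / ((h : ℝ) + 1))) ∧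
    (WassersteinDefined dWInf ∧ Metrizes dWInf ∧ Metrizes deltaWInf) ∧
    -- computability on graphs for finite `h`
    PolyTime (withRounds VertexPair.enc) (fun i => i.1.size + i.2)
      (fun i => dP i.2 ((graphon i.1.G).idm i.2 (point i.1.u))
        ((graphon i.1.H).idm i.2 (point i.1.v))) ∧
    PolyTime (withRounds GraphPair.enc) (fun i => i.1.size + i.2)
      (fun i => deltaP i.2 (didm i.1.G i.2) (didm i.1.H i.2)) ∧
    PolyTime (withRounds VertexPair.enc) (fun i => i.1.size + i.2)
      (fun i => dW i.2 ((graphon i.1.G).idm i.2 (point i.1.u))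
        ((graphon i.1.H).idm i.2 (point i.1.v))) ∧
    PolyTime (withRounds GraphPair.enc) (fun i => i.1.size + i.2)
      (fun i => deltaW i.2 (didm i.1.G i.2) (didm i.1.H i.2)) ∧
    -- computability on graphs for `h = ∞`
    PolyTime VertexPair.enc (fun i => i.size)
      (fun i => dPInf (idmInf i.G (point i.u)) (idmInf i.H (point i.v))) ∧
    PolyTime GraphPair.enc (fun i => i.size)
      (fun i => deltaPInf (didmInf i.G) (didmInf i.H)) ∧
    PolyTimeApprox VertexPair.enc (fun i => i.size)
      (fun i => dWInf (idmInf i.G (point i.u)) (idmInf i.H (point i.v))) ∧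
    PolyTimeApprox GraphPair.enc (fun i => i.size)
      (fun i => deltaWInf (didmInf i.G) (didmInf i.H)) := by
  have hP := weakMetric_prokhorov
  have hW := weakMetric_wasserstein
  have mP := hP.metrizes_iterDist
  have mW := hW.metrizes_iterDist
  have mPI := hP.metrizes_supDist
  have mWI := hW.metrizes_supDist
  refine ⟨fun h => ⟨prokhorovDefined_of_compact (mP h), mP h,
      hP.metrizes_probabilityMeasure (mP h) fun _ _ => hP.iterDist_le_one _ _⟩,
    hP.bddAbove,
    ⟨prokhorovDefined_of_compact mPI, mPI,
      hP.metrizes_probabilityMeasure mPI hP.supDist_le_one⟩,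
    fun h => ⟨wassersteinDefined_of_compact (mW h) fun _ _ => hW.iterDist_le_one _ _, mW h,
      hW.metrizes_probabilityMeasure (mW h) fun _ _ => hW.iterDist_le_one _ _⟩,
    hW.bddAbove,
    ⟨wassersteinDefined_of_compact mWI hW.supDist_le_one, mWI,
      hW.metrizes_probabilityMeasure mWI hW.supDist_le_one⟩, ?_, ?_, ?_, ?_, ?_, ?_, ?_, ?_⟩
  · simpa only [dP, iterDist_graph _ _ hP atomicValue_prokhorov] using
      polyTime_vertex PT.solveP solves_P unitBounded_PV
  · simpa only [deltaP, dP, delta_graph _ _ hP atomicValue_prokhorov] using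
      polyTime_graph PT.solveP solves_P unitBounded_PV
  · simpa only [dW, iterDist_graph _ _ hW atomicValue_wasserstein] using
      polyTime_vertex PT.solveW solves_W unitBounded_OT
  · simpa only [deltaW, dW, delta_graph _ _ hW atomicValue_wasserstein] using
      polyTime_graph PT.solveW solves_W unitBounded_OT
  · have h : ∀ i : VertexPair, dPInf (idmInf i.G (point i.u)) (idmInf i.H (point i.v)) =
        supV (fun _ _ => PV) i.G i.H i.u i.v :=
      fun i => supDist_graph _ _ hP atomicValue_prokhorov _ _
    simpa only [h] using polyTime_vertex_sup_PV
  · have h : ∀ i : GraphPair, deltaPInf (didmInf i.G) (didmInf i.H) =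
        PV (supV (fun _ _ => PV) i.G i.H) :=
      fun i => deltaInf_graph _ _ hP atomicValue_prokhorov
    simpa only [h] using polyTime_graph_sup_PV
  · have h : ∀ i : VertexPair, dWInf (idmInf i.G (point i.u)) (idmInf i.H (point i.v)) =
        supV (fun _ _ => OT) i.G i.H i.u i.v :=
      fun i => supDist_graph _ _ hW atomicValue_wasserstein _ _
    simpa only [h] using polyTimeApprox_vertex_sup_OT
  · have h : ∀ i : GraphPair, deltaWInf (didmInf i.G) (didmInf i.H) =
        OT (supV (fun _ _ => OT) i.G i.H) :=
      fun i => deltaInf_graph _ _ hW atomicValue_wasserstein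
    simpa only [h] using polyTimeApprox_graph_sup_OT
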